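/- Let $p$ be a prime and let $e,n,r\ge 1$ be integers. For $m\ge 1$ let $P^{2m+1}(p^e)=S^{2m}\cup_{p^e}e^{2m+1}$ be the mod $p^e$ Moore space (the reduced mapping cone of the degree $p^e$ map of $S^{2m}$), with the pinch map $P^{2m+1}(p^e)\to S^{2m+1}$ that collapses $S^{2m}$. Let $F_m$ be the homotopy fiber of this pinch map, i.e. the space of pairs of a point $y\in P^{2m+1}(p^e)$ and a path in $S^{2m+1}$ from the image of $y$ to the base point. Let $S^{2n}\times\Omega S^{2n+1}\to F_n$ be the inclusion $(x,\omega)\mapsto (x,\omega)$ of the part of $F_n$ over $S^{2n}\subset P^{2n+1}(p^e)$. Let $H_{r-1}\colon \Omega S^{2n+1}\to\Omega S^{2(r-1)n+1}$ be any choice of $(r-1)$-st James--Hopf invariant: a map which on products $x_1x_2\cdots x_l$ ($l\ge 0$) of elements of $S^{2n}\to\Omega S^{2n+1}$ is given, up to homotopy, by $$x_1\cdots x_l\longmapsto \prod_{i_1<\dots<i_{r-1}} x_{i_1}\wedge\dots\wedge x_{i_{r-1}}\in\Omega S^{2(r-1)n+1},$$ the factors being taken in the order given by some fixed strict total order on increasing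 $(r-1)$-tuples of natural numbers that is invariant under strictly increasing maps of $\mathbb N$ (for $r=1$ this says that $H_0$ is homotopic to the constant map at a generating loop of $\Omega S^1$). Let $c\colon S^{2n}\times\Omega S^{2(r-1)n+1}\to S^{2rn}$ be the map $(u\wedge t,\omega)\mapsto u\wedge\omega(t)$, where $S^{2n}=S^{2n-1}\wedge S^1$, $S^1=[0,1]/\{0,1\}$ and $S^{2n-1}\wedge S^{2(r-1)n+1}=S^{2rn}$. Then there is a pointed map $h\colon F_n\to F_{rn}$ such that the composition $$S^{2n}\times\Omega S^{2n+1}\longrightarrow F_n\stackrel{h}{\longrightarrow}F_{rn}\longrightarrow P^{2rn+1}(p^e)$$ is (pointed) homotopic to $$S^{2n}\times\Omega S^{2n+1}\stackrel{1\times H_{r-1}}{\longrightarrow}S^{2n}\times\Omega S^{2(r-1)n+1}\stackrel{c}{\longrightarrow}S^{2rn}\longrightarrow P^{2rn+1}(p^e).$$ In particular, for every map $h\colon F_n\to F_{rn}$ for which these two compositions are homotopic, $h_*\colon H_{2rn}(F_n;\mathbb Z_{(p)})\to H_{2rn}(F_{rn};\mathbb Z_{(p)})$ is an isomorphism. -/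

import Mathlib

open CategoryTheory Topology
open scoped unitInterval OnePoint

noncomputable section

namespace HopfFiber

/-! ### Spheres -/

/-- The `m`-sphere, as the one-point compactification of `ℝᵐ`, with base point `∞`
(for `m = 0` this is a two-point discrete space). -/
abbrev Sph (m : ℕ) : Type := OnePoint (Fin m → ℝ)

/-- `S^a × S^b ⟶ S^a ∧ S^b = S^(a+b)` as a function: juxtaposition of coordinates on
`ℝᵃ × ℝᵇ`, and `∞` as soon as one of the two entries is `∞`. -/
def smashFun {a b c : ℕ} (h : a + b = c) (z : Sph a × Sph b) : Sph c :=
  z.1.elim ∞ fun v => z.2.elim ∞ fun w => ((Fin.append v w ∘ Fin.cast h.symm : Fin c → ℝ) : Sph c)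

/-- `(S^m)^k ⟶ (S^m)^{∧k} = S^(km)` as a function: juxtaposition of coordinates if all entries
are finite, and `∞` otherwise. For `k = 0` its value is the point of `S^0` other than `∞`. -/
def smashPowFun {k m c : ℕ} (h : k * m = c) (z : Fin k → Sph m) : Sph c :=
  open Classical in
  if hz : ∃ v : Fin k → Fin m → ℝ, z = fun i => ((v i : Fin m → ℝ) : Sph m) then
    ((fun j : Fin c => hz.choose (finProdFinEquiv.symm (Fin.cast h.symm j)).1
      (finProdFinEquiv.symm (Fin.cast h.symm j)).2 : Fin c → ℝ) : Sph c)
  else ∞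

theorem continuous_to_onePoint {Z V : Type*} [TopologicalSpace Z] [TopologicalSpace V]
    {f : Z → OnePoint V}
    (h1 : ∀ U : Set V, IsOpen U → IsOpen (f ⁻¹' ((↑) '' U)))
    (h2 : ∀ K : Set V, IsCompact K → ∀ z, f z = ∞ → ∀ᶠ y in 𝓝 z, f y ∉ ((↑) '' K : Set (OnePoint V))) :
    Continuous f := by
  rw [continuous_def]
  intro s hs
  rw [isOpen_iff_mem_nhds]
  intro z hz
  rw [OnePoint.isOpen_def] at hs
  rcases hfz : f z with _ | v
  · have hi : ∞ ∈ s := by rw [← show f z = ∞ from hfz]; exact hz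
    filter_upwards [h2 _ (hs.1 hi) z hfz] with y hy
    by_contra hys
    apply hy
    rcases hfy : f y with _ | u
    · exact absurd (show f y ∈ s by rw [hfy]; exact hi) hys
    · exact ⟨u, fun hu => hys (by show f y ∈ s; rw [hfy]; exact hu), rfl⟩
  · refine Filter.mem_of_superset ((h1 _ hs.2).mem_nhds (x := z) ⟨v, ?_, hfz.symm⟩) ?_
    · show (v : OnePoint V) ∈ s
      rw [← show f z = v from hfz]; exact hz
    · rintro y ⟨u, hu, huy⟩
      show f y ∈ s
      rw [← huy]; exact hu

theorem continuous_smashFun {a b c : ℕ} (h : a + b = c) : Continuous (smashFun h) := by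
  have hj : Continuous fun p : (Fin a → ℝ) × (Fin b → ℝ) =>
      (Fin.append p.1 p.2 ∘ Fin.cast h.symm : Fin c → ℝ) := by
    refine continuous_pi fun i => ?_
    simp only [Function.comp]
    refine Fin.addCases (fun j => ?_) (fun j => ?_) (Fin.cast h.symm i)
    · simp only [Fin.append_left]; fun_prop
    · simp only [Fin.append_right]; fun_prop
  apply continuous_to_onePoint
  · intro U hU
    have : smashFun h ⁻¹' ((↑) '' U) = Prod.map (↑) (↑) ''
        ((fun p : (Fin a → ℝ) × (Fin b → ℝ) =>
          (Fin.append p.1 p.2 ∘ Fin.cast h.symm : Fin c → ℝ)) ⁻¹' U) := by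
      ext ⟨x, y⟩
      induction x using OnePoint.rec <;> induction y using OnePoint.rec <;>
        simp [smashFun]
    rw [this]
    exact (OnePoint.isOpenMap_coe.prodMap OnePoint.isOpenMap_coe) _ (hU.preimage hj)
  · rintro K hK ⟨x, y⟩ hxy
    subst h
    have hx : IsCompact ((fun (v : Fin (a + b) → ℝ) (i : Fin a) => v (Fin.castAdd b i)) '' K) :=
      hK.image (by fun_prop)
    have hy : IsCompact ((fun (v : Fin (a + b) → ℝ) (i : Fin b) => v (Fin.natAdd a i)) '' K) :=
      hK.image (by fun_prop)
    have hox := (OnePoint.isOpen_compl_image_coe (X := Fin a → ℝ)).2 ⟨hx.isClosed, hx⟩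
    have hoy := (OnePoint.isOpen_compl_image_coe (X := Fin b → ℝ)).2 ⟨hy.isClosed, hy⟩
    have key : ∀ (z : Sph a × Sph b), smashFun rfl z ∈ ((↑) '' K : Set (Sph (a + b))) →
        z.1 ∈ ((↑) '' ((fun (v : Fin (a + b) → ℝ) (i : Fin a) => v (Fin.castAdd b i)) '' K) :
          Set (Sph a)) ∧
        z.2 ∈ ((↑) '' ((fun (v : Fin (a + b) → ℝ) (i : Fin b) => v (Fin.natAdd a i)) '' K) :
          Set (Sph b)) := by
      rintro ⟨x, y⟩ hz
      induction x using OnePoint.rec <;> induction y using OnePoint.rec <;>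
        simp [smashFun] at hz ⊢
      rename_i v w
      exact ⟨⟨_, hz, by ext; simp⟩, ⟨_, hz, by ext; simp⟩⟩
    by_cases hx' : x = ∞
    · filter_upwards [(hox.preimage continuous_fst).mem_nhds (x := (x, y)) (by simp [hx'])]
        with z hz hzK using hz (key z hzK).1
    · have hy' : y = ∞ := by
        induction x using OnePoint.rec <;> induction y using OnePoint.rec <;>
          simp_all [smashFun]
      filter_upwards [(hoy.preimage continuous_snd).mem_nhds (x := (x, y)) (by simp [hy'])]
        with z hz hzK using hz (key z hzK).2

theorem smashPowFun_coe {k m c : ℕ} (h : k * m = c) (v : Fin k → Fin m → ℝ) :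
    smashPowFun h (fun i => ((v i : Fin m → ℝ) : Sph m)) =
      ((fun j : Fin c => v (finProdFinEquiv.symm (Fin.cast h.symm j)).1
        (finProdFinEquiv.symm (Fin.cast h.symm j)).2 : Fin c → ℝ) : Sph c) := by
  have hz : ∃ v' : Fin k → Fin m → ℝ, (fun i => ((v i : Fin m → ℝ) : Sph m)) =
      fun i => ((v' i : Fin m → ℝ) : Sph m) := ⟨v, rfl⟩
  have hv : hz.choose = v := by
    funext i
    exact (OnePoint.coe_injective (congrFun hz.choose_spec i)).symm
  rw [smashPowFun, dif_pos hz, hv]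

theorem smashPowFun_of_eq_infty {k m c : ℕ} (h : k * m = c) {z : Fin k → Sph m} {i : Fin k}
    (hi : z i = ∞) : smashPowFun h z = ∞ := by
  rw [smashPowFun, dif_neg]
  rintro ⟨v, rfl⟩
  exact OnePoint.coe_ne_infty _ hi

theorem continuous_smashPowFun {k m c : ℕ} (h : k * m = c) :
    Continuous (smashPowFun h : (Fin k → Sph m) → Sph c) := by
  have hcase : ∀ z : Fin k → Sph m, (∃ i, z i = ∞) ∨
      ∃ v : Fin k → Fin m → ℝ, z = fun i => ((v i : Fin m → ℝ) : Sph m) := by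
    intro z
    by_cases hz : ∃ i, z i = ∞
    · exact Or.inl hz
    · push Not at hz
      choose v hv using fun i => OnePoint.ne_infty_iff_exists.1 (hz i)
      exact Or.inr ⟨v, funext fun i => (hv i).symm⟩
  apply continuous_to_onePoint
  · intro U hU
    have : smashPowFun h ⁻¹' ((↑) '' U) = (Pi.map fun (_ : Fin k) (v : Fin m → ℝ) => (v : Sph m)) ''
        ((fun (v : Fin k → Fin m → ℝ) (j : Fin c) => v (finProdFinEquiv.symm (Fin.cast h.symm j)).1
          (finProdFinEquiv.symm (Fin.cast h.symm j)).2) ⁻¹' U) := by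
      ext z
      rcases hcase z with ⟨i, hi⟩ | ⟨v, rfl⟩
      · simp only [Set.mem_preimage, smashPowFun_of_eq_infty h hi]
        constructor
        · rintro ⟨u, -, hu⟩; exact absurd hu (OnePoint.coe_ne_infty u)
        · rintro ⟨v, -, rfl⟩; exact absurd hi (OnePoint.coe_ne_infty _)
      · simp only [Set.mem_preimage, smashPowFun_coe]
        constructor
        · rintro ⟨u, hu, huv⟩
          refine ⟨v, ?_, rfl⟩
          rw [OnePoint.coe_injective huv] at hu; exact hu
        · rintro ⟨v', hv', hvv⟩
          have : v' = v := funext fun i => OnePoint.coe_injective (congrFun hvv i)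
          subst this
          exact ⟨_, hv', rfl⟩
    rw [this]
    refine IsOpenMap.piMap (fun _ => OnePoint.isOpenMap_coe) (by simp) _ (hU.preimage ?_)
    fun_prop
  · intro K hK z hz
    rcases hcase z with ⟨i, hi⟩ | ⟨v, rfl⟩
    · subst h
      have hc : IsCompact ((fun (v : Fin (k * m) → ℝ) (j : Fin m) => v (finProdFinEquiv (i, j))) '' K) :=
        hK.image (by fun_prop)
      have ho := (OnePoint.isOpen_compl_image_coe (X := Fin m → ℝ)).2 ⟨hc.isClosed, hc⟩
      filter_upwards [(ho.preimage (continuous_apply i)).mem_nhds (x := z) (by simp [hi])]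
        with y hy hyK
      rcases hcase y with ⟨j, hj⟩ | ⟨v, rfl⟩
      · rw [smashPowFun_of_eq_infty rfl hj] at hyK
        obtain ⟨u, -, hu⟩ := hyK
        exact OnePoint.coe_ne_infty u hu
      · rw [smashPowFun_coe] at hyK
        obtain ⟨u, hu, huv⟩ := hyK
        refine hy ⟨_, ⟨u, hu, rfl⟩, ?_⟩
        rw [OnePoint.coe_injective huv]
        simp
    · rw [smashPowFun_coe] at hz
      exact absurd hz (OnePoint.coe_ne_infty _)

/-- The quotient map `S^a × S^b ⟶ S^a ∧ S^b = S^c`, `c = a + b`. -/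
def smash {a b c : ℕ} (h : a + b = c) : C(Sph a × Sph b, Sph c) := ⟨smashFun h, continuous_smashFun h⟩

/-- The quotient map `(S^m)^k ⟶ (S^m)^{∧k} = S^c`, `c = k m`. -/
def smashPow {k m c : ℕ} (h : k * m = c) : C(Fin k → Sph m, Sph c) :=
  ⟨smashPowFun h, continuous_smashPowFun h⟩

@[simp] theorem smash_infty_left {a b c : ℕ} (h : a + b = c) (y : Sph b) : smash h (∞, y) = ∞ := rfl

@[simp] theorem smash_infty_right {a b c : ℕ} (h : a + b = c) (x : Sph a) :
    smash h (x, ∞) = ∞ := by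
  induction x using OnePoint.rec <;> rfl

/-! ### The circle as a quotient of the real line -/

/-- The map `t ↦ -cot (π t)` from `ℝ` to `S^1 = ℝ ∪ {∞}`; it sends all integers to `∞`, has
period `1`, and maps `(0, 1)` homeomorphically and increasingly onto `ℝ`. It identifies
`[0,1]/{0,1}` with `S^1`. -/
def wind (t : ℝ) : Sph 1 :=
  open Classical in
  if Real.sin (Real.pi * t) = 0 then ∞
  else ((fun _ => -(Real.cos (Real.pi * t) / Real.sin (Real.pi * t)) : Fin 1 → ℝ) : Sph 1)

/-- The inverse `ℝ ⟶ (0,1)` of `wind`. -/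
def unwind (s : ℝ) : I :=
  ⟨1 / 2 + Real.arctan s / Real.pi, by
    have h1 := Real.neg_pi_div_two_lt_arctan s
    have h2 := Real.arctan_lt_pi_div_two s
    have hpi := Real.pi_pos
    constructor
    · have : -(1 / 2) < Real.arctan s / Real.pi := by
        rw [lt_div_iff₀ hpi]; linarith
      linarith
    · have : Real.arctan s / Real.pi < 1 / 2 := by
        rw [div_lt_iff₀ hpi]; linarith
      linarith⟩

theorem continuous_wind : Continuous wind := by
  have hs : Continuous fun t : ℝ => Real.sin (Real.pi * t) := by fun_prop
  have hc : Continuous fun t : ℝ => Real.cos (Real.pi * t) := by fun_prop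
  apply continuous_to_onePoint
  · intro U hU
    rw [isOpen_iff_mem_nhds]
    rintro t ⟨u, hu, hut⟩
    have ht : Real.sin (Real.pi * t) ≠ 0 := by
      intro h0
      rw [wind, if_pos h0] at hut
      exact OnePoint.coe_ne_infty u hut
    rw [wind, if_neg ht] at hut
    have hu' := OnePoint.coe_injective hut
    have hcont : ContinuousAt (fun t : ℝ =>
        (fun _ => -(Real.cos (Real.pi * t) / Real.sin (Real.pi * t)) : Fin 1 → ℝ)) t :=
      continuousAt_pi.2 fun _ => (hc.continuousAt.div hs.continuousAt ht).neg
    filter_upwards [hcont.preimage_mem_nhds (hU.mem_nhds (by rw [← hu']; exact hu)),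
      hs.continuousAt.eventually_ne ht] with y hy hy0
    exact ⟨_, hy, by rw [wind, if_neg hy0]⟩
  · intro K hK t ht
    have ht0 : Real.sin (Real.pi * t) = 0 := by
      by_contra h0
      rw [wind, if_neg h0] at ht
      exact OnePoint.coe_ne_infty _ ht
    obtain ⟨M, hM⟩ := (hK.image (continuous_apply (0 : Fin 1))).isBounded.exists_norm_le
    have hct : Real.cos (Real.pi * t) ≠ 0 := by
      intro h0
      have := Real.sin_sq_add_cos_sq (Real.pi * t)
      rw [h0, ht0] at this
      norm_num at this
    have hlt : M * |Real.sin (Real.pi * t)| < |Real.cos (Real.pi * t)| := by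
      rw [ht0, abs_zero, mul_zero]; exact abs_pos.2 hct
    have hop : IsOpen {t : ℝ | M * |Real.sin (Real.pi * t)| < |Real.cos (Real.pi * t)|} :=
      isOpen_lt (by fun_prop) (by fun_prop)
    filter_upwards [hop.mem_nhds hlt] with y hy hyK
    obtain ⟨u, hu, huy⟩ := hyK
    by_cases hy0 : Real.sin (Real.pi * y) = 0
    · rw [wind, if_pos hy0] at huy; exact OnePoint.coe_ne_infty _ huy
    · rw [wind, if_neg hy0] at huy
      have hb := hM _ ⟨u, hu, rfl⟩
      rw [OnePoint.coe_injective huy, Real.norm_eq_abs, abs_neg, abs_div,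
        div_le_iff₀ (abs_pos.2 hy0)] at hb
      exact absurd hy (not_lt.2 hb)

theorem wind_unwind (s : ℝ) : wind (unwind s) = ((fun _ => s : Fin 1 → ℝ) : Sph 1) := by
  have e : Real.pi * (1 / 2 + Real.arctan s / Real.pi) = Real.arctan s + Real.pi / 2 := by
    field_simp; ring
  have hc := Real.cos_arctan_pos s
  rw [wind, unwind]
  simp only [e, Real.sin_add_pi_div_two, Real.cos_add_pi_div_two]
  rw [if_neg hc.ne']
  congr 1
  funext _
  rw [neg_div, neg_neg, ← Real.tan_eq_sin_div_cos, Real.tan_arctan]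

theorem wind_int (z : ℤ) : wind z = ∞ := by
  rw [wind, if_pos]
  rw [mul_comm]; exact Real.sin_int_mul_pi z

@[simp] theorem wind_zero : wind 0 = ∞ := by simpa using wind_int 0

@[simp] theorem wind_one : wind 1 = ∞ := by simpa using wind_int 1

theorem unwind_of_wind_eq {t : I} {s : Fin 1 → ℝ} (h : wind t = (s : Sph 1)) :
    unwind (s 0) = t := by
  have hs : Real.sin (Real.pi * t) ≠ 0 := by
    intro h0
    rw [wind, if_pos h0] at h
    exact OnePoint.infty_ne_coe s h
  rw [wind, if_neg hs] at h
  have h' := OnePoint.coe_injective h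
  have hpi := Real.pi_pos
  have t0 : 0 < (t : ℝ) := lt_of_le_of_ne t.2.1 fun h0 => hs (by rw [← h0]; simp)
  have t1 : (t : ℝ) < 1 := lt_of_le_of_ne t.2.2 fun h0 => hs (by rw [h0]; simp)
  have e : s 0 = Real.tan (Real.pi * t - Real.pi / 2) := by
    rw [← h', Real.tan_eq_sin_div_cos, Real.sin_sub_pi_div_two, Real.cos_sub_pi_div_two, neg_div]
  apply Subtype.ext
  simp only [unwind]
  rw [e, Real.arctan_tan (by nlinarith) (by nlinarith)]
  field_simp
  ring

theorem exists_wind_eq (x : Sph 1) : ∃ t : I, wind t = x := by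
  induction x using OnePoint.rec with
  | infty => exact ⟨0, by simp⟩
  | coe s => exact ⟨unwind (s 0), by rw [wind_unwind]; congr 1; funext i; rw [Subsingleton.elim i 0]⟩

/-! ### Loop spaces -/

/-- The loop space `Ω S^m`, with the compact-open topology. -/
abbrev LoopSph (m : ℕ) : Type := LoopSpace (Sph m) (∞ : Sph m)

/-- The quotient map `[0,1] × S^m ⟶ S^1 ∧ S^m = S^(m+1)`; the suspension coordinate is
the first one. -/
def susp (m : ℕ) : C(I × Sph m, Sph (m + 1)) :=
  (smash (Nat.add_comm 1 m)).comp
    (ContinuousMap.prodMap ⟨fun t : I => wind t, continuous_wind.comp continuous_subtype_val⟩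
      (ContinuousMap.id _))

/-- The canonical map `S^m ⟶ Ω S^(m+1)`, adjoint to the identity of `S^(m+1)`. -/
def suspLoop (m : ℕ) : C(Sph m, LoopSph (m + 1)) where
  toFun x :=
    { toFun := fun t => susp m (t, x)
      continuous_toFun := by fun_prop
      source' := by simp [susp]
      target' := by simp [susp] }
  continuous_toFun := by
    apply Path.continuous_uncurry_iff.1
    exact (susp m).continuous.comp continuous_swap

/-- The product of two maps into a loop space: pointwise concatenation of loops. -/
def loopMul {Y : Type*} [TopologicalSpace Y] {m : ℕ} (f g : C(Y, LoopSph m)) : C(Y, LoopSph m) :=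
  ⟨fun y => (f y).trans (g y), by fun_prop⟩

/-- The product `f₁ ⋯ f_l` of a list of maps into a loop space. -/
def loopProd {Y : Type*} [TopologicalSpace Y] {m : ℕ} (l : List C(Y, LoopSph m)) :
    C(Y, LoopSph m) :=
  l.foldr loopMul (ContinuousMap.const Y (Path.refl ∞))

/-! ### James--Hopf invariants -/

/-- A rule that puts the `k`-letter subsequences of every finite sequence in an order that does not
change when other letters are inserted or deleted: a strict total order on the strictly increasing
`k`-tuples of natural numbers that is invariant under strictly increasing maps `ℕ → ℕ`.
(The lexicographic orders are examples.) -/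
structure SubseqOrder (k : ℕ) where
  lt : (Fin k ↪o ℕ) → (Fin k ↪o ℕ) → Prop
  isStrictTotalOrder : IsStrictTotalOrder (Fin k ↪o ℕ) lt
  invariant : ∀ (φ : ℕ ↪o ℕ) (s t : Fin k ↪o ℕ), lt s t → lt (s.trans φ) (t.trans φ)

/-- A `k`-th James--Hopf invariant `H : Ω S^(m+1) ⟶ Ω S^(km+1)`: for some admissible order of the
`k`-letter subsequences, `H` is given by James' formula
`x₁ x₂ ⋯ x_l ↦ ∏_{i₁ < ⋯ < i_k} x_{i₁} ∧ ⋯ ∧ x_{i_k}`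
(the product is taken in the chosen order), up to homotopy, on the products of any number `l` of
letters from `S^m ⟶ Ω S^(m+1)`. -/
def IsJamesHopf {k m c : ℕ} (hc : k * m = c) (H : C(LoopSph (m + 1), LoopSph (c + 1))) : Prop :=
  ∃ ord : SubseqOrder k, ∀ l : ℕ, ∃ L : List (Fin k ↪o Fin l),
    (∀ s, s ∈ L) ∧
    L.Pairwise (fun s t => ord.lt (s.trans (Fin.valOrderEmb l)) (t.trans (Fin.valOrderEmb l))) ∧
    ContinuousMap.Homotopic
      (H.comp (loopProd (List.ofFn fun i : Fin l =>
        ((suspLoop m).comp ⟨fun x : Fin l → Sph m => x i, continuous_apply i⟩))))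
      (loopProd (L.map fun s =>
        (suspLoop c).comp ((smashPow hc).comp
          ⟨fun x : Fin l → Sph m => fun j => x (s j), by fun_prop⟩)))

/-! ### The collapse `S^a × Ω S^(m+1) ⟶ S^(a+m)` -/

/-- The map `S^a × Ω S^(m+1) ⟶ S^a ∧ Ω S^(m+1) ⟶ S^a ∧ S^m = S^c`, for `a ≥ 1`, as a function.
It uses the suspension structure `S^a = S^(a-1) ∧ S^1` and the evaluation
`S^1 ∧ Ω S^(m+1) ⟶ S^(m+1) = S^1 ∧ S^m`; that is, `(u ∧ t, ω) ↦ u ∧ ω(t)`. -/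
def collapseFun {a m c : ℕ} (ha : 0 < a) (h : a + m = c) (z : Sph a × LoopSph (m + 1)) : Sph c :=
  z.1.elim ∞ fun v =>
    smash (a := a - 1) (b := m + 1) (by omega)
      (((fun i => v ⟨i, by omega⟩ : Fin (a - 1) → ℝ) : Sph (a - 1)),
        z.2 (unwind (v ⟨a - 1, by omega⟩)))

theorem collapseFun_smash {a m c : ℕ} (ha : 0 < a) (h : a + m = c) (u : Sph (a - 1)) (t : I)
    (ω : LoopSph (m + 1)) :
    collapseFun ha h (smash (a := a - 1) (b := 1) (by omega) (u, wind t), ω) =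
      smash (a := a - 1) (b := m + 1) (by omega) (u, ω t) := by
  induction u using OnePoint.rec with
  | infty => rfl
  | coe u =>
    by_cases hs : wind t = ∞
    · have ht : t = 0 ∨ t = 1 := by
        by_contra hne
        push Not at hne
        have t0 : 0 < (t : ℝ) := lt_of_le_of_ne t.2.1 fun h0 => hne.1 (Subtype.ext h0.symm)
        have t1 : (t : ℝ) < 1 := lt_of_le_of_ne t.2.2 fun h0 => hne.2 (Subtype.ext h0)
        have : 0 < Real.sin (Real.pi * t) :=
          Real.sin_pos_of_pos_of_lt_pi (by have := Real.pi_pos; positivity)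
            (by have := Real.pi_pos; nlinarith)
        rw [wind, if_neg this.ne'] at hs
        exact OnePoint.coe_ne_infty _ hs
      have hω : ω t = ∞ := by
        rcases ht with rfl | rfl
        · exact ω.source
        · exact ω.target
      rw [hs, hω, smash_infty_right, smash_infty_right]
      rfl
    · obtain ⟨s, hs'⟩ := OnePoint.ne_infty_iff_exists.1 hs
      have hu := unwind_of_wind_eq hs'.symm
      obtain ⟨b, rfl⟩ : ∃ b, a = b + 1 := ⟨a - 1, by omega⟩
      rw [← hs', ← hu]
      change smash _ _ = _
      congr 2
      · congr 1
        funext i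
        exact Fin.append_left u s i
      · congr 2
        exact Fin.append_right u s 0

theorem continuous_collapseFun {a m c : ℕ} (ha : 0 < a) (h : a + m = c) :
    Continuous (collapseFun (m := m) ha h) := by
  let g : Sph (a - 1) × I → Sph a := fun p =>
    smash (a := a - 1) (b := 1) (by omega) (p.1, wind p.2)
  have hg : Continuous g :=
    (smash _).continuous.comp (continuous_fst.prodMk
      (continuous_wind.comp (continuous_subtype_val.comp continuous_snd)))
  have hsurj : Function.Surjective g := by
    intro x
    induction x using OnePoint.rec with
    | infty => exact ⟨(∞, 0), rfl⟩
    | coe v =>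
      obtain ⟨b, rfl⟩ : ∃ b, a = b + 1 := ⟨a - 1, by omega⟩
      refine ⟨(((fun i => v i.castSucc : Fin b → ℝ) : Sph b), unwind (v (Fin.last b))), ?_⟩
      simp only [g, wind_unwind]
      change ((_ : Fin (b + 1) → ℝ) : Sph (b + 1)) = _
      congr 1
      funext i
      refine Fin.lastCases ?_ (fun j => ?_) i
      · exact Fin.append_right (fun i : Fin b => v i.castSucc) (fun _ : Fin 1 => v (Fin.last b)) 0
      · exact Fin.append_left (fun i : Fin b => v i.castSucc) (fun _ : Fin 1 => v (Fin.last b)) j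
  have hp : IsProperMap (Prod.map g (id : LoopSph (m + 1) → LoopSph (m + 1))) :=
    hg.isProperMap.prodMap isProperMap_id
  have hq := hp.isClosedMap.isQuotientMap hp.continuous (hsurj.prodMap Function.surjective_id)
  rw [hq.continuous_iff]
  have : collapseFun (m := m) ha h ∘ Prod.map g id = fun p =>
      smash (a := a - 1) (b := m + 1) (by omega) (p.1.1, p.2 p.1.2) := by
    funext ⟨⟨u, t⟩, ω⟩
    exact collapseFun_smash ha h u t ω
  rw [this]
  refine (smash _).continuous.comp ((continuous_fst.comp continuous_fst).prodMk ?_)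
  exact continuous_snd.eval (continuous_snd.comp continuous_fst)

/-- The map `S^a × Ω S^(m+1) ⟶ S^c`, `c = a + m`, `(u ∧ t, ω) ↦ u ∧ ω(t)`. -/
def collapse {a m c : ℕ} (ha : 0 < a) (h : a + m = c) : C(Sph a × LoopSph (m + 1), Sph c) :=
  ⟨collapseFun ha h, continuous_collapseFun ha h⟩

/-! ### Moore spaces and the fibre of the pinch map -/

/-- The degree `d` self-map of `S^(m+1) = S^1 ∧ S^m` as a function: the map of the circle
`wind t ↦ wind (d t)` on the first coordinate, and the identity on the others. -/
def degFun (d m : ℕ) (x : Sph (m + 1)) : Sph (m + 1) :=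
  x.elim ∞ fun v => smash (Nat.add_comm 1 m)
    (wind (d * unwind (v 0)), ((fun i => v i.succ : Fin m → ℝ) : Sph m))

theorem smash_cons {m : ℕ} (s : Fin 1 → ℝ) (u : Fin m → ℝ) :
    smash (Nat.add_comm 1 m) (((s : Fin 1 → ℝ) : Sph 1), ((u : Fin m → ℝ) : Sph m)) =
      ((Fin.cons (s 0) u : Fin (m + 1) → ℝ) : Sph (m + 1)) := by
  change ((_ : Fin (m + 1) → ℝ) : Sph (m + 1)) = _
  congr 1
  funext i
  refine Fin.cases ?_ (fun j => ?_) i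
  · exact Fin.append_left s u 0
  · have : Fin.cast (Nat.add_comm 1 m).symm j.succ = Fin.natAdd 1 j := by
      ext; simp [Nat.add_comm]
    simp only [Function.comp, this, Fin.append_right, Fin.cons_succ]

theorem degFun_susp (d m : ℕ) (t : I) (x : Sph m) :
    degFun d m (susp m (t, x)) = smash (Nat.add_comm 1 m) (wind (d * t), x) := by
  change degFun d m (smash (Nat.add_comm 1 m) (wind t, x)) = _
  induction x using OnePoint.rec with
  | infty => rw [smash_infty_right, smash_infty_right]; rfl
  | coe u =>
    by_cases hs : wind t = ∞
    · have : ∃ z : ℤ, (t : ℝ) = z := by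
        have h0 : Real.sin (Real.pi * t) = 0 := by
          by_contra h0
          rw [wind, if_neg h0] at hs
          exact OnePoint.coe_ne_infty _ hs
        obtain ⟨z, hz⟩ := Real.sin_eq_zero_iff.1 h0
        exact ⟨z, by
          have := Real.pi_ne_zero
          rw [mul_comm] at hz
          exact (mul_left_cancel₀ this hz).symm⟩
      obtain ⟨z, hz⟩ := this
      have h2 : wind (d * t) = ∞ := by
        rw [hz]; exact_mod_cast wind_int (d * z)
      rw [hs, h2]; rfl
    · obtain ⟨s, hs'⟩ := OnePoint.ne_infty_iff_exists.1 hs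
      have hu := unwind_of_wind_eq hs'.symm
      rw [← hs', smash_cons]
      simp only [degFun, OnePoint.elim_some, Fin.cons_zero, Fin.cons_succ, hu]

theorem susp_surjective (m : ℕ) : Function.Surjective (susp m) := by
  intro x
  induction x using OnePoint.rec with
  | infty => exact ⟨(0, ∞), smash_infty_right (Nat.add_comm 1 m) _⟩
  | coe v =>
    refine ⟨(unwind (v 0), ((fun i => v i.succ : Fin m → ℝ) : Sph m)), ?_⟩
    change smash (Nat.add_comm 1 m) (wind _, _) = _
    rw [wind_unwind]
    refine (smash_cons _ _).trans ?_
    congr 1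
    exact Fin.cons_self_tail v

theorem continuous_degFun (d m : ℕ) : Continuous (degFun d m) := by
  have hq : IsQuotientMap (susp m) :=
    (susp m).continuous.isClosedMap.isQuotientMap (susp m).continuous (susp_surjective m)
  rw [hq.continuous_iff]
  have : degFun d m ∘ susp m = fun p => smash (Nat.add_comm 1 m) (wind (d * p.1), p.2) := by
    funext ⟨t, x⟩
    exact degFun_susp d m t x
  rw [this]
  refine (smash _).continuous.comp ((continuous_wind.comp ?_).prodMk continuous_snd)
  fun_prop

/-- The degree `d` self-map of `S^m`, `m ≥ 1` (the value at `m = 0` is irrelevant). -/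
def degMap (d : ℕ) : (m : ℕ) → C(Sph m, Sph m)
  | 0 => ContinuousMap.id _
  | m + 1 => ⟨degFun d m, continuous_degFun d m⟩

/-- The identifications that make `S^m ⊔ ([0,1] × S^m)` into the (reduced) mapping cone of the degree
`d` map. -/
inductive MooreRel (d m : ℕ) : Sph m ⊕ (I × Sph m) → Sph m ⊕ (I × Sph m) → Prop
  | glue (x : Sph m) : MooreRel d m (Sum.inr (1, x)) (Sum.inl (degMap d m x))
  | apex (x : Sph m) : MooreRel d m (Sum.inr (0, x)) (Sum.inl ∞)
  | base (t : I) : MooreRel d m (Sum.inr (t, ∞)) (Sum.inl ∞)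

/-- The Moore space `S^m ∪_d e^(m+1)`, the reduced mapping cone of the degree `d` map of `S^m`. -/
def Moore (d m : ℕ) : Type := Quot (MooreRel d m)

instance (d m : ℕ) : TopologicalSpace (Moore d m) :=
  inferInstanceAs (TopologicalSpace (Quot (MooreRel d m)))

/-- The inclusion `S^m ⟶ S^m ∪_d e^(m+1)`. -/
def Moore.incl (d m : ℕ) : C(Sph m, Moore d m) :=
  ⟨fun x => Quot.mk _ (Sum.inl x), continuous_quot_mk.comp continuous_inl⟩

/-- The pinch map `S^m ∪_d e^(m+1) ⟶ S^(m+1)`, which collapses `S^m`. -/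
def Moore.pinch (d m : ℕ) : C(Moore d m, Sph (m + 1)) where
  toFun := Quot.lift (Sum.elim (fun _ => ∞) (susp m)) (by
    rintro _ _ (x | x | t)
    · simp [susp]
    · simp [susp]
    · simp [susp])
  continuous_toFun := by
    apply continuous_quot_lift
    exact continuous_const.sumElim (susp m).continuous

/-- The homotopy fibre of the pinch map: points `y` of the Moore space with a path in `S^(m+1)` from
the image of `y` to the base point. -/
def PinchFiber (d m : ℕ) : Type :=
  {z : Moore d m × C(I, Sph (m + 1)) // z.2 0 = Moore.pinch d m z.1 ∧ z.2 1 = ∞}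

instance (d m : ℕ) : TopologicalSpace (PinchFiber d m) :=
  inferInstanceAs (TopologicalSpace
    {z : Moore d m × C(I, Sph (m + 1)) // z.2 0 = Moore.pinch d m z.1 ∧ z.2 1 = ∞})

/-- The projection of the homotopy fibre to the Moore space. -/
def PinchFiber.proj (d m : ℕ) : C(PinchFiber d m, Moore d m) :=
  ⟨fun z => z.1.1, continuous_fst.comp continuous_subtype_val⟩

/-- The map `S^m × Ω S^(m+1) ⟶ F`, `(x, ω) ↦ (x, ω)`: the part of the homotopy fibre that lies over
`S^m`, where the pinch map is constant. Equivalently, it is the action of `Ω S^(m+1)` on `F`,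
restricted to `S^m ⊆ F`. -/
def PinchFiber.ofProd (d m : ℕ) : C(Sph m × LoopSph (m + 1), PinchFiber d m) where
  toFun p := ⟨(Moore.incl d m p.1, p.2.toContinuousMap), p.2.source, p.2.target⟩
  continuous_toFun := by
    refine Continuous.subtype_mk (Continuous.prodMk ?_ ?_) _
    · exact (Moore.incl d m).continuous.comp continuous_fst
    · exact continuous_induced_dom.comp continuous_snd

/-- The base point of `S^m × Ω S^(m+1)`. -/
def prodBase (m : ℕ) : Sph m × LoopSph (m + 1) := (∞, Path.refl ∞)

/-- The base point of the homotopy fibre. -/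
def PinchFiber.base (d m : ℕ) : PinchFiber d m := PinchFiber.ofProd d m (prodBase m)

/-! ### The spaces and maps of the statement -/

/-- The mod `p^e` Moore space `P^(2n+1)(p^e) = S^(2n) ∪_{p^e} e^(2n+1)`. -/
abbrev P (p e n : ℕ) : Type := Moore (p ^ e) (2 * n)

/-- The fibre `F_n` of the pinch map `P^(2n+1)(p^e) ⟶ S^(2n+1)`. -/
abbrev F (p e n : ℕ) : Type := PinchFiber (p ^ e) (2 * n)

/-- The composition `S^(2n) × Ω S^(2n+1) ⟶ F_n ⟶ F_{rn} ⟶ P^(2rn+1)(p^e)` for a map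
`h : F_n ⟶ F_{rn}`. -/
def throughFiber {p e n r : ℕ} (h : C(F p e n, F p e (r * n))) :
    C(Sph (2 * n) × LoopSph (2 * n + 1), P p e (r * n)) :=
  (PinchFiber.proj (p ^ e) (2 * (r * n))).comp (h.comp (PinchFiber.ofProd (p ^ e) (2 * n)))

theorem dim_eq {r : ℕ} (n : ℕ) (hr : 1 ≤ r) : 2 * n + 2 * (r - 1) * n = 2 * (r * n) := by
  obtain ⟨k, rfl⟩ := Nat.exists_eq_add_of_le' hr
  simp only [Nat.add_sub_cancel]
  ring

/-- The composition
`S^(2n) × Ω S^(2n+1) ⟶ S^(2n) × Ω S^(2(r-1)n+1) ⟶ S^(2rn) ⟶ P^(2rn+1)(p^e)` of `1 × H`, the collapse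
and the inclusion. -/
def throughHopf (p e : ℕ) {n r : ℕ} (hn : 1 ≤ n) (hr : 1 ≤ r)
    (H : C(LoopSph (2 * n + 1), LoopSph (2 * (r - 1) * n + 1))) :
    C(Sph (2 * n) × LoopSph (2 * n + 1), P p e (r * n)) :=
  (Moore.incl (p ^ e) (2 * (r * n))).comp
    ((collapse (Nat.mul_pos two_pos hn) (dim_eq n hr)).comp
      (ContinuousMap.prodMap (ContinuousMap.id (Sph (2 * n))) H))

/-! ### `p`-local homology -/

/-- The ring `ℤ_(p)` of integers localized at the prime `p`: the rational numbers whose denominator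
is prime to `p`. -/
abbrev ZLoc (p : ℕ) [hp : Fact p.Prime] : Type :=
  haveI : (Ideal.span {(p : ℤ)}).IsPrime :=
    Ideal.isPrime_span_singleton_of_prime (Nat.prime_iff_prime_int.1 hp.out)
  Localization.AtPrime (Ideal.span {(p : ℤ)})

/-- The homomorphism induced in singular homology `H_i(-; ℤ_(p))`. -/
def homologyMap (p : ℕ) [Fact p.Prime] (i : ℕ) {X Y : Type} [TopologicalSpace X]
    [TopologicalSpace Y] (f : C(X, Y)) :=
  ((AlgebraicTopology.singularHomologyFunctor (ModuleCat.{0} (ZLoc p)) i).obj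
    (ModuleCat.of (ZLoc p) (ZLoc p))).map (TopCat.ofHom f)

end HopfFiber

end

/-! Write m = 2n, K = 2(r-1)n, M = m + K = 2rn, d = p^e, and Ω for the loop space of S^(m+1).

Existence. The fibre F_n is the pullback of the path fibration of S^(m+1) along the pinch map. A
point (t, x) of the cone, together with a path g from its image in S^(m+1) to the base point,
determines a loop: run along the suspension line of x from parameter 1 to t, then follow g
(`extend`). The pair is sent to the cone point with the same t over the sphere point `collapse (x, H
loop)`. After pinching, this rule depends only on the starting point and g, so it is a map
`startVal` from the path space of S^(m+1) to S^(M+1); evaluated on all tails of g it gives the path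
coordinate of the new point. At t = 1 the loop is g itself (`extend_one`), and the gluing is
respected because the degree map changes only the first sphere coordinate while the collapse
replaces only the last one (`degMap_collapse`). The two compositions of the theorem are then equal,
not merely homotopic, and this works for every continuous H.

Homology of the fibre. A fibration over a mapping cone B ∪ C(S^m) has a Mayer-Vietoris square
(`CellAt.mvSquare`). If it is induced from the path fibration by a map that is constant on B and the
suspension coordinate on the cone, the corners are S^m × Ω, B × Ω and, over the ball, Ω; the map S^m
× Ω → Ω is the multiplication `muMap` (`ConeAt.totSquare`, `ConeAt.diskLoop_toDisk`). When B is a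
point the total space is contractible, so in positive degrees `muMap` is an isomorphism from the
classes killed by the projection to Ω onto the homology of Ω. With the Künneth isomorphism for a
sphere factor (`cross_bijective`) this shows inductively that H_(jm)(Ω) is generated by the product
of j fundamental classes (`exists_wordClass`). When B = S^m the same square identifies the classes
of S^m × Ω killed by the projection with the positive homology of the fibre (`fiber_surjective`,
`fiber_injective`). Hence H_M(F_n) is generated by the cross product of [S^m] with the class of
words of r - 1 letters.

The isomorphism. A word of r - 1 letters has exactly one subsequence of length r - 1, so on such
words H is the smash product of the letters, and the collapse turns the generator of H_M(F_n) into
the smash of r fundamental classes, a generator of H_M(S^M). The inclusion of S^M in the Moore space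
kills only multiples of d, so h takes the generator to c times the generator with c congruent to a
unit modulo d. Over a local ring in which d is not a unit, c is a unit
(`hmap_bijective_of_homotopic`).

The Mayer-Vietoris sequence itself is derived from barycentric subdivision of concrete singular
chains, which are first identified with the chains that define `homologyMap`. -/

noncomputable section

namespace HopfFiber

section

open Simplicial Limits

/-! ### Singular chains -/

section Chains

variable (R : Type) [CommRing R]

/-- The topological `k`-simplex. -/
abbrev Dlt (k : ℕ) : Type := stdSimplex ℝ (Fin (k + 1))

/-- Singular `k`-chains with coefficients in `R`. -/
abbrev Ch (k : ℕ) (X : Type) [TopologicalSpace X] : Type := C(Dlt k, X) →₀ R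

/-- The `i`-th face inclusion of the topological simplex. -/
def faceMap {k : ℕ} (i : Fin (k + 2)) : C(Dlt k, Dlt (k + 1)) :=
  ⟨stdSimplex.map (Fin.succAbove i), stdSimplex.continuous_map _⟩

variable {X Y Z : Type} [TopologicalSpace X] [TopologicalSpace Y] [TopologicalSpace Z]

/-- The boundary operator on singular chains. -/
def bd (k : ℕ) : Ch R (k + 1) X →ₗ[R] Ch R k X :=
  Finsupp.lsum R fun τ => ∑ i : Fin (k + 2),
    (-1 : R) ^ (i : ℕ) • Finsupp.lsingle (τ.comp (faceMap i))

/-- The map induced on singular chains. -/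
def push (k : ℕ) (f : C(X, Y)) : Ch R k X →ₗ[R] Ch R k Y :=
  Finsupp.lmapDomain R R fun τ => f.comp τ

theorem bd_single {k : ℕ} (τ : C(Dlt (k + 1), X)) (r : R) :
    bd R k (Finsupp.single τ r) =
      ∑ i : Fin (k + 2), (-1 : R) ^ (i : ℕ) • Finsupp.single (τ.comp (faceMap i)) r := by
  simp [bd]

@[simp] theorem push_single {k : ℕ} (f : C(X, Y)) (τ : C(Dlt k, X)) (r : R) :
    push R k f (Finsupp.single τ r) = Finsupp.single (f.comp τ) r := by
  simp [push]

theorem bd_push {k : ℕ} (f : C(X, Y)) (c : Ch R (k + 1) X) :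
    bd R k (push R (k + 1) f c) = push R k f (bd R k c) := by
  induction c using Finsupp.induction_linear with
  | zero => simp
  | add a b ha hb => simp only [map_add, ha, hb]
  | single τ r =>
    simp only [push_single, bd_single, map_sum, map_smul]
    rfl

/-- The module complex of Mathlib that computes singular homology. -/
abbrev singCx (X : Type) [TopologicalSpace X] : ChainComplex (ModuleCat.{0} R) ℕ :=
  (TopCat.toSSet.obj (TopCat.of X)).chainComplex (ModuleCat.of R R)

/-- Singular homology with coefficients in `R`. -/
abbrev Hom (k : ℕ) (X : Type) [TopologicalSpace X] : Type := (singCx R X).homology k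

/-- The map induced in singular homology. -/
def hmap (k : ℕ) (f : C(X, Y)) : Hom R k X →ₗ[R] Hom R k Y :=
  (SSet.homologyMap (TopCat.toSSet.map (TopCat.ofHom f)) (ModuleCat.of R R) k).hom

theorem hmap_id (k : ℕ) : hmap R k (ContinuousMap.id X) = LinearMap.id := by
  have : TopCat.ofHom (ContinuousMap.id X) = 𝟙 (TopCat.of X) := rfl
  simp [hmap, this]
  
theorem hmap_comp (k : ℕ) (g : C(Y, Z)) (f : C(X, Y)) :
    hmap R k (g.comp f) = hmap R k g ∘ₗ hmap R k f := by
  have : TopCat.ofHom (g.comp f) = TopCat.ofHom f ≫ TopCat.ofHom g := rfl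
  simp [hmap, this, SSet.homologyMap_comp]

theorem hmap_comp_apply (k : ℕ) (g : C(Y, Z)) (f : C(X, Y)) (z : Hom R k X) :
    hmap R k (g.comp f) z = hmap R k g (hmap R k f z) := by
  rw [hmap_comp]; rfl

theorem hmap_homotopic (k : ℕ) {f g : C(X, Y)} (h : f.Homotopic g) : hmap R k f = hmap R k g := by
  obtain ⟨F⟩ := h
  exact congrArg ModuleCat.Hom.hom
    (TopCat.Homotopy.congr_homologyMap_singularChainComplexFunctor
      (f := TopCat.ofHom f) (g := TopCat.ofHom g) F (ModuleCat.of R R) k)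

/-- A continuous map as a simplex of the singular simplicial set. -/
def toSimplex {k : ℕ} (τ : C(Dlt k, X)) : (TopCat.toSSet.obj (TopCat.of X)) _⦋k⦌ :=
  ((TopCat.of X).toSSetObjEquiv (.op ⦋k⦌)).symm τ

theorem toSimplex_bijective {k : ℕ} :
    Function.Bijective (toSimplex : C(Dlt k, X) → (TopCat.toSSet.obj (TopCat.of X)) _⦋k⦌) :=
  ((TopCat.of X).toSSetObjEquiv (.op ⦋k⦌)).symm.bijective

theorem toSimplex_face {k : ℕ} (τ : C(Dlt (k + 1), X)) (i : Fin (k + 2)) :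
    (TopCat.toSSet.obj (TopCat.of X)).δ i (toSimplex τ) = toSimplex (τ.comp (faceMap i)) := rfl

theorem toSimplex_map {k : ℕ} (f : C(X, Y)) (τ : C(Dlt k, X)) :
    (TopCat.toSSet.map (TopCat.ofHom f)).app _ (toSimplex τ) = toSimplex (f.comp τ) := rfl

/-- Comparison of concrete chains with the chains of Mathlib. -/
def chIn (k : ℕ) (X : Type) [TopologicalSpace X] : Ch R k X →ₗ[R] (singCx R X).X k :=
  Finsupp.lsum R fun τ => (SSet.ιChainComplex (R := ModuleCat.of R R) _ (toSimplex τ)).hom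

theorem chIn_single {k : ℕ} (τ : C(Dlt k, X)) (r : R) :
    chIn R k X (Finsupp.single τ r) =
      SSet.ιChainComplex (R := ModuleCat.of R R) _ (toSimplex τ) r := by
  simp [chIn]

theorem chIn_bd {k : ℕ} (c : Ch R (k + 1) X) :
    (singCx R X).d (k + 1) k (chIn R (k + 1) X c) = chIn R k X (bd R k c) := by
  induction c using Finsupp.induction_linear with
  | zero => simp
  | add a b ha hb => simp only [map_add, ha, hb]
  | single τ r =>
    have h := congrArg (fun φ => φ.hom r)
      (SSet.ιChainComplex_d (TopCat.toSSet.obj (TopCat.of X)) (ModuleCat.of R R) (toSimplex τ))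
    simp only [ModuleCat.hom_comp, LinearMap.comp_apply] at h
    rw [chIn_single, bd_single, map_sum]
    refine h.trans ?_
    rw [ModuleCat.hom_sum, LinearMap.sum_apply]
    refine Finset.sum_congr rfl fun i _ => ?_
    rw [map_smul, chIn_single, toSimplex_face]
    rcases Nat.even_or_odd (i : ℕ) with hi | hi <;> simp [hi.neg_one_pow]

theorem chIn_push {k : ℕ} (f : C(X, Y)) (c : Ch R k X) :
    (SSet.chainComplexMap (TopCat.toSSet.map (TopCat.ofHom f)) (ModuleCat.of R R)).f k
      (chIn R k X c) = chIn R k Y (push R k f c) := by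
  induction c using Finsupp.induction_linear with
  | zero => simp
  | add a b ha hb => simp only [map_add, ha, hb]
  | single τ r =>
    have h := congrArg (fun φ => φ.hom r)
      (SSet.ι_chainComplexMap_f (TopCat.toSSet.obj (TopCat.of X)) _
        (TopCat.toSSet.map (TopCat.ofHom f)) (ModuleCat.of R R) (toSimplex τ))
    rw [chIn_single, push_single, chIn_single, ← toSimplex_map]
    exact h

/-- Both sides are free on the singular simplices; the inverse comes from the universal property of
the coproduct. -/
theorem chIn_bijective (k : ℕ) : Function.Bijective (chIn R k X) := by
  let S := TopCat.toSSet.obj (TopCat.of X)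
  let e := Equiv.ofBijective _ (toSimplex_bijective (X := X) (k := k))
  let inv : (singCx R X).X k ⟶ ModuleCat.of R (Ch R k X) :=
    Cofan.IsColimit.desc (S.isColimitChainComplexXCofan (ModuleCat.of R R) k)
      fun s => ModuleCat.ofHom (Finsupp.lsingle (e.symm s))
  have hinv : ∀ s, S.ιChainComplex s ≫ inv = ModuleCat.ofHom (Finsupp.lsingle (e.symm s)) :=
    fun s => Cofan.IsColimit.fac (S.isColimitChainComplexXCofan (ModuleCat.of R R) k) _ s
  constructor
  · apply Function.LeftInverse.injective (g := inv)
    intro c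
    induction c using Finsupp.induction_linear with
    | zero => simp
    | add a b ha hb => rw [map_add, map_add, ha, hb]
    | single τ r =>
      rw [chIn_single]
      have := congrArg (fun φ => φ.hom r) (hinv (toSimplex τ))
      refine this.trans ?_
      have h2 : e.symm (toSimplex τ) = τ := e.symm_apply_apply τ
      simp [h2]
  · apply Function.RightInverse.surjective (g := inv)
    have : inv ≫ ModuleCat.ofHom (chIn R k X) = 𝟙 _ := by
      apply SSet.chainComplex_hom_ext
      intro s
      rw [← Category.assoc, hinv]
      ext
      have h2 : toSimplex (e.symm s) = s := e.apply_symm_apply s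
      simp [chIn_single, h2]
    intro c
    exact congrArg (fun φ => φ.hom c) this

/-- The cycles in degree `k`. -/
def cyc (X : Type) [TopologicalSpace X] (k : ℕ) : Submodule R (Ch R k X) :=
  match k with
  | 0 => ⊤
  | k + 1 => LinearMap.ker (bd R k)

theorem mem_cyc_iff {k : ℕ} (c : Ch R k X) :
    c ∈ cyc R X k ↔ (singCx R X).d k ((ComplexShape.down ℕ).next k) (chIn R k X c) = 0 := by
  cases k with
  -- In degree 0 `next` gives an index that is not related to 0, so the differential there is zero
  -- by default.
  | zero => simp [cyc]
  | succ k =>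
    rw [ChainComplex.next_nat_succ, chIn_bd]
    simp only [cyc, LinearMap.mem_ker]
    constructor
    · intro h; rw [h, map_zero]
    · intro h; exact (chIn_bijective R k).1 (by rw [h, map_zero])

theorem iCycles_injective (K : ChainComplex (ModuleCat.{0} R) ℕ) (k : ℕ) :
    Function.Injective (K.iCycles k) :=
  (ModuleCat.mono_iff_injective _).1 inferInstance

theorem exists_iCycles (K : ChainComplex (ModuleCat.{0} R) ℕ) (k : ℕ) (x : K.X k)
    (hx : K.d k ((ComplexShape.down ℕ).next k) x = 0) : ∃ c, K.iCycles k c = x :=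
  (ShortComplex.moduleCat_exact_iff _).1
    (ShortComplex.exact_of_f_is_kernel
      (ShortComplex.mk _ _ (K.iCycles_d k ((ComplexShape.down ℕ).next k)))
      (K.cyclesIsKernel k _ rfl)) x hx

/-- The cycle of Mathlib's complex given by a concrete cycle. -/
def cycIn (k : ℕ) (X : Type) [TopologicalSpace X] : cyc R X k →ₗ[R] (singCx R X).cycles k where
  toFun c := (exists_iCycles R _ k (chIn R k X c) ((mem_cyc_iff R _).1 c.2)).choose
  map_add' a b := by
    apply iCycles_injective
    have h := fun c : cyc R X k =>
      (exists_iCycles R _ k (chIn R k X c) ((mem_cyc_iff R _).1 c.2)).choose_spec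
    rw [map_add, h, h, h, Submodule.coe_add, map_add]
  map_smul' r a := by
    apply iCycles_injective
    have h := fun c : cyc R X k =>
      (exists_iCycles R _ k (chIn R k X c) ((mem_cyc_iff R _).1 c.2)).choose_spec
    rw [RingHom.id_apply, map_smul, h, h, Submodule.coe_smul, map_smul]

theorem iCycles_cycIn (k : ℕ) (c : cyc R X k) :
    (singCx R X).iCycles k (cycIn R k X c) = chIn R k X c :=
  (exists_iCycles R _ k (chIn R k X c) ((mem_cyc_iff R _).1 c.2)).choose_spec

/-- The homology class of a cycle. -/
def cls (k : ℕ) (X : Type) [TopologicalSpace X] : cyc R X k →ₗ[R] Hom R k X :=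
  ((singCx R X).homologyπ k).hom ∘ₗ cycIn R k X

theorem cls_surjective (k : ℕ) : Function.Surjective (cls R k X) := by
  intro z
  obtain ⟨c, rfl⟩ := (ModuleCat.epi_iff_surjective ((singCx R X).homologyπ k)).1 inferInstance z
  obtain ⟨b, hb⟩ := (chIn_bijective R k).2 ((singCx R X).iCycles k c)
  have hbc : b ∈ cyc R X k := by
    rw [mem_cyc_iff, hb]
    exact congrArg (fun φ => φ.hom c) ((singCx R X).iCycles_d k ((ComplexShape.down ℕ).next k))
  refine ⟨⟨b, hbc⟩, ?_⟩
  have : cycIn R k X ⟨b, hbc⟩ = c := by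
    apply iCycles_injective
    rw [iCycles_cycIn, hb]
  simp [cls, this]

/-- Together with `cls_surjective` this presents homology as concrete cycles modulo concrete
boundaries; nearly all later arguments with classes rest on these two facts. -/
theorem cls_eq_zero_iff (k : ℕ) (c : cyc R X k) :
    cls R k X c = 0 ↔ ∃ w : Ch R (k + 1) X, bd R k w = c := by
  have ex := (ShortComplex.moduleCat_exact_iff _).1
    (ShortComplex.exact_of_g_is_cokernel
      (ShortComplex.mk _ _ ((singCx R X).toCycles_comp_homologyπ (k + 1) k))
      ((singCx R X).homologyIsCokernel (k + 1) k (by simp)))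
  have ti : ∀ y, (singCx R X).iCycles k ((singCx R X).toCycles (k + 1) k y) =
      (singCx R X).d (k + 1) k y :=
    fun y => congrArg (fun φ => φ.hom y) ((singCx R X).toCycles_i (k + 1) k)
  constructor
  · intro h
    obtain ⟨y, hy⟩ := ex (cycIn R k X c) h
    obtain ⟨w, rfl⟩ := (chIn_bijective R (k + 1)).2 y
    refine ⟨w, (chIn_bijective R k).1 ?_⟩
    rw [← chIn_bd, ← iCycles_cycIn, ← hy]
    exact (ti _).symm
  · rintro ⟨w, hw⟩
    have : cycIn R k X c = (singCx R X).toCycles (k + 1) k (chIn R (k + 1) X w) := by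
      apply iCycles_injective
      rw [iCycles_cycIn, ti, chIn_bd, hw]
    change ((singCx R X).homologyπ k).hom (cycIn R k X c) = 0
    rw [this]
    exact congrArg (fun φ => φ.hom (chIn R (k + 1) X w))
      ((singCx R X).toCycles_comp_homologyπ (k + 1) k)

theorem push_mem_cyc {k : ℕ} (f : C(X, Y)) {c : Ch R k X} (hc : c ∈ cyc R X k) :
    push R k f c ∈ cyc R Y k := by
  cases k with
  | zero => trivial
  | succ k =>
    simp only [cyc, LinearMap.mem_ker] at hc ⊢
    rw [bd_push, hc, map_zero]

theorem hmap_cls (k : ℕ) (f : C(X, Y)) (c : cyc R X k) :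
    hmap R k f (cls R k X c) = cls R k Y ⟨push R k f c, push_mem_cyc R f c.2⟩ := by
  let φ := SSet.chainComplexMap (TopCat.toSSet.map (TopCat.ofHom f)) (ModuleCat.of R R)
  have h1 := congrArg (fun ψ => ψ.hom (cycIn R k X c))
    (HomologicalComplex.homologyπ_naturality φ k)
  refine h1.trans ?_
  change ((singCx R Y).homologyπ k).hom _ = ((singCx R Y).homologyπ k).hom _
  congr 1
  apply iCycles_injective
  rw [iCycles_cycIn]
  have h2 := congrArg (fun ψ => ψ.hom (cycIn R k X c)) (HomologicalComplex.cyclesMap_i φ k)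
  refine h2.trans ?_
  change φ.f k ((singCx R X).iCycles k (cycIn R k X c)) = _
  rw [iCycles_cycIn, chIn_push]

end Chains

end

/-! ### Formal subdivision of ordered vertex chains -/

section Formal

variable (R : Type) [CommRing R] {V W : Type}

/-- Formal combinations of `k`-tuples of vertices. -/
abbrev Tup (k : ℕ) (V : Type) : Type := (Fin k → V) →₀ R

/-- The boundary of vertex chains; the empty tuple is the augmentation. -/
def tbd (k : ℕ) : Tup R (k + 1) V →ₗ[R] Tup R k V :=
  Finsupp.lsum R fun v => ∑ i : Fin (k + 1), (-1 : R) ^ (i : ℕ) • Finsupp.lsingle (v ∘ i.succAbove)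

theorem tbd_single {k : ℕ} (v : Fin (k + 1) → V) (r : R) :
    tbd R k (Finsupp.single v r) =
      ∑ i : Fin (k + 1), (-1 : R) ^ (i : ℕ) • Finsupp.single (v ∘ i.succAbove) r := by
  simp [tbd]

/-- The cone with apex `b`. -/
def tcone {k : ℕ} (b : V) : Tup R k V →ₗ[R] Tup R (k + 1) V :=
  Finsupp.lmapDomain R R fun v => (Fin.cons b v : Fin (k + 1) → V)

@[simp] theorem tcone_single {k : ℕ} (b : V) (v : Fin k → V) (r : R) :
    tcone R b (Finsupp.single v r) = Finsupp.single (Fin.cons b v : Fin (k + 1) → V) r := by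
  simp [tcone]

/-- The map induced on vertex chains. -/
def tmap (k : ℕ) (f : V → W) : Tup R k V →ₗ[R] Tup R k W :=
  Finsupp.lmapDomain R R fun v => f ∘ v

@[simp] theorem tmap_single {k : ℕ} (f : V → W) (v : Fin k → V) (r : R) :
    tmap R k f (Finsupp.single v r) = Finsupp.single (f ∘ v) r := by
  simp [tmap]

theorem tbd_tcone_zero (b : V) (c : Tup R 0 V) : tbd R 0 (tcone R b c) = c := by
  induction c using Finsupp.induction_linear with
  | zero => simp
  | add x y hx hy => simp only [map_add, hx, hy]
  | single v r =>
    rw [tcone_single, tbd_single]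
    rw [Fin.sum_univ_one, Subsingleton.elim ((Fin.cons b v : Fin 1 → V) ∘ (0 : Fin 1).succAbove) v]
    simp

/-- The zeroth face of a cone is its base; every other face is the cone on a face of the base, with
the sign shifted by one. -/
theorem tbd_tcone_succ {k : ℕ} (b : V) (c : Tup R (k + 1) V) :
    tbd R (k + 1) (tcone R b c) = c - tcone R b (tbd R k c) := by
  induction c using Finsupp.induction_linear with
  | zero => simp
  | add x y hx hy => simp only [map_add, hx, hy]; abel
  | single v r =>
    rw [tcone_single, tbd_single, Fin.sum_univ_succ, tbd_single, map_sum, sub_eq_add_neg,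
      ← Finset.sum_neg_distrib]
    congr 1
    · simp only [Fin.val_zero, pow_zero, one_smul]
      rfl
    · refine Finset.sum_congr rfl fun i _ => ?_
      have : (Fin.cons b v : Fin (k + 2) → V) ∘ i.succ.succAbove =
          Fin.cons b (v ∘ i.succAbove) := by
        funext j
        refine Fin.cases ?_ (fun j => ?_) j
        · simp
        · simp
      rw [this, map_smul, tcone_single, Fin.val_succ, pow_succ]
      simp

/-- Every nonempty tuple is the cone on its tail, so the cone formula and induction replace the
usual cancellation in a double sum. -/
theorem tbd_tbd {k : ℕ} (c : Tup R (k + 2) V) : tbd R k (tbd R (k + 1) c) = 0 := by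
  induction k with
  | zero =>
    induction c using Finsupp.induction_linear with
    | zero => simp
    | add x y hx hy => simp only [map_add, hx, hy, add_zero]
    | single v r =>
      rw [← Fin.cons_self_tail v, ← tcone_single, tbd_tcone_succ, map_sub, tbd_tcone_zero, sub_self]
  | succ k ih =>
    induction c using Finsupp.induction_linear with
    | zero => simp
    | add x y hx hy => simp only [map_add, hx, hy, add_zero]
    | single v r =>
      rw [← Fin.cons_self_tail v, ← tcone_single, tbd_tcone_succ, map_sub, tbd_tcone_succ, ih]
      simp

/-- Barycentric subdivision of vertex chains, with respect to a choice `β` of barycentres. -/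
def tsd (β : ∀ k, (Fin (k + 1) → V) → V) (k : ℕ) : Tup R k V →ₗ[R] Tup R k V :=
  match k with
  | 0 => LinearMap.id
  | k + 1 => Finsupp.lsum R fun v => LinearMap.toSpanSingleton R _
      (tcone R (β k v) (tsd β k (tbd R k (Finsupp.single v 1))))

/-- The chain homotopy between the identity and the subdivision. -/
def tht (β : ∀ k, (Fin (k + 1) → V) → V) (k : ℕ) : Tup R k V →ₗ[R] Tup R (k + 1) V :=
  match k with
  | 0 => 0
  | k + 1 => Finsupp.lsum R fun v => LinearMap.toSpanSingleton R _
      (tcone R (β k v) (Finsupp.single v 1 - tht β k (tbd R k (Finsupp.single v 1))))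

variable (β : ∀ k, (Fin (k + 1) → V) → V)

theorem tsd_single {k : ℕ} (v : Fin (k + 1) → V) (r : R) :
    tsd R β (k + 1) (Finsupp.single v r) =
      tcone R (β k v) (tsd R β k (tbd R k (Finsupp.single v r))) := by
  have : Finsupp.single v r = r • Finsupp.single v (1 : R) := by simp
  rw [this]
  simp only [map_smul]
  simp [tsd]

theorem tht_single {k : ℕ} (v : Fin (k + 1) → V) (r : R) :
    tht R β (k + 1) (Finsupp.single v r) =
      tcone R (β k v) (Finsupp.single v r - tht R β k (tbd R k (Finsupp.single v r))) := by
  have : Finsupp.single v r = r • Finsupp.single v (1 : R) := by simp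
  rw [this]
  simp only [map_smul, ← smul_sub]
  simp [tht]

/-- Only the cone formula is used, so the apexes `β` can be arbitrary; their position matters only
for the diameter estimates. -/
theorem tbd_tsd {k : ℕ} (c : Tup R (k + 1) V) :
    tbd R k (tsd R β (k + 1) c) = tsd R β k (tbd R k c) := by
  induction k with
  | zero =>
    induction c using Finsupp.induction_linear with
    | zero => simp
    | add x y hx hy => simp only [map_add, hx, hy]
    | single v r => rw [tsd_single, tbd_tcone_zero]
  | succ k ih =>
    induction c using Finsupp.induction_linear with
    | zero => simp
    | add x y hx hy => simp only [map_add, hx, hy]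
    | single v r => rw [tsd_single, tbd_tcone_succ, ih, tbd_tbd]; simp

/-- By induction `v - T∂v` has boundary `S∂v`, where T is the homotopy and S the subdivision; coning
it off gives boundary `v - T∂v` minus the cone on `S∂v`, and that cone is `Sv`. -/
theorem tbd_tht {k : ℕ} (c : Tup R (k + 1) V) :
    tbd R (k + 1) (tht R β (k + 1) c) + tht R β k (tbd R k c) = c - tsd R β (k + 1) c := by
  induction k with
  | zero =>
    induction c using Finsupp.induction_linear with
    | zero => simp
    | add x y hx hy =>
      simp only [map_add] at *
      rw [show ∀ a b c d : Tup R 1 V, a + b + (c + d) = (a + c) + (b + d) by intros; abel, hx, hy]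
      abel
    | single v r =>
      rw [tht_single, tbd_tcone_succ, tsd_single]
      simp [tht, tsd]
  | succ k ih =>
    induction c using Finsupp.induction_linear with
    | zero => simp
    | add x y hx hy =>
      simp only [map_add] at *
      rw [show ∀ a b c d : Tup R (k + 2) V, a + b + (c + d) = (a + c) + (b + d) by intros; abel,
        hx, hy]
      abel
    | single v r =>
      have h := ih (tbd R (k + 1) (Finsupp.single v r))
      rw [tbd_tbd, map_zero, add_zero] at h
      rw [tht_single, tbd_tcone_succ, tsd_single, map_sub, h, sub_sub_cancel]
      abel

theorem tmap_tcone {k : ℕ} (f : V → W) (b : V) (c : Tup R k V) :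
    tmap R (k + 1) f (tcone R b c) = tcone R (f b) (tmap R k f c) := by
  induction c using Finsupp.induction_linear with
  | zero => simp
  | add x y hx hy => simp only [map_add, hx, hy]
  | single v r =>
    simp only [tcone_single, tmap_single]
    congr 1
    funext j
    refine Fin.cases ?_ (fun j => ?_) j <;> simp

theorem tmap_tbd {k : ℕ} (f : V → W) (c : Tup R (k + 1) V) :
    tmap R k f (tbd R k c) = tbd R k (tmap R (k + 1) f c) := by
  induction c using Finsupp.induction_linear with
  | zero => simp
  | add x y hx hy => simp only [map_add, hx, hy]
  | single v r => simp only [tbd_single, tmap_single, map_sum, map_smul]; rfl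

variable {β} {γ : ∀ k, (Fin (k + 1) → W) → W}

/-- Applied to affine maps, which preserve barycentres: subdividing a face of a simplex agrees with
restricting the subdivision formula, which makes subdivision of singular chains a chain map. -/
theorem tmap_tsd (f : V → W) (hf : ∀ k v, f (β k v) = γ k (f ∘ v)) {k : ℕ} (c : Tup R k V) :
    tmap R k f (tsd R β k c) = tsd R γ k (tmap R k f c) := by
  induction k with
  | zero => rfl
  | succ k ih =>
    induction c using Finsupp.induction_linear with
    | zero => simp
    | add x y hx hy => simp only [map_add, hx, hy]
    | single v r => rw [tsd_single, tmap_tcone, ih, tmap_tbd, tmap_single, tsd_single, hf]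

theorem tmap_tht (f : V → W) (hf : ∀ k v, f (β k v) = γ k (f ∘ v)) {k : ℕ} (c : Tup R k V) :
    tmap R (k + 1) f (tht R β k c) = tht R γ k (tmap R k f c) := by
  induction k with
  | zero => simp [tht]
  | succ k ih =>
    induction c using Finsupp.induction_linear with
    | zero => simp
    | add x y hx hy => simp only [map_add, hx, hy]
    | single v r =>
      rw [tht_single, tmap_tcone, map_sub, ih, tmap_tbd, tmap_single, tht_single, hf]

end Formal

/-! ### Affine simplices -/

section Affine

/-- The affine simplex with given vertices in a topological simplex. -/
def aff {k n : ℕ} (v : Fin (k + 1) → Dlt n) : C(Dlt k, Dlt n) where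
  toFun t := ⟨∑ i, t.1 i • (v i).1,
    (convex_stdSimplex ℝ (Fin (n + 1))).sum_mem (fun i _ => t.2.1 i) t.2.2 fun i _ => (v i).2⟩
  continuous_toFun := by
    refine Continuous.subtype_mk (continuous_finsetSum _ fun i _ => ?_) _
    exact ((continuous_apply i).comp continuous_subtype_val).smul continuous_const

theorem aff_coe {k n : ℕ} (v : Fin (k + 1) → Dlt n) (t : Dlt k) :
    (aff v t).1 = ∑ i, t.1 i • (v i).1 := rfl

theorem aff_face {k n : ℕ} (v : Fin (k + 2) → Dlt n) (i : Fin (k + 2)) :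
    (aff v).comp (faceMap i) = aff (v ∘ i.succAbove) := by
  ext t : 1
  apply Subtype.ext
  change ∑ j, (stdSimplex.map i.succAbove t).1 j • (v j).1 = ∑ j, t.1 j • (v (i.succAbove j)).1
  have h : (stdSimplex.map i.succAbove t).1 = FunOnFinite.linearMap ℝ ℝ i.succAbove t.1 := rfl
  rw [Fin.sum_univ_succAbove _ i]
  have h1 : ∀ j, (stdSimplex.map i.succAbove t).1 (i.succAbove j) = t.1 j := by
    intro j
    rw [h, FunOnFinite.linearMap_apply_apply]
    simp [Finset.sum_filter]
  have h2 : (stdSimplex.map i.succAbove t).1 i = 0 := by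
    rw [h, FunOnFinite.linearMap_apply_apply]
    simp [Fin.succAbove_ne]
  simp [h1, h2]

theorem aff_aff {j k n : ℕ} (v : Fin (k + 1) → Dlt n) (w : Fin (j + 1) → Dlt k) :
    (aff v).comp (aff w) = aff (aff v ∘ w) := by
  ext t : 1
  apply Subtype.ext
  change ∑ i, (∑ l, t.1 l • (w l).1) i • (v i).1 = ∑ l, t.1 l • ∑ i, (w l).1 i • (v i).1
  simp only [Finset.sum_apply, Pi.smul_apply, Finset.sum_smul, Finset.smul_sum, smul_smul,
    smul_eq_mul]
  exact Finset.sum_comm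

theorem aff_vertex {n : ℕ} :
    aff (stdSimplex.vertex : Fin (n + 1) → Dlt n) = ContinuousMap.id _ := by
  ext t j
  change (∑ i, t.1 i • (Pi.single i (1 : ℝ) : Fin (n + 1) → ℝ)) j = t.1 j
  simp [Finset.sum_apply, Pi.single_apply]

theorem aff_apply_vertex {k n : ℕ} (v : Fin (k + 1) → Dlt n) (i : Fin (k + 1)) :
    aff v (stdSimplex.vertex i) = v i := by
  apply Subtype.ext
  change ∑ j, (Pi.single i (1 : ℝ) : Fin (k + 1) → ℝ) j • (v j).1 = (v i).1
  rw [Finset.sum_eq_single i] <;> simp +contextual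

/-- The barycentre of a tuple of points in a simplex. -/
def bary {n : ℕ} (k : ℕ) (v : Fin (k + 1) → Dlt n) : Dlt n := aff v stdSimplex.barycenter

theorem aff_bary {j k n : ℕ} (v : Fin (k + 1) → Dlt n) (w : Fin (j + 1) → Dlt k) :
    aff v (bary j w) = bary j (aff v ∘ w) := by
  rw [bary, bary, ← aff_aff]; rfl

theorem dist_aff_le {k n : ℕ} (v : Fin (k + 1) → Dlt n) (t : Dlt k) (x : Dlt n) (ρ : ℝ)
    (h : ∀ i, dist (v i) x ≤ ρ) : dist (aff v t) x ≤ ρ := by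
  have := (convex_closedBall x.1 ρ).sum_mem (t := Finset.univ) (w := t.1) (z := fun i => (v i).1)
    (fun i _ => t.2.1 i) t.2.2 (fun i _ => h i)
  exact this

/-- The difference is the average of the k + 1 vectors `v i - v l`; the one with i = l vanishes, and
this produces the factor k / (k + 1). -/
theorem dist_bary_le {k n : ℕ} (v : Fin (k + 1) → Dlt n) (l : Fin (k + 1)) (δ : ℝ)
    (h : ∀ i j, dist (v i) (v j) ≤ δ) : dist (bary k v) (v l) ≤ k / (k + 1) * δ := by
  have hb : (bary k v).1 = ∑ i, ((k : ℝ) + 1)⁻¹ • (v i).1 := by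
    rw [bary, aff_coe]
    refine Finset.sum_congr rfl fun i _ => ?_
    congr 1
    rw [stdSimplex.barycenter_apply, Fintype.card_fin]
    push_cast
    rfl
  have e : (bary k v).1 - (v l).1 = ∑ i, ((k : ℝ) + 1)⁻¹ • ((v i).1 - (v l).1) := by
    rw [hb]
    rw [← sub_eq_zero]
    simp only [smul_sub, Finset.sum_sub_distrib, sub_sub_sub_cancel_left]
    rw [sub_eq_zero]
    rw [← Finset.sum_smul]
    have : ∑ _i : Fin (k + 1), ((k : ℝ) + 1)⁻¹ = 1 := by
      rw [Finset.sum_const, Finset.card_univ, Fintype.card_fin, nsmul_eq_mul]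
      push_cast
      exact mul_inv_cancel₀ (by positivity)
    rw [this, one_smul]
  change dist (bary k v).1 (v l).1 ≤ _
  rw [dist_eq_norm, e, Fin.sum_univ_succAbove _ l, sub_self, smul_zero, zero_add]
  refine (norm_sum_le _ _).trans ?_
  have : ∀ i ∈ (Finset.univ : Finset (Fin k)),
      ‖((k : ℝ) + 1)⁻¹ • ((v (l.succAbove i)).1 - (v l).1)‖ ≤ ((k : ℝ) + 1)⁻¹ * δ := by
    intro i _
    rw [norm_smul, Real.norm_of_nonneg (by positivity), ← dist_eq_norm]
    exact mul_le_mul_of_nonneg_left (h _ _) (by positivity)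
  refine (Finset.sum_le_sum this).trans (le_of_eq ?_)
  simp
  ring

variable (R : Type) [CommRing R]

/-- The tuples `w` of diameter at most `δ` that lie in every ball that contains all the `v i`. -/
def nearTup {k j n : ℕ} (v : Fin k → Dlt n) (δ : ℝ) : Set (Fin j → Dlt n) :=
  {w | (∀ i l, dist (w i) (w l) ≤ δ) ∧ ∀ x ρ, (∀ i, dist (v i) x ≤ ρ) → ∀ i, dist (w i) x ≤ ρ}

theorem tcone_mem_supported {k n : ℕ} (b : Dlt n) (S : Set (Fin k → Dlt n))
    (S' : Set (Fin (k + 1) → Dlt n)) (h : ∀ w ∈ S, (Fin.cons b w : Fin (k + 1) → Dlt n) ∈ S')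
    {c : Tup R k (Dlt n)} (hc : c ∈ Finsupp.supported R R S) :
    tcone R b c ∈ Finsupp.supported R R S' := by
  rw [Finsupp.supported_eq_span_single] at hc
  induction hc using Submodule.span_induction with
  | mem x hx =>
    obtain ⟨w, hw, rfl⟩ := hx
    simp only [tcone_single]
    exact Finsupp.single_mem_supported R _ (h w hw)
  | zero => simp
  | add x y _ _ hx hy => rw [map_add]; exact add_mem hx hy
  | smul r x _ hx => rw [map_smul]; exact Submodule.smul_mem _ _ hx

/-- The ball condition in `nearTup` drives the induction: the vertices of the subdivided face lie in
every ball containing the face, in particular in one about the new barycentre. A fixed N bounding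
the dimension gives one contraction factor for all faces, since x / (x + 1) increases. -/
theorem tsd_single_mem {k n : ℕ} (v : Fin k → Dlt n) (r : R) (N : ℕ) (hN : k ≤ N + 1) (δ : ℝ)
    (h : ∀ i j, dist (v i) (v j) ≤ δ) :
    tsd R bary k (Finsupp.single v r) ∈ Finsupp.supported R R (nearTup v (N / (N + 1) * δ)) := by
  induction k with
  | zero =>
    exact Finsupp.single_mem_supported R _ ⟨fun i => i.elim0, fun _ _ _ i => i.elim0⟩
  | succ k ih =>
    have hδ : 0 ≤ δ := dist_nonneg.trans (h 0 0)
    rw [tsd_single, tbd_single, map_sum, map_sum]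
    refine Submodule.sum_mem _ fun i _ => ?_
    rw [map_smul, map_smul]
    refine Submodule.smul_mem _ _ (tcone_mem_supported R _ _ _ ?_
      (ih (v ∘ i.succAbove) (by omega) fun _ _ => h _ _))
    rintro w ⟨hw1, hw2⟩
    have hb : ∀ j, dist (bary k v) (w j) ≤ N / (N + 1) * δ := by
      intro j
      rw [dist_comm]
      refine hw2 _ _ (fun l => ?_) j
      rw [dist_comm]
      refine (dist_bary_le v _ δ h).trans (mul_le_mul_of_nonneg_right ?_ hδ)
      rw [div_le_div_iff₀ (by positivity) (by positivity)]
      have : (k : ℝ) ≤ N := by exact_mod_cast (by omega : k ≤ N)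
      nlinarith
    constructor
    · intro a
      refine Fin.cases (fun c => ?_) (fun a c => ?_) a
      · refine Fin.cases ?_ (fun c => ?_) c
        · simp only [Fin.cons_zero, dist_self]; positivity
        · simpa using hb c
      · refine Fin.cases ?_ (fun c => ?_) c
        · rw [dist_comm]; simpa using hb a
        · simpa using hw1 a c
    · intro x ρ hx a
      refine Fin.cases ?_ (fun a => ?_) a
      · exact dist_aff_le v _ x ρ hx
      · simpa using hw2 x ρ (fun _ => hx _) a

theorem tsd_iterate_mem {k n : ℕ} (v : Fin k → Dlt n) (r : R) (N M : ℕ) (hN : k ≤ N + 1) (δ : ℝ)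
    (h : ∀ i j, dist (v i) (v j) ≤ δ) :
    (tsd R bary k ^ M) (Finsupp.single v r) ∈ Finsupp.supported R R
      {w : Fin k → Dlt n | ∀ i l, dist (w i) (w l) ≤ ((N : ℝ) / (N + 1)) ^ M * δ} := by
  induction M with
  | zero => simpa using Finsupp.single_mem_supported R r (s := {w : Fin k → Dlt n |
      ∀ i l, dist (w i) (w l) ≤ δ}) h
  | succ M ih =>
    rw [pow_succ' (tsd R bary k), Module.End.mul_apply]
    rw [Finsupp.supported_eq_span_single] at ih
    generalize (tsd R bary k ^ M) (Finsupp.single v r) = c at ih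
    induction ih using Submodule.span_induction with
    | mem x hx =>
      obtain ⟨w, hw, rfl⟩ := hx
      refine Finsupp.supported_mono ?_ (tsd_single_mem R w 1 N hN _ hw)
      rintro u ⟨hu, -⟩ i l
      refine (hu i l).trans (le_of_eq ?_)
      rw [pow_succ']; ring
    | zero => simp
    | add x y _ _ hx hy => rw [map_add]; exact add_mem hx hy
    | smul r x _ hx => rw [map_smul]; exact Submodule.smul_mem _ _ hx

end Affine

/-! ### Small chains -/

section Small

variable (R : Type) [CommRing R] {X Y : Type} [TopologicalSpace X] [TopologicalSpace Y]

/-- The chain in `X` given by a vertex chain in a simplex and a singular simplex of `X`. -/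
def realize {n : ℕ} (k : ℕ) (τ : C(Dlt n, X)) : Tup R (k + 1) (Dlt n) →ₗ[R] Ch R k X :=
  Finsupp.lmapDomain R R fun v => τ.comp (aff v)

@[simp] theorem realize_single {n k : ℕ} (τ : C(Dlt n, X)) (v : Fin (k + 1) → Dlt n) (r : R) :
    realize R k τ (Finsupp.single v r) = Finsupp.single (τ.comp (aff v)) r := by
  simp [realize]

theorem bd_realize {n k : ℕ} (τ : C(Dlt n, X)) (c : Tup R (k + 2) (Dlt n)) :
    bd R k (realize R (k + 1) τ c) = realize R k τ (tbd R (k + 1) c) := by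
  induction c using Finsupp.induction_linear with
  | zero => simp
  | add x y hx hy => simp only [map_add, hx, hy]
  | single v r =>
    simp only [realize_single, bd_single, tbd_single, map_sum, map_smul, ContinuousMap.comp_assoc,
      aff_face]

theorem realize_comp {n j k : ℕ} (τ : C(Dlt n, X)) (v : Fin (j + 1) → Dlt n)
    (c : Tup R (k + 1) (Dlt j)) :
    realize R k (τ.comp (aff v)) c = realize R k τ (tmap R (k + 1) (aff v) c) := by
  induction c using Finsupp.induction_linear with
  | zero => simp
  | add x y hx hy => simp only [map_add, hx, hy]
  | single w r => simp only [realize_single, tmap_single, ContinuousMap.comp_assoc, aff_aff]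

/-- The vertices of the standard simplex as a vertex chain. -/
def vtx (n : ℕ) : Tup R (n + 1) (Dlt n) := Finsupp.single (fun i => stdSimplex.vertex i) 1

theorem realize_vtx {n : ℕ} (τ : C(Dlt n, X)) : realize R n τ (vtx R n) = Finsupp.single τ 1 := by
  rw [vtx, realize_single]
  congr 1
  exact (congrArg τ.comp aff_vertex).trans (ContinuousMap.comp_id τ)

theorem tmap_aff_vtx {n k : ℕ} (v : Fin (k + 1) → Dlt n) :
    tmap R (k + 1) (aff v) (vtx R k) = Finsupp.single v 1 := by
  rw [vtx, tmap_single]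
  congr 1
  funext i
  exact aff_apply_vertex v i

/-- Barycentric subdivision of singular chains. -/
def sd (k : ℕ) : Ch R k X →ₗ[R] Ch R k X :=
  Finsupp.lsum R fun τ => LinearMap.toSpanSingleton R _
    (realize R k τ (tsd R bary (k + 1) (vtx R k)))

/-- The chain homotopy from the identity to the subdivision of singular chains. -/
def ht (k : ℕ) : Ch R k X →ₗ[R] Ch R (k + 1) X :=
  Finsupp.lsum R fun τ => LinearMap.toSpanSingleton R _
    (realize R (k + 1) τ (tht R bary (k + 1) (vtx R k)))

theorem sd_single {k : ℕ} (τ : C(Dlt k, X)) (r : R) :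
    sd R k (Finsupp.single τ r) = r • realize R k τ (tsd R bary (k + 1) (vtx R k)) := by
  simp [sd]

theorem ht_single {k : ℕ} (τ : C(Dlt k, X)) (r : R) :
    ht R k (Finsupp.single τ r) = r • realize R (k + 1) τ (tht R bary (k + 1) (vtx R k)) := by
  simp [ht]

theorem sd_realize {n k : ℕ} (τ : C(Dlt n, X)) (c : Tup R (k + 1) (Dlt n)) :
    sd R k (realize R k τ c) = realize R k τ (tsd R bary (k + 1) c) := by
  induction c using Finsupp.induction_linear with
  | zero => simp
  | add x y hx hy => simp only [map_add, hx, hy]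
  | single v r =>
    rw [realize_single, sd_single, realize_comp,
      tmap_tsd R (γ := bary) (aff v) (fun _ _ => aff_bary v _), tmap_aff_vtx, ← map_smul,
      ← map_smul]
    simp

theorem ht_realize {n k : ℕ} (τ : C(Dlt n, X)) (c : Tup R (k + 1) (Dlt n)) :
    ht R k (realize R k τ c) = realize R (k + 1) τ (tht R bary (k + 1) c) := by
  induction c using Finsupp.induction_linear with
  | zero => simp
  | add x y hx hy => simp only [map_add, hx, hy]
  | single v r =>
    rw [realize_single, ht_single, realize_comp,
      tmap_tht R (γ := bary) (aff v) (fun _ _ => aff_bary v _), tmap_aff_vtx, ← map_smul,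
      ← map_smul]
    simp

/-- Since each singular simplex is a realization of the standard vertex chain, identities between
natural operators reduce to identities of formal vertex chains. -/
theorem chain_induction {k : ℕ} {p : Ch R k X → Prop} (h0 : p 0)
    (hadd : ∀ a b, p a → p b → p (a + b)) (hsmul : ∀ (r : R) a, p a → p (r • a))
    (hs : ∀ τ, p (realize R k τ (vtx R k))) (c : Ch R k X) : p c := by
  induction c using Finsupp.induction_linear with
  | zero => exact h0
  | add x y hx hy => exact hadd _ _ hx hy
  | single τ r =>
    have := hsmul r _ (hs τ)
    rw [realize_vtx] at this
    simpa using this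

theorem bd_bd {k : ℕ} (c : Ch R (k + 2) X) : bd R k (bd R (k + 1) c) = 0 := by
  induction c using chain_induction with
  | h0 => simp
  | hadd a b ha hb => simp only [map_add, ha, hb, add_zero]
  | hsmul r a ha => simp only [map_smul, ha, smul_zero]
  | hs τ => rw [bd_realize, bd_realize, tbd_tbd, map_zero]

theorem bd_sd {k : ℕ} (c : Ch R (k + 1) X) : bd R k (sd R (k + 1) c) = sd R k (bd R k c) := by
  induction c using chain_induction with
  | h0 => simp
  | hadd a b ha hb => simp only [map_add, ha, hb]
  | hsmul r a ha => simp only [map_smul, ha]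
  | hs τ => rw [sd_realize, bd_realize, bd_realize, sd_realize, tbd_tsd]

theorem bd_ht_zero (c : Ch R 0 X) : bd R 0 (ht R 0 c) = c - sd R 0 c := by
  induction c using chain_induction with
  | h0 => simp
  | hadd a b ha hb => simp only [map_add, ha, hb]; abel
  | hsmul r a ha => simp only [map_smul, ha, smul_sub]
  | hs τ =>
    have h := tbd_tht R (bary (n := 0)) (vtx R 0)
    rw [show tht R (bary (n := 0)) 0 = 0 from rfl, LinearMap.zero_apply, add_zero] at h
    rw [ht_realize, bd_realize, sd_realize, h, map_sub]

theorem bd_ht {k : ℕ} (c : Ch R (k + 1) X) :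
    bd R (k + 1) (ht R (k + 1) c) = c - sd R (k + 1) c - ht R k (bd R k c) := by
  induction c using chain_induction with
  | h0 => simp
  | hadd a b ha hb => simp only [map_add, ha, hb]; abel
  | hsmul r a ha => simp only [map_smul, ha, smul_sub]
  | hs τ =>
    rw [ht_realize, bd_realize, sd_realize, bd_realize, ht_realize, ← map_sub, ← map_sub,
      ← tbd_tht, add_sub_cancel_right]

variable {R} in
/-- The chains whose simplices lie in `U`. -/
def sm (R : Type) [CommRing R] (U : Set X) (k : ℕ) : Submodule R (Ch R k X) :=
  Finsupp.supported R R {τ | ∀ t, τ t ∈ U}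

theorem realize_mem_sm {n k : ℕ} {U : Set X} {τ : C(Dlt n, X)} (h : ∀ t, τ t ∈ U)
    (c : Tup R (k + 1) (Dlt n)) : realize R k τ c ∈ sm R U k := by
  induction c using Finsupp.induction_linear with
  | zero => simp
  | add x y hx hy => rw [map_add]; exact add_mem hx hy
  | single v r => rw [realize_single]; exact Finsupp.single_mem_supported R _ fun t => h _

theorem map_mem_of_mem_sm {k : ℕ} {U : Set X} {M : Type} [AddCommGroup M] [Module R M]
    (φ : Ch R k X →ₗ[R] M) (S : Submodule R M)
    (hs : ∀ τ : C(Dlt k, X), (∀ t, τ t ∈ U) → φ (Finsupp.single τ 1) ∈ S) {c : Ch R k X}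
    (hc : c ∈ sm R U k) : φ c ∈ S := by
  rw [sm, Finsupp.supported_eq_span_single] at hc
  induction hc using Submodule.span_induction with
  | mem x hx => obtain ⟨w, hw, rfl⟩ := hx; exact hs w hw
  | zero => simp
  | add x y _ _ hx hy => rw [map_add]; exact add_mem hx hy
  | smul r x _ hx => rw [map_smul]; exact Submodule.smul_mem _ _ hx

theorem sd_mem_sm {k : ℕ} {U : Set X} {c : Ch R k X} (hc : c ∈ sm R U k) : sd R k c ∈ sm R U k :=
  map_mem_of_mem_sm R (sd R k) _ (fun τ hτ => by
    rw [sd_single, one_smul]; exact realize_mem_sm R hτ _) hc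

theorem ht_mem_sm {k : ℕ} {U : Set X} {c : Ch R k X} (hc : c ∈ sm R U k) :
    ht R k c ∈ sm R U (k + 1) :=
  map_mem_of_mem_sm R (ht R k) _ (fun τ hτ => by
    rw [ht_single, one_smul]; exact realize_mem_sm R hτ _) hc

theorem bd_mem_sm {k : ℕ} {U : Set X} {c : Ch R (k + 1) X} (hc : c ∈ sm R U (k + 1)) :
    bd R k c ∈ sm R U k :=
  map_mem_of_mem_sm R (bd R k) _ (fun τ hτ => by
    rw [bd_single]
    exact Submodule.sum_mem _ fun i _ => Submodule.smul_mem _ _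
      (Finsupp.single_mem_supported R _ fun t => hτ _)) hc

theorem sd_pow_realize {n k : ℕ} (τ : C(Dlt n, X)) (c : Tup R (k + 1) (Dlt n)) (N : ℕ) :
    (sd R k ^ N) (realize R k τ c) = realize R k τ ((tsd R bary (k + 1) ^ N) c) := by
  induction N with
  | zero => rfl
  | succ N ih =>
    rw [pow_succ' (sd R k), pow_succ' (tsd R bary (k + 1)), Module.End.mul_apply,
      Module.End.mul_apply, ih, sd_realize]

theorem sd_pow_mem {k : ℕ} (S : Submodule R (Ch R k X)) (hS : ∀ c ∈ S, sd R k c ∈ S) (N : ℕ)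
    {c : Ch R k X} (hc : c ∈ S) : (sd R k ^ N) c ∈ S := by
  induction N with
  | zero => exact hc
  | succ N ih => rw [pow_succ' (sd R k), Module.End.mul_apply]; exact hS _ ih

theorem sd_mem_sup {k : ℕ} {U V : Set X} {c : Ch R k X} (hc : c ∈ sm R U k ⊔ sm R V k) :
    sd R k c ∈ sm R U k ⊔ sm R V k := by
  obtain ⟨a, ha, b, hb, rfl⟩ := Submodule.mem_sup.1 hc
  rw [map_add]
  exact Submodule.add_mem_sup (sd_mem_sm R ha) (sd_mem_sm R hb)

/-- The diameters (k / (k + 1))^N · D fall below a Lebesgue number of the pulled back cover, and a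
small affine simplex lies in a ball about its first vertex. The bound is uniform in M because
subdivision preserves small chains. -/
theorem exists_sd_pow_mem {k : ℕ} {U V : Set X} (hU : IsOpen U) (hV : IsOpen V)
    (hUV : U ∪ V = Set.univ) (c : Ch R k X) :
    ∃ N : ℕ, ∀ M ≥ N, (sd R k ^ M) c ∈ sm R U k ⊔ sm R V k := by
  suffices h : ∃ N : ℕ, (sd R k ^ N) c ∈ sm R U k ⊔ sm R V k by
    obtain ⟨N, hN⟩ := h
    refine ⟨N, fun M hM => ?_⟩
    obtain ⟨j, rfl⟩ := Nat.exists_eq_add_of_le' hM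
    rw [pow_add, Module.End.mul_apply]
    exact sd_pow_mem R _ (fun _ => sd_mem_sup R) j hN
  induction c using chain_induction with
  | h0 => exact ⟨0, by simp⟩
  | hadd a b ha hb =>
    obtain ⟨N, hN⟩ := ha
    obtain ⟨M, hM⟩ := hb
    refine ⟨N + M, ?_⟩
    rw [map_add]
    refine add_mem ?_ ?_
    · rw [add_comm N M, pow_add, Module.End.mul_apply]
      exact sd_pow_mem R _ (fun _ => sd_mem_sup R) _ hN
    · rw [pow_add, Module.End.mul_apply]
      exact sd_pow_mem R _ (fun _ => sd_mem_sup R) _ hM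
  | hsmul r a ha =>
    obtain ⟨N, hN⟩ := ha
    exact ⟨N, by rw [map_smul]; exact Submodule.smul_mem _ _ hN⟩
  | hs τ =>
    obtain ⟨δ, hδ, hball⟩ := lebesgue_number_lemma_of_metric (s := (Set.univ : Set (Dlt k)))
      (c := fun i : Bool => τ ⁻¹' (if i then U else V)) isCompact_univ
      (fun i => by cases i <;> simp [hU.preimage τ.continuous, hV.preimage τ.continuous])
      (fun x _ => by
        have : τ x ∈ U ∪ V := by rw [hUV]; trivial
        rcases this with h | h
        · exact Set.mem_iUnion.2 ⟨true, by simpa using h⟩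
        · exact Set.mem_iUnion.2 ⟨false, by simpa using h⟩)
    obtain ⟨D, hD⟩ : ∃ D, ∀ x y : Dlt k, dist x y ≤ D :=
      ⟨Metric.diam (Set.univ : Set (Dlt k)), fun x y =>
        Metric.dist_le_diam_of_mem isCompact_univ.isBounded trivial trivial⟩
    have hq : (k : ℝ) / (k + 1) < 1 := by rw [div_lt_one (by positivity)]; linarith
    have ht : Filter.Tendsto (fun N : ℕ => ((k : ℝ) / (k + 1)) ^ N * D) Filter.atTop (𝓝 (0 * D)) :=
      (tendsto_pow_atTop_nhds_zero_of_lt_one (by positivity) hq).mul_const D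
    rw [zero_mul] at ht
    obtain ⟨N, hN⟩ := (ht.eventually (gt_mem_nhds hδ)).exists
    refine ⟨N, ?_⟩
    rw [sd_pow_realize]
    have hm := tsd_iterate_mem R (fun i : Fin (k + 1) => (stdSimplex.vertex i : Dlt k)) (1 : R) k N
      le_rfl D fun i j => hD _ _
    change (tsd R bary (k + 1) ^ N) (vtx R k) ∈ _ at hm
    rw [Finsupp.supported_eq_span_single] at hm
    generalize (tsd R bary (k + 1) ^ N) (vtx R k) = c at hm
    induction hm using Submodule.span_induction with
    | mem x hx =>
      obtain ⟨w, hw, rfl⟩ := hx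
      rw [realize_single]
      obtain ⟨i, hi⟩ := hball (w 0) trivial
      have hin : ∀ t, τ.comp (aff w) t ∈ if i then U else V := by
        intro t
        apply hi
        rw [Metric.mem_ball]
        exact (dist_aff_le w t (w 0) _ fun l => hw l 0).trans_lt hN
      cases i
      · exact Submodule.mem_sup_right (Finsupp.single_mem_supported R _ (by simpa using hin))
      · exact Submodule.mem_sup_left (Finsupp.single_mem_supported R _ (by simpa using hin))
    | zero => simp
    | add x y _ _ hx hy => rw [map_add]; exact add_mem hx hy
    | smul r x _ hx => rw [map_smul]; exact Submodule.smul_mem _ _ hx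

/-- The chain homotopy from the identity to the `N`-fold subdivision. -/
def htN (N k : ℕ) : Ch R k X →ₗ[R] Ch R (k + 1) X := ∑ i ∈ Finset.range N, ht R k ∘ₗ (sd R k ^ i)

theorem htN_mem_sm {N k : ℕ} {U : Set X} {c : Ch R k X} (hc : c ∈ sm R U k) :
    htN R N k c ∈ sm R U (k + 1) := by
  rw [htN, LinearMap.sum_apply]
  exact Submodule.sum_mem _ fun i _ => ht_mem_sm R (sd_pow_mem R _ (fun _ => sd_mem_sm R) i hc)

theorem bd_sd_pow {k : ℕ} (N : ℕ) (c : Ch R (k + 1) X) :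
    bd R k ((sd R (k + 1) ^ N) c) = (sd R k ^ N) (bd R k c) := by
  induction N with
  | zero => rfl
  | succ N ih =>
    rw [pow_succ' (sd R (k + 1)), pow_succ' (sd R k), Module.End.mul_apply, Module.End.mul_apply,
      bd_sd, ih]

theorem bd_htN_zero (N : ℕ) (c : Ch R 0 X) : bd R 0 (htN R N 0 c) = c - (sd R 0 ^ N) c := by
  induction N with
  | zero => simp [htN]
  | succ N ih =>
    rw [htN, Finset.sum_range_succ, LinearMap.add_apply, map_add, ← htN, ih, LinearMap.comp_apply,
      bd_ht_zero, pow_succ' (sd R 0), Module.End.mul_apply]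
    abel

theorem bd_htN {k : ℕ} (N : ℕ) (c : Ch R (k + 1) X) :
    bd R (k + 1) (htN R N (k + 1) c) = c - (sd R (k + 1) ^ N) c - htN R N k (bd R k c) := by
  induction N with
  | zero => simp [htN]
  | succ N ih =>
    rw [htN, Finset.sum_range_succ, LinearMap.add_apply, map_add, ← htN, ih, LinearMap.comp_apply,
      bd_ht, htN, htN, Finset.sum_range_succ, LinearMap.add_apply, LinearMap.comp_apply, bd_sd_pow,
      pow_succ' (sd R (k + 1)), Module.End.mul_apply]
    abel

theorem exists_small_cycle {k : ℕ} {U V : Set X} (hU : IsOpen U) (hV : IsOpen V)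
    (hUV : U ∪ V = Set.univ) (c : Ch R k X) (hc : c ∈ cyc R X k) :
    ∃ a ∈ sm R U k, ∃ b ∈ sm R V k, ∃ w : Ch R (k + 1) X, bd R k w = c - (a + b) := by
  obtain ⟨N, hN⟩ := exists_sd_pow_mem R hU hV hUV c
  obtain ⟨a, ha, b, hb, hab⟩ := Submodule.mem_sup.1 (hN N le_rfl)
  refine ⟨a, ha, b, hb, htN R N k c, ?_⟩
  cases k with
  | zero => rw [bd_htN_zero, hab]
  | succ k =>
    have : bd R k c = 0 := hc
    rw [bd_htN, hab, this, map_zero, sub_zero]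

/-- Subdividing `e` makes it small but changes its boundary from a + b to its subdivision; the
homotopy applied separately to a and b corrects this without leaving U and V. -/
theorem exists_small_bounding {k : ℕ} {U V : Set X} (hU : IsOpen U) (hV : IsOpen V)
    (hUV : U ∪ V = Set.univ) (e : Ch R (k + 1) X) {a b : Ch R k X} (ha : a ∈ sm R U k)
    (hb : b ∈ sm R V k) (he : bd R k e = a + b) :
    ∃ a' ∈ sm R U (k + 1), ∃ b' ∈ sm R V (k + 1), bd R k a' + bd R k b' = a + b := by
  obtain ⟨N, hN⟩ := exists_sd_pow_mem R hU hV hUV e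
  obtain ⟨a', ha', b', hb', hab⟩ := Submodule.mem_sup.1 (hN N le_rfl)
  refine ⟨a' + htN R N k a, add_mem ha' (htN_mem_sm R ha), b' + htN R N k b,
    add_mem hb' (htN_mem_sm R hb), ?_⟩
  have h1 : bd R k a' + bd R k b' = (sd R k ^ N) (a + b) := by
    rw [← map_add, hab, bd_sd_pow, he]
  have h2 : bd R k (htN R N k a) + bd R k (htN R N k b) = a + b - (sd R k ^ N) (a + b) := by
    rw [← map_add, ← map_add]
    cases k with
    | zero => rw [bd_htN_zero]
    | succ k =>
      have : bd R k (a + b) = 0 := by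
        rw [← he]; exact bd_bd R e
      rw [bd_htN, this, map_zero, sub_zero]
  rw [map_add, map_add, add_add_add_comm, h1, h2]
  abel

end Small

/-! ### The Mayer-Vietoris sequence -/

section MayerVietoris

variable (R : Type) [CommRing R] {X Y : Type} [TopologicalSpace X] [TopologicalSpace Y]

/-- The inclusion of a subset. -/
def inc (U : Set X) : C(U, X) := ⟨Subtype.val, continuous_subtype_val⟩

/-- The inclusion of a subset into a larger one. -/
def incl {U V : Set X} (h : U ⊆ V) : C(U, V) := ⟨Set.inclusion h, continuous_inclusion h⟩

/-- A cover by two open sets. -/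
structure Cover (X : Type) [TopologicalSpace X] where
  U : Set X
  V : Set X
  isOpen_U : IsOpen U
  isOpen_V : IsOpen V
  union_eq : U ∪ V = Set.univ

theorem push_injective {k : ℕ} {f : C(X, Y)} (hf : Function.Injective f) :
    Function.Injective (push R k f) := by
  apply Finsupp.mapDomain_injective
  intro a b hab
  ext t
  exact hf (congrArg (fun c : C(Dlt k, Y) => c t) hab)

theorem push_inc_mem {k : ℕ} (U : Set X) (c : Ch R k U) : push R k (inc U) c ∈ sm R U k := by
  induction c using Finsupp.induction_linear with
  | zero => simp
  | add x y hx hy => rw [map_add]; exact add_mem hx hy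
  | single τ r =>
    rw [push_single]
    exact Finsupp.single_mem_supported R _ fun t => (τ t).2

theorem exists_push_inc {k : ℕ} {U : Set X} {c : Ch R k X} (hc : c ∈ sm R U k) :
    ∃ a : Ch R k U, push R k (inc U) a = c := by
  have := map_mem_of_mem_sm R LinearMap.id (LinearMap.range (push R k (inc U))) (fun τ hτ =>
    ⟨Finsupp.single ⟨fun t => ⟨τ t, hτ t⟩, τ.continuous.subtype_mk _⟩ 1, by
      rw [push_single]; rfl⟩) hc
  exact this

theorem exists_push_inc_inter {k : ℕ} {U V : Set X} {c : Ch R k X} (hU : c ∈ sm R U k)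
    (hV : c ∈ sm R V k) : ∃ a : Ch R k ↥(U ∩ V), push R k (inc (U ∩ V)) a = c := by
  apply exists_push_inc
  have : c ∈ sm R U k ⊓ sm R V k := ⟨hU, hV⟩
  rw [sm, sm, ← Finsupp.supported_inter] at this
  exact Finsupp.supported_mono (fun τ hτ t => ⟨hτ.1 t, hτ.2 t⟩) this

theorem push_push {Z : Type} [TopologicalSpace Z] {k : ℕ} (g : C(Y, Z)) (f : C(X, Y))
    (c : Ch R k X) :
    push R k g (push R k f c) = push R k (g.comp f) c := by
  induction c using Finsupp.induction_linear with
  | zero => simp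
  | add x y hx hy => simp only [map_add, hx, hy]
  | single τ r => simp only [push_single, ContinuousMap.comp_assoc]

theorem inc_injective (U : Set X) : Function.Injective (inc U) := Subtype.val_injective

theorem mem_cyc_of_push {k : ℕ} {f : C(X, Y)} (hf : Function.Injective f) {c : Ch R k X}
    (h : push R k f c ∈ cyc R Y k) : c ∈ cyc R X k := by
  cases k with
  | zero => trivial
  | succ k =>
    have h' : bd R k (push R (k + 1) f c) = 0 := h
    rw [bd_push] at h'
    exact push_injective R hf (by rw [h', map_zero])

theorem bd_mem_cyc {k : ℕ} (c : Ch R (k + 1) X) : bd R k c ∈ cyc R X k := by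
  cases k with
  | zero => trivial
  | succ k => exact bd_bd R c

/-- The graph of the connecting homomorphism: the class of `a + b`, with `a` in `U` and `b` in `V`,
is related to the class of `∂ a`. -/
def MVRel (C : Cover X) (k : ℕ) (z : Hom R (k + 1) X) (w : Hom R k ↥(C.U ∩ C.V)) : Prop :=
  ∃ a ∈ sm R C.U (k + 1), ∃ b ∈ sm R C.V (k + 1), ∃ h : a + b ∈ cyc R X (k + 1),
    cls R (k + 1) X ⟨a + b, h⟩ = z ∧ ∃ c : cyc R ↥(C.U ∩ C.V) k,
      push R k (inc (C.U ∩ C.V)) (c : Ch R k ↥(C.U ∩ C.V)) = bd R k a ∧ cls R k _ c = w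

variable {R} {C : Cover X} {k : ℕ}

theorem cls_eq_cls {a b : cyc R X k} (w : Ch R (k + 1) X) (h : bd R k w = a - b) :
    cls R k X a = cls R k X b := by
  rw [← sub_eq_zero, ← map_sub, cls_eq_zero_iff]
  exact ⟨w, by rw [h]; rfl⟩

theorem MVRel.exists (C : Cover X) (z : Hom R (k + 1) X) : ∃ w, MVRel R C k z w := by
  obtain ⟨⟨c, hc⟩, rfl⟩ := cls_surjective R (k + 1) z
  obtain ⟨a, ha, b, hb, w, hw⟩ := exists_small_cycle R C.isOpen_U C.isOpen_V C.union_eq c hc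
  have hab : a + b ∈ cyc R X (k + 1) := by
    have : a + b = c - bd R (k + 1) w := by rw [hw]; abel
    rw [this]
    exact sub_mem hc (bd_mem_cyc R w)
  have hV : bd R k a ∈ sm R C.V k := by
    have h0 : bd R k (a + b) = 0 := hab
    rw [map_add, add_eq_zero_iff_eq_neg] at h0
    rw [h0]
    exact neg_mem (bd_mem_sm R hb)
  obtain ⟨d, hd⟩ := exists_push_inc_inter R (bd_mem_sm R ha) hV
  have hd' : d ∈ cyc R ↥(C.U ∩ C.V) k :=
    mem_cyc_of_push R (inc_injective _) (by rw [hd]; exact bd_mem_cyc R a)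
  exact ⟨_, a, ha, b, hb, hab, (cls_eq_cls w (by rw [hw])).symm, ⟨d, hd'⟩, hd, rfl⟩

theorem MVRel.add {z z' : Hom R (k + 1) X} {w w' : Hom R k ↥(C.U ∩ C.V)} (h : MVRel R C k z w)
    (h' : MVRel R C k z' w') : MVRel R C k (z + z') (w + w') := by
  obtain ⟨a, ha, b, hb, hab, rfl, c, hc, rfl⟩ := h
  obtain ⟨a', ha', b', hb', hab', rfl, c', hc', rfl⟩ := h'
  have e : a + a' + (b + b') = a + b + (a' + b') := by abel
  refine ⟨a + a', add_mem ha ha', b + b', add_mem hb hb', by rw [e]; exact add_mem hab hab', ?_,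
    c + c', ?_, map_add _ _ _⟩
  · rw [← map_add]; congr 1; exact Subtype.ext e
  · rw [map_add, Submodule.coe_add, map_add, hc, hc']

theorem MVRel.smul {z : Hom R (k + 1) X} {w : Hom R k ↥(C.U ∩ C.V)} (h : MVRel R C k z w) (r : R) :
    MVRel R C k (r • z) (r • w) := by
  obtain ⟨a, ha, b, hb, hab, rfl, c, hc, rfl⟩ := h
  have e : r • a + r • b = r • (a + b) := (smul_add _ _ _).symm
  refine ⟨r • a, Submodule.smul_mem _ _ ha, r • b, Submodule.smul_mem _ _ hb,
    by rw [e]; exact Submodule.smul_mem _ _ hab, ?_, r • c, ?_, map_smul _ _ _⟩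
  · rw [← map_smul]; congr 1; exact Subtype.ext e
  · rw [map_smul, Submodule.coe_smul, map_smul, hc]

/-- If a + b bounds, it bounds a small chain a' + b'. Then a - ∂a' = ∂b' - b lies in both open sets,
hence in the intersection, and its boundary is ∂a. -/
theorem MVRel.eq_zero {w : Hom R k ↥(C.U ∩ C.V)} (h : MVRel R C k 0 w) : w = 0 := by
  obtain ⟨a, ha, b, hb, hab, hz, c, hc, rfl⟩ := h
  obtain ⟨e, he⟩ := (cls_eq_zero_iff R _ _).1 hz
  obtain ⟨a', ha', b', hb', hab'⟩ :=
    exists_small_bounding R C.isOpen_U C.isOpen_V C.union_eq e ha hb he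
  have hV : a - bd R (k + 1) a' ∈ sm R C.V (k + 1) := by
    have : a - bd R (k + 1) a' = bd R (k + 1) b' - b := by
      rw [sub_eq_sub_iff_add_eq_add, ← hab']; abel
    rw [this]
    exact sub_mem (bd_mem_sm R hb') hb
  obtain ⟨d, hd⟩ := exists_push_inc_inter R (sub_mem ha (bd_mem_sm R ha')) hV
  rw [cls_eq_zero_iff]
  refine ⟨d, push_injective R (inc_injective _) ?_⟩
  rw [← bd_push, hd, map_sub, bd_bd, sub_zero, hc]

theorem MVRel.unique {z : Hom R (k + 1) X} {w w' : Hom R k ↥(C.U ∩ C.V)} (h : MVRel R C k z w)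
    (h' : MVRel R C k z w') : w = w' := by
  have := (h.add (h'.smul (-1)))
  rw [neg_one_smul, add_neg_cancel, neg_one_smul, ← sub_eq_add_neg] at this
  exact sub_eq_zero.1 this.eq_zero

variable (R) in
/-- The connecting homomorphism of the Mayer-Vietoris sequence. -/
def mvδ (C : Cover X) (k : ℕ) : Hom R (k + 1) X →ₗ[R] Hom R k ↥(C.U ∩ C.V) where
  toFun z := (MVRel.exists C z).choose
  map_add' z z' := (MVRel.exists C (z + z')).choose_spec.unique
    ((MVRel.exists C z).choose_spec.add (MVRel.exists C z').choose_spec)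
  map_smul' r z := (MVRel.exists C (r • z)).choose_spec.unique
    ((MVRel.exists C z).choose_spec.smul r)

theorem mvδ_rel (C : Cover X) (z : Hom R (k + 1) X) : MVRel R C k z (mvδ R C k z) :=
  (MVRel.exists C z).choose_spec

theorem MVRel.eq {z : Hom R (k + 1) X} {w : Hom R k ↥(C.U ∩ C.V)} (h : MVRel R C k z w) :
    mvδ R C k z = w := (mvδ_rel C z).unique h

theorem inc_comp_incl {U V : Set X} (h : U ⊆ V) : (inc V).comp (incl h) = inc U := rfl

theorem hmap_mvδ_left (C : Cover X) (z : Hom R (k + 1) X) :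
    hmap R k (incl Set.inter_subset_left) (mvδ R C k z) = 0 := by
  obtain ⟨a, ha, b, hb, hab, -, c, hc, h⟩ := mvδ_rel C z
  rw [← h, hmap_cls, cls_eq_zero_iff]
  obtain ⟨a', rfl⟩ := exists_push_inc R ha
  refine ⟨a', push_injective R (inc_injective _) ?_⟩
  rw [← bd_push, ← hc, push_push]
  rfl

theorem hmap_mvδ_right (C : Cover X) (z : Hom R (k + 1) X) :
    hmap R k (incl Set.inter_subset_right) (mvδ R C k z) = 0 := by
  obtain ⟨a, ha, b, hb, hab, -, c, hc, h⟩ := mvδ_rel C z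
  rw [← h, hmap_cls, cls_eq_zero_iff]
  obtain ⟨b', rfl⟩ := exists_push_inc R hb
  refine ⟨-b', push_injective R (inc_injective _) ?_⟩
  have h0 : bd R k (a + _) = 0 := hab
  rw [map_add, add_eq_zero_iff_eq_neg] at h0
  rw [map_neg, map_neg, ← bd_push, ← h0, ← hc, push_push]
  rfl

theorem mvδ_hmap_left (C : Cover X) (u : Hom R (k + 1) C.U) :
    mvδ R C k (hmap R (k + 1) (inc C.U) u) = 0 := by
  obtain ⟨a, rfl⟩ := cls_surjective R (k + 1) u
  apply MVRel.eq
  rw [hmap_cls]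
  refine ⟨_, push_inc_mem R _ a, 0, zero_mem _, by rw [add_zero]; exact push_mem_cyc R _ a.2,
    ?_, 0, ?_, map_zero _⟩
  · congr 1; exact Subtype.ext (add_zero _)
  · rw [Submodule.coe_zero, map_zero, bd_push, show bd R k (a : Ch R (k + 1) C.U) = 0 from a.2,
      map_zero]

theorem mvδ_hmap_right (C : Cover X) (v : Hom R (k + 1) C.V) :
    mvδ R C k (hmap R (k + 1) (inc C.V) v) = 0 := by
  obtain ⟨a, rfl⟩ := cls_surjective R (k + 1) v
  apply MVRel.eq
  rw [hmap_cls]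
  refine ⟨0, zero_mem _, _, push_inc_mem R _ a, by rw [zero_add]; exact push_mem_cyc R _ a.2,
    ?_, 0, ?_, map_zero _⟩
  · congr 1; exact Subtype.ext (zero_add _)
  · rw [Submodule.coe_zero, map_zero, map_zero]

/-- If ∂a bounds d inside the intersection, then a - d and b + d are cycles of the two pieces with
the same sum as a and b. -/
theorem mv_exact_total (C : Cover X) {z : Hom R (k + 1) X} (h : mvδ R C k z = 0) :
    ∃ u v, z = hmap R (k + 1) (inc C.U) u + hmap R (k + 1) (inc C.V) v := by
  obtain ⟨a, ha, b, hb, hab, rfl, c, hc, hcz⟩ := mvδ_rel C z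
  rw [h, cls_eq_zero_iff] at hcz
  obtain ⟨d, hd⟩ := hcz
  rw [← hd] at hc
  obtain ⟨a', rfl⟩ := exists_push_inc R ha
  obtain ⟨b', rfl⟩ := exists_push_inc R hb
  have hab0 : bd R k (_ + _) = 0 := hab
  rw [map_add, ← hc, ← bd_push] at hab0
  rw [← bd_push] at hc
  let dU := push R (k + 1) (incl (Set.inter_subset_left : C.U ∩ C.V ⊆ C.U)) d
  let dV := push R (k + 1) (incl (Set.inter_subset_right : C.U ∩ C.V ⊆ C.V)) d
  have eU : push R (k + 1) (inc C.U) dU = push R (k + 1) (inc (C.U ∩ C.V)) d := push_push ..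
  have eV : push R (k + 1) (inc C.V) dV = push R (k + 1) (inc (C.U ∩ C.V)) d := push_push ..
  have h1 : a' - dU ∈ cyc R C.U (k + 1) := by
    apply mem_cyc_of_push R (inc_injective C.U)
    change bd R k _ = 0
    rw [map_sub, eU, map_sub, hc, sub_self]
  have h2 : b' + dV ∈ cyc R C.V (k + 1) := by
    apply mem_cyc_of_push R (inc_injective C.V)
    change bd R k _ = 0
    rw [map_add, eV, map_add, add_comm, hab0]
  refine ⟨cls R _ _ ⟨_, h1⟩, cls R _ _ ⟨_, h2⟩, ?_⟩
  rw [hmap_cls, hmap_cls, ← map_add]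
  congr 1
  apply Subtype.ext
  simp only [Submodule.coe_add, map_sub, map_add, eU, eV]
  abel

theorem mv_exact_zero (C : Cover X) (z : Hom R 0 X) :
    ∃ u v, z = hmap R 0 (inc C.U) u + hmap R 0 (inc C.V) v := by
  obtain ⟨⟨c, hc⟩, rfl⟩ := cls_surjective R 0 z
  obtain ⟨a, ha, b, hb, w, hw⟩ := exists_small_cycle R C.isOpen_U C.isOpen_V C.union_eq c hc
  obtain ⟨a', rfl⟩ := exists_push_inc R ha
  obtain ⟨b', rfl⟩ := exists_push_inc R hb
  refine ⟨cls R 0 _ ⟨a', trivial⟩, cls R 0 _ ⟨b', trivial⟩, ?_⟩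
  rw [hmap_cls, hmap_cls, ← map_add]
  exact cls_eq_cls w (by rw [hw]; rfl)

theorem mv_exact_inter (C : Cover X) {w : Hom R k ↥(C.U ∩ C.V)}
    (hU : hmap R k (incl Set.inter_subset_left) w = 0)
    (hV : hmap R k (incl Set.inter_subset_right) w = 0) : ∃ z, mvδ R C k z = w := by
  obtain ⟨c, rfl⟩ := cls_surjective R k w
  rw [hmap_cls, cls_eq_zero_iff] at hU hV
  obtain ⟨a, ha⟩ := hU
  obtain ⟨b, hb⟩ := hV
  have h1 : bd R k (push R (k + 1) (inc C.U) a) = push R k (inc (C.U ∩ C.V)) c := by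
    rw [bd_push, ha, push_push]; rfl
  have h2 : bd R k (push R (k + 1) (inc C.V) b) = push R k (inc (C.U ∩ C.V)) c := by
    rw [bd_push, hb, push_push]; rfl
  have hab : push R (k + 1) (inc C.U) a + -push R (k + 1) (inc C.V) b ∈ cyc R X (k + 1) := by
    change bd R k _ = 0
    rw [map_add, map_neg, h1, h2, add_neg_cancel]
  exact ⟨cls R _ _ ⟨_, hab⟩, MVRel.eq ⟨_, push_inc_mem R _ a, _, neg_mem (push_inc_mem R _ b), hab,
    rfl, c, h1.symm, rfl⟩⟩

/-- A small chain a' + b' bounding the difference shows that a - ∂a' = b + ∂b'; this cycle lies in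
both open sets and represents both classes. -/
theorem mv_exact_sum (C : Cover X) {u : Hom R k C.U} {v : Hom R k C.V}
    (h : hmap R k (inc C.U) u = hmap R k (inc C.V) v) :
    ∃ w : Hom R k ↥(C.U ∩ C.V), hmap R k (incl Set.inter_subset_left) w = u ∧
      hmap R k (incl Set.inter_subset_right) w = v := by
  obtain ⟨a, rfl⟩ := cls_surjective R k u
  obtain ⟨b, rfl⟩ := cls_surjective R k v
  rw [hmap_cls, hmap_cls, ← sub_eq_zero, ← map_sub, cls_eq_zero_iff] at h
  obtain ⟨e, he⟩ := h
  obtain ⟨a', ha', b', hb', hab⟩ := exists_small_bounding R C.isOpen_U C.isOpen_V C.union_eq e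
    (push_inc_mem R _ (a : Ch R k C.U)) (neg_mem (push_inc_mem R _ (b : Ch R k C.V)))
    (by rw [he, ← sub_eq_add_neg]; rfl)
  obtain ⟨a', rfl⟩ := exists_push_inc R ha'
  obtain ⟨b', rfl⟩ := exists_push_inc R hb'
  have e1 : push R k (inc C.U) (a : Ch R k C.U) - bd R k (push R (k + 1) (inc C.U) a') =
      push R k (inc C.V) b + bd R k (push R (k + 1) (inc C.V) b') := by
    rw [sub_eq_iff_eq_add, add_assoc, add_comm (bd R k _), hab]; abel
  have hVm : push R k (inc C.U) (a : Ch R k C.U) - bd R k (push R (k + 1) (inc C.U) a') ∈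
      sm R C.V k := by
    rw [e1]; exact add_mem (push_inc_mem R _ _) (bd_mem_sm R hb')
  obtain ⟨c, hc⟩ := exists_push_inc_inter R
    (sub_mem (push_inc_mem R _ (a : Ch R k C.U)) (bd_mem_sm R ha')) hVm
  have hcc : c ∈ cyc R _ k := by
    apply mem_cyc_of_push R (inc_injective _)
    rw [hc]
    exact sub_mem (push_mem_cyc R _ a.2) (bd_mem_cyc R _)
  refine ⟨cls R k _ ⟨c, hcc⟩, ?_, ?_⟩
  · rw [hmap_cls]
    refine cls_eq_cls (-a') (push_injective R (inc_injective _) ?_)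
    rw [map_neg, map_neg, map_sub, push_push, inc_comp_incl, hc, ← bd_push]
    abel
  · rw [hmap_cls]
    refine cls_eq_cls b' (push_injective R (inc_injective _) ?_)
    rw [map_sub, push_push, inc_comp_incl, hc, e1, ← bd_push]
    abel

/-- The map induced on subsets. -/
def restr (f : C(X, Y)) {A : Set X} {B : Set Y} (h : Set.MapsTo f A B) : C(A, B) :=
  ⟨fun x => ⟨f x, h x.2⟩, (f.continuous.comp continuous_subtype_val).subtype_mk _⟩

theorem push_mem_sm {f : C(X, Y)} {A : Set X} {B : Set Y} (h : Set.MapsTo f A B) {c : Ch R k X}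
    (hc : c ∈ sm R A k) : push R k f c ∈ sm R B k :=
  map_mem_of_mem_sm R (push R k f) _ (fun τ hτ => by
    rw [push_single]; exact Finsupp.single_mem_supported R _ fun t => h (hτ t)) hc

theorem mvδ_natural (C : Cover X) (C' : Cover Y) (f : C(X, Y)) (hU : Set.MapsTo f C.U C'.U)
    (hV : Set.MapsTo f C.V C'.V) (z : Hom R (k + 1) X) :
    mvδ R C' k (hmap R (k + 1) f z) =
      hmap R k (restr f (hU.inter_inter hV)) (mvδ R C k z) := by
  obtain ⟨a, ha, b, hb, hab, hz, c, hc, hw⟩ := mvδ_rel C z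
  apply MVRel.eq
  rw [← hw, ← hz, hmap_cls, hmap_cls]
  refine ⟨push R _ f a, push_mem_sm hU ha, push R _ f b, push_mem_sm hV hb, ?_, ?_, _, ?_, rfl⟩
  · rw [← map_add]; exact push_mem_cyc R f hab
  · congr 1
    exact Subtype.ext (map_add _ _ _).symm
  · rw [bd_push, ← hc, push_push, push_push]
    rfl

end MayerVietoris

/-! ### Homology isomorphisms and Mayer-Vietoris squares -/

section HIso

variable (R : Type) [CommRing R] {X Y Z : Type} [TopologicalSpace X] [TopologicalSpace Y]
  [TopologicalSpace Z]

/-- A map that induces isomorphisms in homology. -/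
def HIso (f : C(X, Y)) : Prop := ∀ k, Function.Bijective (hmap R k f)

theorem hmap_id_apply (k : ℕ) (z : Hom R k X) : hmap R k (ContinuousMap.id X) z = z := by
  rw [hmap_id]; rfl

variable {R}

theorem HIso.of_homotopyInverse {f : C(X, Y)} (g : C(Y, X))
    (h1 : (g.comp f).Homotopic (ContinuousMap.id X))
    (h2 : (f.comp g).Homotopic (ContinuousMap.id Y)) : HIso R f := by
  intro k
  have e1 := hmap_homotopic R k h1
  have e2 := hmap_homotopic R k h2
  rw [hmap_comp, hmap_id] at e1 e2
  exact Function.bijective_iff_has_inverse.2 ⟨hmap R k g, fun z => congrArg (fun φ => φ z) e1,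
    fun z => congrArg (fun φ => φ z) e2⟩

theorem HIso.of_inverse {f : C(X, Y)} (g : C(Y, X)) (h1 : ∀ x, g (f x) = x)
    (h2 : ∀ y, f (g y) = y) : HIso R f := by
  refine HIso.of_homotopyInverse g ?_ ?_
  · rw [show g.comp f = ContinuousMap.id X from ContinuousMap.ext h1]
  · rw [show f.comp g = ContinuousMap.id Y from ContinuousMap.ext h2]

theorem HIso.comp {g : C(Y, Z)} {f : C(X, Y)} (hg : HIso R g) (hf : HIso R f) :
    HIso R (g.comp f) := by
  intro k
  rw [hmap_comp]
  exact (hg k).comp (hf k)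

/-- The inverse of a homology isomorphism. -/
def HIso.inv {f : C(X, Y)} (h : HIso R f) (k : ℕ) : Hom R k Y →ₗ[R] Hom R k X :=
  (LinearEquiv.ofBijective (hmap R k f) (h k)).symm.toLinearMap

@[simp] theorem HIso.hmap_inv {f : C(X, Y)} (h : HIso R f) (k : ℕ) (z : Hom R k Y) :
    hmap R k f (h.inv k z) = z :=
  (LinearEquiv.ofBijective (hmap R k f) (h k)).apply_symm_apply z

@[simp] theorem HIso.inv_hmap {f : C(X, Y)} (h : HIso R f) (k : ℕ) (z : Hom R k X) :
    h.inv k (hmap R k f z) = z :=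
  (LinearEquiv.ofBijective (hmap R k f) (h k)).symm_apply_apply z

theorem HIso.inv_eq_iff {f : C(X, Y)} (h : HIso R f) {k : ℕ} {z : Hom R k Y} {w : Hom R k X} :
    h.inv k z = w ↔ z = hmap R k f w := by
  constructor
  · rintro rfl; simp
  · rintro rfl; simp

theorem hom_eq_zero_of_isEmpty [IsEmpty X] (k : ℕ) (z : Hom R k X) : z = 0 := by
  obtain ⟨⟨c, hc⟩, rfl⟩ := cls_surjective R k z
  have : IsEmpty C(Dlt k, X) := ⟨fun τ => isEmptyElim (τ (stdSimplex.vertex 0))⟩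
  have h0 : c = 0 := Subsingleton.elim _ _
  subst h0
  exact map_zero (cls R k X)

theorem hom_point_eq_zero (k : ℕ) (hk : k ≠ 0) (z : Hom R k PUnit) : z = 0 := by
  have := AlgebraicTopology.isZero_singularHomologyFunctor_of_totallyDisconnectedSpace
    (ModuleCat.{0} R) k (ModuleCat.of R R) (TopCat.of PUnit) hk
  exact (ModuleCat.isZero_iff_subsingleton.1 this).elim z 0

/-- The constant simplex at a point. -/
def ptClass (R : Type) [CommRing R] : Hom R 0 PUnit :=
  cls R 0 PUnit ⟨Finsupp.single (ContinuousMap.const _ PUnit.unit) 1, trivial⟩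

theorem exists_smul_ptClass (z : Hom R 0 PUnit) : ∃ r : R, z = r • ptClass R := by
  obtain ⟨⟨c, hc⟩, rfl⟩ := cls_surjective R 0 z
  refine ⟨c (ContinuousMap.const _ PUnit.unit), ?_⟩
  rw [ptClass, ← map_smul]
  congr 1
  apply Subtype.ext
  ext τ
  rw [Subsingleton.elim τ (ContinuousMap.const _ PUnit.unit)]
  simp

theorem bd_point (w : Ch R 1 PUnit) : bd R 0 w = 0 := by
  induction w using Finsupp.induction_linear with
  | zero => simp
  | add x y hx hy => rw [map_add, hx, hy, add_zero]
  | single τ r =>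
    rw [bd_single, Fin.sum_univ_two,
      Subsingleton.elim (τ.comp (faceMap 0)) (τ.comp (faceMap 1))]
    simp

theorem smul_ptClass_eq_zero {r : R} (h : r • ptClass R = 0) : r = 0 := by
  rw [ptClass, ← map_smul, cls_eq_zero_iff] at h
  obtain ⟨w, hw⟩ := h
  rw [bd_point] at hw
  have := congrArg (fun c : Ch R 0 PUnit => c (ContinuousMap.const _ PUnit.unit)) hw
  simpa using this.symm

/-- The map to a point. -/
def toPt (X : Type) [TopologicalSpace X] : C(X, PUnit) := ContinuousMap.const _ PUnit.unit

theorem hIso_toPt {x : X} (h : (ContinuousMap.const X x).Homotopic (ContinuousMap.id X)) :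
    HIso R (toPt X) := by
  refine HIso.of_homotopyInverse (ContinuousMap.const _ x) h ?_
  rw [Subsingleton.elim ((toPt X).comp _) (ContinuousMap.id PUnit)]

theorem hom_eq_zero_of_hIso_toPt (h : HIso R (toPt X)) {k : ℕ} (hk : k ≠ 0) (z : Hom R k X) :
    z = 0 :=
  (h k).1 (by rw [hom_point_eq_zero k hk (hmap R k _ z), map_zero])

end HIso

/-! ### Mayer-Vietoris squares up to homology isomorphism. -/

section MVSquare

variable (R : Type) [CommRing R] {C A B X C' A' B' : Type} [TopologicalSpace C]
  [TopologicalSpace A] [TopologicalSpace B] [TopologicalSpace C'] [TopologicalSpace A']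
  [TopologicalSpace B'] [TopologicalSpace X]

/-- A commutative square with a Mayer-Vietoris sequence. -/
structure MVSquare (f : C(C, A)) (g : C(C, B)) (i : C(A, X)) (j : C(B, X))
    (δ : ∀ k, Hom R (k + 1) X →ₗ[R] Hom R k C) : Prop where
  comm : ∀ k w, hmap R k i (hmap R k f w) = hmap R k j (hmap R k g w)
  left_δ : ∀ k z, hmap R k f (δ k z) = 0
  right_δ : ∀ k z, hmap R k g (δ k z) = 0
  δ_left : ∀ k u, δ k (hmap R (k + 1) i u) = 0
  δ_right : ∀ k v, δ k (hmap R (k + 1) j v) = 0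
  exact_total : ∀ k z, δ k z = 0 → ∃ u v, z = hmap R (k + 1) i u + hmap R (k + 1) j v
  exact_zero : ∀ z, ∃ u v, z = hmap R 0 i u + hmap R 0 j v
  exact_inter : ∀ k w, hmap R k f w = 0 → hmap R k g w = 0 → ∃ z, δ k z = w
  exact_sum : ∀ k u v, hmap R k i u = hmap R k j v → ∃ w, hmap R k f w = u ∧ hmap R k g w = v

variable {R} {f : C(C, A)} {g : C(C, B)} {i : C(A, X)} {j : C(B, X)}
  {δ : ∀ k, Hom R (k + 1) X →ₗ[R] Hom R k C}

theorem Cover.mvSquare (K : Cover X) :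
    MVSquare R (incl (Set.inter_subset_left : K.U ∩ K.V ⊆ K.U))
      (incl (Set.inter_subset_right : K.U ∩ K.V ⊆ K.V)) (inc K.U) (inc K.V) (mvδ R K) where
  comm k w := by rw [← hmap_comp_apply, ← hmap_comp_apply, inc_comp_incl, inc_comp_incl]
  left_δ _ := hmap_mvδ_left K
  right_δ _ := hmap_mvδ_right K
  δ_left _ := mvδ_hmap_left K
  δ_right _ := mvδ_hmap_right K
  exact_total _ _ := mv_exact_total K
  exact_zero := mv_exact_zero K
  exact_inter _ _ := mv_exact_inter K
  exact_sum _ _ _ := mv_exact_sum K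

/-- Replacing the corners of a Mayer-Vietoris square by homology equivalent spaces mapping to
them. -/
theorem MVSquare.pull (S : MVSquare R f g i j δ) {c : C(C', C)} {a : C(A', A)} {b : C(B', B)}
    (hc : HIso R c) (ha : HIso R a) (hb : HIso R b) {f' : C(C', A')} {g' : C(C', B')}
    {i' : C(A', X)} {j' : C(B', X)} (ef : a.comp f' = f.comp c) (eg : b.comp g' = g.comp c)
    (ei : i.comp a = i') (ej : j.comp b = j') :
    MVSquare R f' g' i' j' (fun k => hc.inv k ∘ₗ δ k) := by
  have ef' : ∀ k w, hmap R k a (hmap R k f' w) = hmap R k f (hmap R k c w) := fun k w => by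
    rw [← hmap_comp_apply, ef, hmap_comp_apply]
  have eg' : ∀ k w, hmap R k b (hmap R k g' w) = hmap R k g (hmap R k c w) := fun k w => by
    rw [← hmap_comp_apply, eg, hmap_comp_apply]
  have ei' : ∀ k w, hmap R k i' w = hmap R k i (hmap R k a w) := fun k w => by
    rw [← hmap_comp_apply, ei]
  have ej' : ∀ k w, hmap R k j' w = hmap R k j (hmap R k b w) := fun k w => by
    rw [← hmap_comp_apply, ej]
  constructor
  · intro k w; rw [ei', ef', ej', eg', S.comm]
  · intro k z; apply (ha k).1; rw [ef']; simp [S.left_δ]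
  · intro k z; apply (hb k).1; rw [eg']; simp [S.right_δ]
  · intro k u; rw [ei']; simp [S.δ_left]
  · intro k u; rw [ej']; simp [S.δ_right]
  · intro k z hz
    have : δ k z = 0 := by
      have := (hc.inv_eq_iff (z := δ k z) (w := 0)).1 hz
      rwa [map_zero] at this
    obtain ⟨u, v, rfl⟩ := S.exact_total k z this
    exact ⟨ha.inv _ u, hb.inv _ v, by rw [ei', ej']; simp⟩
  · intro z
    obtain ⟨u, v, rfl⟩ := S.exact_zero z
    exact ⟨ha.inv _ u, hb.inv _ v, by rw [ei', ej']; simp⟩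
  · intro k w h1 h2
    obtain ⟨z, hz⟩ := S.exact_inter k (hmap R k c w) (by rw [← ef', h1, map_zero])
      (by rw [← eg', h2, map_zero])
    exact ⟨z, by simp [hz]⟩
  · intro k u v h
    rw [ei', ej'] at h
    obtain ⟨w, h1, h2⟩ := S.exact_sum k _ _ h
    refine ⟨hc.inv k w, (ha k).1 ?_, (hb k).1 ?_⟩
    · rw [ef']; simp [h1]
    · rw [eg']; simp [h2]

/-- Replacing two corners of a Mayer-Vietoris square by homology equivalent spaces to which they
map. -/
theorem MVSquare.push (S : MVSquare R f g i j δ) {c : C(C, C')} {b : C(B, B')}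
    (hc : HIso R c) (hb : HIso R b) {f' : C(C', A)} {g' : C(C', B')}
    {j' : C(B', X)} (ef : f'.comp c = f) (eg : g'.comp c = b.comp g) (ej : j'.comp b = j) :
    MVSquare R f' g' i j' (fun k => hmap R k c ∘ₗ δ k) := by
  have ef' : ∀ k w, hmap R k f' (hmap R k c w) = hmap R k f w := fun k w => by
    rw [← hmap_comp_apply, ef]
  have eg' : ∀ k w, hmap R k g' (hmap R k c w) = hmap R k b (hmap R k g w) := fun k w => by
    rw [← hmap_comp_apply, eg, hmap_comp_apply]
  have ej' : ∀ k w, hmap R k j' (hmap R k b w) = hmap R k j w := fun k w => by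
    rw [← hmap_comp_apply, ej]
  constructor
  · intro k w
    obtain ⟨w, rfl⟩ := (hc k).2 w
    rw [ef', eg', ej', S.comm]
  · intro k z; simp [ef', S.left_δ]
  · intro k z; simp [eg', S.right_δ]
  · intro k u; simp [S.δ_left]
  · intro k v
    obtain ⟨v, rfl⟩ := (hb _).2 v
    rw [ej']; simp [S.δ_right]
  · intro k z hz
    obtain ⟨u, v, rfl⟩ := S.exact_total k z ((hc k).1 (by rw [map_zero]; exact hz))
    exact ⟨u, hmap R _ b v, by rw [ej']⟩
  · intro z
    obtain ⟨u, v, rfl⟩ := S.exact_zero z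
    exact ⟨u, hmap R _ b v, by rw [ej']⟩
  · intro k w h1 h2
    obtain ⟨w, rfl⟩ := (hc k).2 w
    rw [ef'] at h1
    rw [eg'] at h2
    obtain ⟨z, hz⟩ := S.exact_inter k w h1 ((hb k).1 (by rw [h2, map_zero]))
    exact ⟨z, by simp [hz]⟩
  · intro k u v h
    obtain ⟨v, rfl⟩ := (hb k).2 v
    rw [ej'] at h
    obtain ⟨w, h1, h2⟩ := S.exact_sum k _ _ h
    exact ⟨hmap R k c w, by rw [ef', h1], by rw [eg', h2]⟩

end MVSquare

/-! ### Covering homotopies -/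

section CHP

variable {E X Y A : Type} [TopologicalSpace E] [TopologicalSpace X] [TopologicalSpace Y]
  [TopologicalSpace A]

/-- The covering homotopy property. -/
def CHP (π : C(E, X)) : Prop :=
  ∀ (Z : Type) [TopologicalSpace Z] (f : C(Z, E)) (h : C(Z × I, X)), (∀ z, h (z, 0) = π (f z)) →
    ∃ h' : C(Z × I, E), (∀ z, h' (z, 0) = f z) ∧ ∀ p, π (h' p) = h p

theorem CHP.id : CHP (ContinuousMap.id X) :=
  fun _ _ _ h h0 => ⟨h, h0, fun _ => rfl⟩

theorem CHP.fst : CHP (⟨Prod.fst, continuous_fst⟩ : C(X × Y, X)) := by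
  intro Z _ f h h0
  refine ⟨⟨fun p => (h p, (f p.1).2), by fun_prop⟩, fun z => ?_, fun _ => rfl⟩
  exact Prod.ext (h0 z) rfl

/-- The pullback of a map. -/
abbrev Pull (f : C(A, X)) (π : C(E, X)) : Type := {p : A × E // f p.1 = π p.2}

/-- The projection of a pullback to its base. -/
def Pull.base (f : C(A, X)) (π : C(E, X)) : C(Pull f π, A) :=
  ⟨fun p => p.1.1, continuous_fst.comp continuous_subtype_val⟩

/-- The projection of a pullback to the original total space. -/
def Pull.top (f : C(A, X)) (π : C(E, X)) : C(Pull f π, E) :=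
  ⟨fun p => p.1.2, continuous_snd.comp continuous_subtype_val⟩

theorem CHP.pull {π : C(E, X)} (hπ : CHP π) (f : C(A, X)) : CHP (Pull.base f π) := by
  intro Z _ s h h0
  obtain ⟨h', h1, h2⟩ := hπ Z ((Pull.top f π).comp s) (f.comp h) fun z => by
    change f (h (z, 0)) = _
    rw [h0]
    exact (s z).2
  refine ⟨⟨fun p => ⟨(h p, h' p), (h2 p).symm⟩, by fun_prop⟩, fun z => ?_, fun _ => rfl⟩
  exact Subtype.ext (Prod.ext (h0 z) (h1 z))

/-- A deformation of `U` into `A` that keeps `A` in itself lifts to a map with the covering homotopy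
property. -/
theorem CHP.hIso_incl {R : Type} [CommRing R] {π : C(E, X)} (hπ : CHP π) {A U : Set X} (hAU : A ⊆ U)
    (h : C(U × I, X)) (h0 : ∀ u, h (u, 0) = u) (hU : ∀ p, h p ∈ U) (h1 : ∀ u, h (u, 1) ∈ A)
    (hA : ∀ p : U × I, (p.1 : X) ∈ A → h p ∈ A) :
    HIso R (incl (Set.preimage_mono hAU : π ⁻¹' A ⊆ π ⁻¹' U)) := by
  -- The deformation of the base, composed with π, is lifted starting from the inclusion of `π ⁻¹'
  -- U`; the end of the lift is the homotopy inverse.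
  let g : C((π ⁻¹' U) × I, X) :=
    h.comp ((restr π (Set.mapsTo_preimage π U)).prodMap (ContinuousMap.id I))
  have hg : ∀ p, g p = h (⟨π p.1, p.1.2⟩, p.2) := fun _ => rfl
  obtain ⟨k, k0, k1⟩ := hπ _ (inc (π ⁻¹' U)) g fun z => h0 _
  let r : C(π ⁻¹' U, π ⁻¹' A) := ⟨fun e => ⟨k (e, 1), by
    change π _ ∈ A; rw [k1]; exact h1 _⟩, by fun_prop⟩
  -- The lift starts at the identity, while the homotopies required by `HIso.of_homotopyInverse` end
  -- there; hence the reversal `σ`.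
  have mA : ∀ p : I × (π ⁻¹' A), k (incl (Set.preimage_mono hAU) p.2, σ p.1) ∈ π ⁻¹' A := by
    intro p
    change π _ ∈ A
    rw [k1]
    exact hA _ p.2.2
  have mU : ∀ p : I × (π ⁻¹' U), k (p.2, σ p.1) ∈ π ⁻¹' U := by
    intro p
    change π _ ∈ U
    rw [k1]
    exact hU _
  refine HIso.of_homotopyInverse r ⟨⟨⟨fun p => ⟨_, mA p⟩, ?_⟩, fun e => ?_, fun e => ?_⟩⟩
    ⟨⟨⟨fun p => ⟨_, mU p⟩, ?_⟩, fun e => ?_, fun e => ?_⟩⟩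
  · refine Continuous.subtype_mk (k.continuous.comp (Continuous.prodMk ?_ ?_)) _
    · exact (incl _).continuous.comp continuous_snd
    · exact unitInterval.continuous_symm.comp continuous_fst
  · apply Subtype.ext; simp; rfl
  · apply Subtype.ext; simp [k0]; rfl
  · refine Continuous.subtype_mk (k.continuous.comp (Continuous.prodMk continuous_snd ?_)) _
    exact unitInterval.continuous_symm.comp continuous_fst
  · apply Subtype.ext; simp; rfl
  · apply Subtype.ext; simp [k0]; rfl

end CHP

theorem HIso.of_comp {R : Type} [CommRing R] {X Y Z : Type} [TopologicalSpace X]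
    [TopologicalSpace Y] [TopologicalSpace Z] {f : C(X, Y)} {g : C(Y, Z)} {h : C(X, Z)}
    (hg : HIso R g) (hf : HIso R f) (e : ∀ x, h x = g (f x)) : HIso R h := by
  rw [show h = g.comp f from ContinuousMap.ext e]
  exact hg.comp hf

theorem hmap_comm (R : Type) [CommRing R] (k : ℕ) {X Y Y' Z : Type} [TopologicalSpace X]
    [TopologicalSpace Y] [TopologicalSpace Y'] [TopologicalSpace Z] {f : C(X, Y)} {g : C(Y, Z)}
    {f' : C(X, Y')} {g' : C(Y', Z)} (e : ∀ x, g (f x) = g' (f' x)) (w : Hom R k X) :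
    hmap R k g (hmap R k f w) = hmap R k g' (hmap R k f' w) := by
  rw [← hmap_comp_apply, ← hmap_comp_apply, show g.comp f = g'.comp f' from ContinuousMap.ext e]

/-! ### Attaching a cell -/

/-- The closed unit ball. -/
abbrev Db (V : Type) [NormedAddCommGroup V] : Type := {y : V // ‖y‖ ≤ 1}

/-- The unit sphere. -/
abbrev Sb (V : Type) [NormedAddCommGroup V] : Type := {y : V // ‖y‖ = 1}

section Ball

variable {V : Type} [NormedAddCommGroup V] [NormedSpace ℝ V]

/-- The boundary inclusion. -/
def bdry (V : Type) [NormedAddCommGroup V] : C(Sb V, Db V) :=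
  ⟨fun y => ⟨y.1, y.2.le⟩, by fun_prop⟩

theorem norm_affine_smul {y : V} {t c : ℝ} (ht : t ∈ I) (hc : 0 ≤ c) :
    ‖((1 - t) + t * c) • y‖ = (1 - t) * ‖y‖ + t * (c * ‖y‖) := by
  rw [norm_smul, Real.norm_of_nonneg]
  · ring
  · have := ht.1; have := ht.2; have := mul_nonneg ht.1 hc; linarith

/-- The radial deformation that pushes the points of norm at least `1/3` to the boundary. -/
def radial (V : Type) [NormedAddCommGroup V] [NormedSpace ℝ V] : C(Db V × I, Db V) where
  toFun p := ⟨((1 - (p.2 : ℝ)) + p.2 * (max (1 / 3) ‖p.1.1‖)⁻¹) • p.1.1, by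
    rw [norm_affine_smul p.2.2 (by positivity)]
    have h1 : (max (1 / 3) ‖p.1.1‖)⁻¹ * ‖p.1.1‖ ≤ 1 := by
      rw [inv_mul_le_iff₀ (by positivity), mul_one]; exact le_max_right _ _
    have := p.1.2
    nlinarith [p.2.2.1, p.2.2.2]⟩
  continuous_toFun := by
    refine Continuous.subtype_mk ?_ _
    refine Continuous.smul (Continuous.add (by fun_prop) (Continuous.mul (by fun_prop) ?_))
      (by fun_prop)
    refine Continuous.inv₀ (by fun_prop) fun p => ?_
    positivity

theorem norm_radial {p : Db V × I} (h : 1 / 3 ≤ ‖p.1.1‖) :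
    ‖(radial V p).1‖ = (1 - p.2) * ‖p.1.1‖ + p.2 := by
  change ‖((1 - (p.2 : ℝ)) + p.2 * (max (1 / 3) ‖p.1.1‖)⁻¹) • p.1.1‖ = _
  rw [norm_affine_smul p.2.2 (by positivity), max_eq_right h, inv_mul_cancel₀, mul_one]
  have : (0 : ℝ) < 1 / 3 := by norm_num
  linarith

theorem radial_zero (y : Db V) : radial V (y, 0) = y := by
  apply Subtype.ext
  simp [radial]

theorem radial_of_norm_eq_one {y : Db V} (h : ‖y.1‖ = 1) (t : I) : radial V (y, t) = y := by
  apply Subtype.ext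
  have : max (1 / 3 : ℝ) 1 = 1 := by norm_num
  simp only [radial, ContinuousMap.coe_mk, h, this, inv_one, mul_one, sub_add_cancel, one_smul]

/-- The radial deformation that pushes all points into the ball of radius `1/2`. -/
def shrink (V : Type) [NormedAddCommGroup V] [NormedSpace ℝ V] : C(Db V × I, Db V) where
  toFun p := ⟨((1 - (p.2 : ℝ)) + p.2 * (max 1 (2 * ‖p.1.1‖))⁻¹) • p.1.1, by
    rw [norm_affine_smul p.2.2 (by positivity)]
    have h1 : (max 1 (2 * ‖p.1.1‖))⁻¹ * ‖p.1.1‖ ≤ 1 := by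
      rw [inv_mul_le_iff₀ (by positivity), mul_one]
      exact p.1.2.trans (le_max_left _ _)
    have := p.1.2
    nlinarith [p.2.2.1, p.2.2.2]⟩
  continuous_toFun := by
    refine Continuous.subtype_mk ?_ _
    refine Continuous.smul (Continuous.add (by fun_prop) (Continuous.mul (by fun_prop) ?_))
      (by fun_prop)
    refine Continuous.inv₀ (by fun_prop) fun p => ?_
    positivity

theorem shrink_zero (y : Db V) : shrink V (y, 0) = y := by
  apply Subtype.ext
  simp [shrink]

theorem norm_shrink (p : Db V × I) :
    ‖(shrink V p).1‖ = (1 - p.2) * ‖p.1.1‖ + p.2 * min ‖p.1.1‖ (1 / 2) := by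
  change ‖((1 - (p.2 : ℝ)) + p.2 * (max 1 (2 * ‖p.1.1‖))⁻¹) • p.1.1‖ = _
  rw [norm_affine_smul p.2.2 (by positivity)]
  congr 2
  rcases le_total (2 * ‖p.1.1‖) 1 with h | h
  · rw [max_eq_left h, min_eq_left (by linarith)]; simp
  · rw [max_eq_right h, min_eq_right (by linarith)]
    have : ‖p.1.1‖ ≠ 0 := by intro h0; rw [h0] at h; norm_num at h
    field_simp

end Ball

/-- A space `X` obtained from `B` by attaching the unit ball of `V` along its boundary. -/
structure CellAt (X B V : Type) [TopologicalSpace X] [TopologicalSpace B] [NormedAddCommGroup V]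
    [NormedSpace ℝ V] where
  i : C(B, X)
  χ : C(Db V, X)
  φ : C(Sb V, B)
  comm : ∀ y, i (φ y) = χ (bdry V y)
  inj_i : Function.Injective i
  inj_χ : ∀ y y' : Db V, ‖y.1‖ < 1 → χ y = χ y' → y = y'
  disj : ∀ (y : Db V) b, ‖y.1‖ < 1 → χ y ≠ i b
  surj : ∀ x, (∃ b, i b = x) ∨ ∃ y, χ y = x
  -- Properness is stronger than being a quotient map and is stable under products, so homotopies on
  -- `X × I` can be defined on the pieces although `X` and `B` are arbitrary spaces.
  proper : IsProperMap (Sum.elim i χ)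

namespace CellAt

variable {X B V : Type} [TopologicalSpace X] [TopologicalSpace B] [NormedAddCommGroup V]
    [NormedSpace ℝ V] (K : CellAt X B V)

/-- The quotient map. -/
def q : B ⊕ Db V → X := Sum.elim K.i K.χ

theorem q_surjective : Function.Surjective K.q := by
  intro x
  rcases K.surj x with ⟨b, rfl⟩ | ⟨y, rfl⟩
  · exact ⟨Sum.inl b, rfl⟩
  · exact ⟨Sum.inr y, rfl⟩

theorem isProperMap_q : IsProperMap K.q := K.proper

theorem isQuotientMap_q : IsQuotientMap K.q :=
  K.isProperMap_q.isClosedMap.isQuotientMap K.isProperMap_q.continuous K.q_surjective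

/-- The norm coordinate of the cell, extended by `1` to `B`. -/
def N (x : X) : ℝ :=
  open Classical in
  if h : ∃ y : Db V, ‖y.1‖ < 1 ∧ K.χ y = x then ‖h.choose.1‖ else 1

theorem N_χ (y : Db V) : K.N (K.χ y) = ‖y.1‖ := by
  by_cases hy : ‖y.1‖ < 1
  · have h : ∃ y' : Db V, ‖y'.1‖ < 1 ∧ K.χ y' = K.χ y := ⟨y, hy, rfl⟩
    rw [N, dif_pos h, K.inj_χ _ _ h.choose_spec.1 h.choose_spec.2]
  · rw [N, dif_neg]
    · exact le_antisymm (not_lt.1 hy) y.2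
    · rintro ⟨y', hy', h⟩
      rw [K.inj_χ _ _ hy' h] at hy'
      exact hy hy'

theorem N_i (b : B) : K.N (K.i b) = 1 := by
  rw [N, dif_neg]
  rintro ⟨y', hy', h⟩
  exact K.disj _ _ hy' h

theorem continuous_N : Continuous K.N := by
  rw [K.isQuotientMap_q.continuous_iff]
  have : K.N ∘ K.q = Sum.elim (fun _ => 1) (fun y => ‖y.1‖) := by
    funext s
    cases s with
    | inl b => exact K.N_i b
    | inr y => exact K.N_χ y
  rw [this]
  exact continuous_const.sumElim (by fun_prop)

theorem mem_range_i_iff (x : X) : x ∈ Set.range K.i ↔ K.N x = 1 := by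
  constructor
  · rintro ⟨b, rfl⟩; exact K.N_i b
  · intro h
    rcases K.surj x with ⟨b, rfl⟩ | ⟨y, rfl⟩
    · exact ⟨b, rfl⟩
    · rw [N_χ] at h
      exact ⟨K.φ ⟨y.1, h⟩, K.comm _⟩

/-- The deformation of `X` that pushes the points of norm at least `1/3` into `B`. -/
theorem exists_deformation : ∃ h : C(X × I, X),
    (∀ b t, h (K.i b, t) = K.i b) ∧ ∀ y t, h (K.χ y, t) = K.χ (radial V (y, t)) := by
  let G : (B ⊕ Db V) × I → X := fun p => Sum.elim (fun b => K.i b)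
    (fun y => K.χ (radial V (y, p.2))) p.1
  have hG : Continuous G := by
    have : G = (Sum.elim (fun p : B × I => K.i p.1) (fun p : Db V × I => K.χ (radial V p))) ∘
        Homeomorph.sumProdDistrib := by
      funext ⟨s, t⟩
      cases s <;> rfl
    rw [this]
    exact ((K.i.continuous.comp continuous_fst).sumElim
      (K.χ.continuous.comp (radial V).continuous)).comp (Homeomorph.continuous _)
  have compat : ∀ s s' t, K.q s = K.q s' → G (s, t) = G (s', t) := by
    have key : ∀ (y : Db V) b t, K.χ y = K.i b → K.χ (radial V (y, t)) = K.i b := by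
      intro y b t h
      have : ‖y.1‖ = 1 := by rw [← K.N_χ, h, K.N_i]
      rw [radial_of_norm_eq_one this, h]
    rintro (b | y) (b' | y') t h
    · exact h
    · exact (key y' b t h.symm).symm
    · exact key y b' t h
    · by_cases hy : ‖y.1‖ < 1
      · rw [K.inj_χ _ _ hy h]
      · have h1 : ‖y.1‖ = 1 := le_antisymm y.2 (not_lt.1 hy)
        have h2 : ‖y'.1‖ = 1 := by rw [← K.N_χ, ← show K.χ y = K.χ y' from h, K.N_χ, h1]
        change K.χ (radial V (y, t)) = K.χ (radial V (y', t))
        rw [radial_of_norm_eq_one h1, radial_of_norm_eq_one h2]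
        exact h
  have hp : IsProperMap (Prod.map K.q (id : I → I)) := K.isProperMap_q.prodMap isProperMap_id
  have hq := hp.isClosedMap.isQuotientMap hp.continuous
    (K.q_surjective.prodMap Function.surjective_id)
  let g : X × I → X := fun p => G (Function.surjInv K.q_surjective p.1, p.2)
  have hg : ∀ s t, g (K.q s, t) = G (s, t) := fun s t =>
    compat _ _ t (Function.surjInv_eq K.q_surjective _)
  have gc : Continuous g := by
    rw [hq.continuous_iff]
    have : g ∘ Prod.map K.q id = G := by
      funext ⟨s, t⟩
      exact hg s t
    rw [this]
    exact hG
  exact ⟨⟨g, gc⟩, fun b t => hg (Sum.inl b) t, fun y t => hg (Sum.inr y) t⟩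

theorem isClosedMap_χ : IsClosedMap K.χ :=
  K.isProperMap_q.isClosedMap.comp (f := Sum.inr) (g := K.q) IsClosedEmbedding.inr.isClosedMap

theorem isClosedEmbedding_i : IsClosedEmbedding K.i :=
  .of_continuous_injective_isClosedMap K.i.continuous K.inj_i
    (K.isProperMap_q.isClosedMap.comp (f := Sum.inl) (g := K.q) IsClosedEmbedding.inl.isClosedMap)

/-- The inverse of the characteristic map on the open cell. -/
theorem exists_inverse : ∃ r : C({x | K.N x < 1}, Db V),
    (∀ x, K.χ (r x) = x) ∧ ∀ (y : Db V) (h : K.N (K.χ y) < 1), r ⟨K.χ y, h⟩ = y := by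
  let T : Set X := {x | K.N x < 1}
  have hinj : Function.Injective (T.restrictPreimage K.χ) := by
    rintro ⟨y, hy⟩ ⟨y', hy'⟩ h
    have hy1 : ‖y.1‖ < 1 := by rw [← K.N_χ]; exact hy
    exact Subtype.ext (K.inj_χ _ _ hy1 (congrArg Subtype.val h))
  have hsurj : Function.Surjective (T.restrictPreimage K.χ) := by
    rintro ⟨x, hx⟩
    rcases K.surj x with ⟨b, rfl⟩ | ⟨y, rfl⟩
    · have : K.N (K.i b) < 1 := hx
      rw [N_i] at this
      exact absurd this (lt_irrefl _)
    · exact ⟨⟨y, hx⟩, rfl⟩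
  let e := (Equiv.ofBijective _ ⟨hinj, hsurj⟩).toHomeomorphOfContinuousClosed
    K.χ.continuous.restrictPreimage (K.isClosedMap_χ.restrictPreimage T)
  refine ⟨⟨fun x => (e.symm x).1, by fun_prop⟩, fun x => ?_, fun y h => ?_⟩
  · exact congrArg Subtype.val (e.apply_symm_apply x)
  · exact congrArg Subtype.val (e.symm_apply_apply ⟨y, h⟩)

/-! ### The Mayer-Vietoris square of a fibration over a cell attachment. -/

section MV

variable {R : Type} [CommRing R] {E : Type} [TopologicalSpace E] (π : C(E, X))

/-- The characteristic map restricted to the boundary. -/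
def χb : C(Sb V, X) := K.χ.comp (bdry V)

/-- The pullback over the ball, restricted to the points with norm in `S`. -/
abbrev PN (S : Set ℝ) : Set (Pull K.χ π) := Pull.base K.χ π ⁻¹' {y | ‖y.1‖ ∈ S}

/-- The points of the total space with norm coordinate in `S`. -/
abbrev EN (S : Set ℝ) : Set E := π ⁻¹' {x | K.N x ∈ S}

theorem mapsTo_top (S : Set ℝ) : Set.MapsTo (Pull.top K.χ π) (K.PN π S) (K.EN π S) := by
  rintro ⟨⟨y, e⟩, h⟩ hy
  change K.N (π e) ∈ S
  rw [← show K.χ y = π e from h, N_χ]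
  exact hy

/-- Over the open cell the characteristic map is a homeomorphism, so the pullback to the ball is the
total space itself. -/
theorem hIso_restr_top {S : Set ℝ} (hS : ∀ s ∈ S, s < 1) :
    HIso R (restr (Pull.top K.χ π) (K.mapsTo_top π S)) := by
  obtain ⟨r, hr1, hr2⟩ := K.exists_inverse
  have hs : ∀ e : K.EN π S, K.N (π e) < 1 := fun e => hS _ e.2
  have hm : ∀ e : K.EN π S, ‖(r ⟨π e, hs e⟩).1‖ ∈ S := by
    intro e
    rw [← K.N_χ, hr1]
    exact e.2
  refine HIso.of_inverse ⟨fun e => ⟨⟨(r ⟨π e, hs e⟩, e), hr1 _⟩, hm e⟩, by fun_prop⟩ ?_ ?_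
  · rintro ⟨⟨⟨y, e⟩, h⟩, hy⟩
    apply Subtype.ext
    apply Subtype.ext
    refine Prod.ext ?_ rfl
    change r ⟨π e, _⟩ = y
    have : ∀ (x : X) (hx : K.N x < 1), K.χ y = x → r ⟨x, hx⟩ = y := by
      rintro x hx rfl; exact hr2 _ _
    exact this _ _ h
  · rintro ⟨e, he⟩
    rfl

/-- The cover of the total space that gives the Mayer-Vietoris sequence of a cell attachment. -/
def cover : Cover E where
  U := K.EN π (Set.Ioi (1 / 3))
  V := K.EN π (Set.Iio (2 / 3))
  isOpen_U := (isOpen_Ioi.preimage K.continuous_N).preimage π.continuous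
  isOpen_V := (isOpen_Iio.preimage K.continuous_N).preimage π.continuous
  union_eq := by
    ext e
    simp only [Set.mem_union, Set.mem_univ, iff_true]
    change 1 / 3 < K.N (π e) ∨ K.N (π e) < 2 / 3
    rcases lt_or_ge (1 / 3) (K.N (π e)) with h | h
    · exact Or.inl h
    · right; linarith

/-- The map from the part over the boundary of the ball to the part over `B`. -/
def toB : C(Pull K.χb π, Pull K.i π) :=
  ⟨fun p => ⟨(K.φ p.1.1, p.1.2), (K.comm _).trans p.2⟩, by fun_prop⟩

/-- The map from the part over the boundary of the ball to the part over the ball. -/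
def toD : C(Pull K.χb π, Pull K.χ π) :=
  ⟨fun p => ⟨(bdry V p.1.1, p.1.2), p.2⟩, by fun_prop⟩

/-- The part over the boundary as a subspace of the part over the ball. -/
def toPos : C(Pull K.χb π, K.PN π (Set.Ioi (1 / 3))) :=
  ⟨fun p => ⟨K.toD π p, by
    change (1 / 3 : ℝ) < ‖p.1.1.1‖
    rw [p.1.1.2]; norm_num⟩, by fun_prop⟩

/-- The part over `B` as a subspace of the outer open set. -/
def toOuter : C(Pull K.i π, (K.cover π).U) :=
  ⟨fun p => ⟨p.1.2, by
    change (1 / 3 : ℝ) < K.N (π p.1.2)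
    rw [← p.2, N_i]; norm_num⟩, by fun_prop⟩

variable {π} (hπ : CHP π)

/-- The radial deformation of the collar onto the boundary sphere lifts to the pulled back
fibration. -/
theorem hIso_toPos (hπ : CHP π) : HIso R (K.toPos π) := by
  have hAU : {y : Db V | ‖y.1‖ = 1} ⊆ {y : Db V | ‖y.1‖ ∈ Set.Ioi (1 / 3)} := by
    intro y hy
    have hy' : ‖y.1‖ = 1 := hy
    change (1 / 3 : ℝ) < ‖y.1‖
    rw [hy']; norm_num
  have h1 : HIso R (incl (Set.preimage_mono hAU : Pull.base K.χ π ⁻¹' {y | ‖y.1‖ = 1} ⊆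
      Pull.base K.χ π ⁻¹' {y | ‖y.1‖ ∈ Set.Ioi (1 / 3)})) := by
    refine (hπ.pull K.χ).hIso_incl hAU ((radial V).comp ((inc _).prodMap (ContinuousMap.id I)))
      (fun u => radial_zero _) ?_ ?_ ?_
    · rintro ⟨⟨y, hy⟩, t⟩
      have hy' : (1 / 3 : ℝ) < ‖y.1‖ := hy
      change (1 / 3 : ℝ) < ‖(radial V (y, t)).1‖
      rw [norm_radial hy'.le]
      nlinarith [t.2.1, t.2.2, y.2]
    · rintro ⟨y, hy⟩
      have hy' : (1 / 3 : ℝ) < ‖y.1‖ := hy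
      change ‖(radial V (y, 1)).1‖ = 1
      rw [norm_radial hy'.le]
      simp
    · rintro ⟨⟨y, hy⟩, t⟩ hy1
      have hy' : ‖y.1‖ = 1 := hy1
      change ‖(radial V (y, t)).1‖ = 1
      rw [radial_of_norm_eq_one hy', hy']
  have h2 : HIso R (⟨fun p => ⟨K.toD π p, p.1.1.2⟩, by fun_prop⟩ :
      C(Pull K.χb π, Pull.base K.χ π ⁻¹' {y | ‖y.1‖ = 1})) := by
    refine HIso.of_inverse ⟨fun p => ⟨(⟨p.1.1.1.1, p.2⟩, p.1.1.2), p.1.2⟩, by fun_prop⟩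
      (fun p => rfl) (fun p => rfl)
  exact HIso.of_comp h1 h2 fun _ => rfl

theorem hIso_toOuter (hπ : CHP π) : HIso R (K.toOuter π) := by
  obtain ⟨h, hi, hχ⟩ := K.exists_deformation
  have hN : ∀ x t, 1 / 3 < K.N x → K.N (h (x, t)) = (1 - t) * K.N x + t := by
    intro x t hx
    rcases K.surj x with ⟨b, rfl⟩ | ⟨y, rfl⟩
    · rw [hi, N_i]; ring
    · rw [N_χ] at hx
      rw [hχ, N_χ, N_χ, norm_radial hx.le]
  have hN1 : ∀ x, K.N x ≤ 1 := by
    intro x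
    rcases K.surj x with ⟨b, rfl⟩ | ⟨y, rfl⟩
    · rw [N_i]
    · rw [N_χ]; exact y.2
  have hAU : Set.range K.i ⊆ {x | K.N x ∈ Set.Ioi (1 / 3)} := by
    intro x hx
    change 1 / 3 < K.N x
    rw [(K.mem_range_i_iff x).1 hx]; norm_num
  have h1 : HIso R (incl (Set.preimage_mono hAU : π ⁻¹' Set.range K.i ⊆
      π ⁻¹' {x | K.N x ∈ Set.Ioi (1 / 3)})) := by
    refine hπ.hIso_incl hAU (h.comp ((inc _).prodMap (ContinuousMap.id I))) ?_ ?_ ?_ ?_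
    · rintro ⟨x, hx⟩
      change h (x, 0) = x
      rcases K.surj x with ⟨b, rfl⟩ | ⟨y, rfl⟩
      · rw [hi]
      · rw [hχ, radial_zero]
    · rintro ⟨⟨x, hx⟩, t⟩
      have hx' : 1 / 3 < K.N x := hx
      change 1 / 3 < K.N (h (x, t))
      rw [hN x t hx']
      nlinarith [t.2.1, t.2.2, hN1 x]
    · rintro ⟨x, hx⟩
      change h (x, 1) ∈ _
      rw [mem_range_i_iff, hN x 1 hx]
      simp
    · rintro ⟨⟨x, hx⟩, t⟩ ⟨b, hb⟩
      exact ⟨b, by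
        change K.i b = h (x, t)
        rw [← show K.i b = x from hb, hi]⟩
  let e := K.isClosedEmbedding_i.isEmbedding.toHomeomorph
  have h2 : HIso R (⟨fun p => ⟨p.1.2, ⟨p.1.1, p.2⟩⟩, by fun_prop⟩ :
      C(Pull K.i π, π ⁻¹' Set.range K.i)) := by
    refine HIso.of_inverse ⟨fun p => ⟨(e.symm ⟨π p, p.2⟩, p),
      congrArg Subtype.val (e.apply_symm_apply ⟨π p, p.2⟩)⟩, by fun_prop⟩ ?_ (fun p => rfl)
    rintro ⟨⟨b, p⟩, h⟩
    apply Subtype.ext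
    refine Prod.ext (K.inj_i ?_) rfl
    exact (congrArg Subtype.val (e.apply_symm_apply ⟨π p, ⟨b, h⟩⟩)).trans h.symm
  exact HIso.of_comp h1 h2 fun _ => rfl

theorem norm_shrink_one (y : Db V) : ‖(shrink V (y, 1)).1‖ < 2 / 3 := by
  have h : ‖(shrink V (y, 1)).1‖ = min ‖y.1‖ (1 / 2) := by rw [norm_shrink]; simp
  rw [h]
  exact (min_le_right _ _).trans_lt (by norm_num)

theorem norm_shrink_lt {y : Db V} (t : I) (h : ‖y.1‖ < 2 / 3) : ‖(shrink V (y, t)).1‖ < 2 / 3 := by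
  rw [norm_shrink]
  have := min_le_left ‖y.1‖ (1 / 2)
  nlinarith [t.2.1, t.2.2]

theorem lt_norm_shrink {y : Db V} (t : I) (h : 1 / 3 < ‖y.1‖) : 1 / 3 < ‖(shrink V (y, t)).1‖ := by
  rw [norm_shrink]
  have : 1 / 3 < min ‖y.1‖ (1 / 2) := lt_min h (by norm_num)
  dsimp only
  rcases eq_or_lt_of_le t.2.1 with h0 | h0
  · rw [← h0]; simpa using h
  · nlinarith [t.2.2]

theorem annulus_subset : K.PN π (Set.Ioi (1 / 3) ∩ Set.Iio (2 / 3)) ⊆ K.PN π (Set.Ioi (1 / 3)) :=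
  fun _ h => h.1

theorem annulus_subset' : K.PN π (Set.Ioi (1 / 3) ∩ Set.Iio (2 / 3)) ⊆ K.PN π (Set.Iio (2 / 3)) :=
  fun _ h => h.2

/-- `shrink` moves the collar {norm > 1/3} into the annulus and preserves both sets, since its
radius 1/2 lies strictly between the bounds 1/3 and 2/3. -/
theorem hIso_annulus (hπ : CHP π) : HIso R (incl (K.annulus_subset (π := π))) := by
  have hAU : {y : Db V | ‖y.1‖ ∈ Set.Ioi (1 / 3) ∩ Set.Iio (2 / 3)} ⊆
    {y : Db V | ‖y.1‖ ∈ Set.Ioi (1 / 3)} := fun _ h => h.1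
  refine (hπ.pull K.χ).hIso_incl hAU ((shrink V).comp ((inc _).prodMap (ContinuousMap.id I)))
      (fun u => shrink_zero _) ?_ ?_ ?_
  · rintro ⟨⟨y, hy⟩, t⟩
    exact lt_norm_shrink t hy
  · rintro ⟨y, hy⟩
    exact ⟨lt_norm_shrink 1 hy, norm_shrink_one y⟩
  · rintro ⟨⟨y, hy⟩, t⟩ hy1
    exact ⟨lt_norm_shrink t hy, norm_shrink_lt t hy1.2⟩

theorem hIso_inner (hπ : CHP π) : HIso R (inc (K.PN π (Set.Iio (2 / 3)))) := by
  have hAU : {y : Db V | ‖y.1‖ ∈ Set.Iio (2 / 3)} ⊆ Set.univ := Set.subset_univ _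
  have h1 : HIso R (incl (Set.preimage_mono hAU :
      K.PN π (Set.Iio (2 / 3)) ⊆ Pull.base K.χ π ⁻¹' Set.univ)) := by
    refine (hπ.pull K.χ).hIso_incl hAU ((shrink V).comp ((inc _).prodMap (ContinuousMap.id I)))
      (fun u => shrink_zero _) (fun _ => trivial) ?_ ?_
    · rintro ⟨y, hy⟩
      exact norm_shrink_one y
    · rintro ⟨⟨y, hy⟩, t⟩ hy1
      exact norm_shrink_lt t hy1
  have h2 : HIso R (inc (Pull.base K.χ π ⁻¹' Set.univ)) :=
    HIso.of_inverse ⟨fun p => ⟨p, trivial⟩, by fun_prop⟩ (fun _ => rfl) (fun _ => rfl)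
  exact HIso.of_comp h2 h1 fun _ => rfl

theorem hIso_cell_inter : HIso R (restr (Pull.top K.χ π)
    (K.mapsTo_top π (Set.Ioi (1 / 3) ∩ Set.Iio (2 / 3)))) :=
  K.hIso_restr_top π fun s hs => hs.2.trans (by norm_num)

theorem hIso_cell_inner : HIso R (restr (Pull.top K.χ π) (K.mapsTo_top π (Set.Iio (2 / 3)))) :=
  K.hIso_restr_top π fun s hs => (show s < 2 / 3 from hs).trans (by norm_num)

variable (R) in
/-- The connecting homomorphism of a cell attachment. -/
def cδ (hπ : CHP π) (k : ℕ) : Hom R (k + 1) E →ₗ[R] Hom R k (Pull K.χb π) :=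
  (K.hIso_toPos hπ).inv k ∘ₗ hmap R k (incl (K.annulus_subset (π := π))) ∘ₗ
    (K.hIso_cell_inter (π := π)).inv k ∘ₗ mvδ R (K.cover π) k

/-- The Mayer-Vietoris square of a cell attachment. -/
theorem mvSquare : MVSquare R (K.toB π) (K.toD π) (Pull.top K.i π) (Pull.top K.χ π)
    (K.cδ R hπ) := by
  -- The corners are replaced in three stages: the intersection and the inner set are identified
  -- with parts over the ball; then the annulus is enlarged to the collar and the inner ball to the
  -- whole ball; finally the collar and the outer set are replaced by the parts over the boundary
  -- sphere and over `B`.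
  have S0 := (K.cover π).mvSquare (R := R)
  have S1 := S0.pull
    (c := restr (Pull.top K.χ π) (K.mapsTo_top π (Set.Ioi (1 / 3) ∩ Set.Iio (2 / 3))))
    (a := ContinuousMap.id _) (b := restr (Pull.top K.χ π) (K.mapsTo_top π (Set.Iio (2 / 3))))
    K.hIso_cell_inter (HIso.of_inverse (ContinuousMap.id _) (fun _ => rfl) (fun _ => rfl))
    K.hIso_cell_inner
    (f' := (restr (Pull.top K.χ π) (K.mapsTo_top π (Set.Ioi (1 / 3)))).comp
      (incl (K.annulus_subset (π := π))))
    (g' := incl (K.annulus_subset' (π := π)))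
    (i' := inc _) (j' := (Pull.top K.χ π).comp (inc _)) rfl rfl rfl rfl
  have S2 := S1.push (c := incl (K.annulus_subset (π := π)))
    (b := inc (K.PN π (Set.Iio (2 / 3)))) (K.hIso_annulus hπ) (K.hIso_inner hπ)
    (f' := restr (Pull.top K.χ π) (K.mapsTo_top π (Set.Ioi (1 / 3)))) (g' := inc _)
    (j' := Pull.top K.χ π) rfl rfl rfl
  exact S2.pull (c := K.toPos π) (a := K.toOuter π) (b := ContinuousMap.id _) (K.hIso_toPos hπ)
    (K.hIso_toOuter hπ) (HIso.of_inverse (ContinuousMap.id _) (fun _ => rfl) (fun _ => rfl))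
    (f' := K.toB π) (g' := K.toD π) rfl rfl rfl rfl

end MV

section Natural

variable {R : Type} [CommRing R] {X' B' E E' : Type} [TopologicalSpace X'] [TopologicalSpace B']
  [TopologicalSpace E] [TopologicalSpace E'] (K' : CellAt X' B' V) {π' : C(E', X')} {π : C(E, X)}

/-- The map of boundary parts induced by a map of cell attachments. -/
def mapBdry (F : C(E, E')) (f : C(X, X')) (hF : ∀ e, π' (F e) = f (π e))
    (hχ : ∀ y, f (K.χ y) = K'.χ y) : C(Pull K.χb π, Pull K'.χb π') :=
  ⟨fun p => ⟨(p.1.1, F p.1.2), by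
    change K'.χ _ = _
    rw [hF, ← p.2, ← hχ]; rfl⟩, by fun_prop⟩

/-- A map that carries one characteristic map to the other and `B` into `B'` preserves the norm
coordinate, hence the covers; each identification used to define `cδ` then commutes with it. -/
theorem cδ_natural (hπ : CHP π) (hπ' : CHP π') (F : C(E, E')) (f : C(X, X'))
    (hF : ∀ e, π' (F e) = f (π e)) (hχ : ∀ y, f (K.χ y) = K'.χ y)
    (hB : ∀ b, f (K.i b) ∈ Set.range K'.i) (k : ℕ) (z : Hom R (k + 1) E) :
    K'.cδ R hπ' k (hmap R (k + 1) F z) = hmap R k (K.mapBdry K' F f hF hχ) (K.cδ R hπ k z) := by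
  have hN : ∀ x, K'.N (f x) = K.N x := by
    intro x
    rcases K.surj x with ⟨b, rfl⟩ | ⟨y, rfl⟩
    · rw [N_i, (K'.mem_range_i_iff _).1 (hB b)]
    · rw [hχ, N_χ, N_χ]
  have hE : ∀ S, Set.MapsTo F (K.EN π S) (K'.EN π' S) := by
    intro S e he
    change K'.N (π' (F e)) ∈ S
    rw [hF, hN]
    exact he
  let FD : C(Pull K.χ π, Pull K'.χ π') := ⟨fun p => ⟨(p.1.1, F p.1.2), by
    rw [hF, ← p.2, ← hχ]⟩, by fun_prop⟩
  have hFD : ∀ S, Set.MapsTo FD (K.PN π S) (K'.PN π' S) := fun S p hp => hp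
  -- Stated for arbitrary spaces so that the same unfolding applies to both sides.
  have hc : ∀ {B X E : Type} [TopologicalSpace B] [TopologicalSpace X] [TopologicalSpace E]
      (K : CellAt X B V) {π : C(E, X)} (hπ : CHP π) (z : Hom R (k + 1) E), K.cδ R hπ k z =
      (K.hIso_toPos hπ).inv k (hmap R k (incl (K.annulus_subset (π := π)))
        ((K.hIso_cell_inter (π := π)).inv k (mvδ R (K.cover π) k z))) := fun _ _ _ _ => rfl
  rw [hc, hc, HIso.inv_eq_iff, mvδ_natural (K.cover π) (K'.cover π') F (hE _) (hE _)]
  generalize mvδ R (K.cover π) k z = w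
  obtain ⟨w, rfl⟩ := ((K.hIso_cell_inter (R := R) (π := π)) k).2 w
  rw [HIso.inv_hmap]
  have e1 : hmap R k (restr F (hE (Set.Ioi (1 / 3) ∩ Set.Iio (2 / 3))))
      (hmap R k (restr (Pull.top K.χ π) (K.mapsTo_top π (Set.Ioi (1 / 3) ∩ Set.Iio (2 / 3)))) w) =
      hmap R k (restr (Pull.top K'.χ π') (K'.mapsTo_top π' (Set.Ioi (1 / 3) ∩ Set.Iio (2 / 3))))
        (hmap R k (restr FD (hFD _)) w) :=
    hmap_comm R k (by intro _; rfl) w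
  have e2 : (K'.hIso_cell_inter (R := R) (π := π')).inv k
      (hmap R k (restr F (hE (Set.Ioi (1 / 3) ∩ Set.Iio (2 / 3))))
      (hmap R k (restr (Pull.top K.χ π) (K.mapsTo_top π (Set.Ioi (1 / 3) ∩ Set.Iio (2 / 3)))) w)) =
        (hmap R k (restr FD (hFD _)) w) := by
    rw [HIso.inv_eq_iff]; exact e1
  refine (congrArg (hmap R k _) e2).trans ?_
  generalize hu : hmap R k (incl _) w = u
  obtain ⟨v, rfl⟩ := (K.hIso_toPos (R := R) hπ k).2 u
  rw [HIso.inv_hmap]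
  have e3 : hmap R k (K'.toPos π') (hmap R k (K.mapBdry K' F f hF hχ) v) =
    hmap R k (restr FD (hFD (Set.Ioi (1 / 3)))) (hmap R k (K.toPos π) v) :=
    hmap_comm R k (by intro _; rfl) v
  rw [e3, ← hu]
  exact hmap_comm R k (by intro _; rfl) w

end Natural

end CellAt

/-! ### The cone on a sphere as a ball -/

/-- The Euclidean space of dimension `m + 1`. -/
abbrev Eu (m : ℕ) : Type := EuclideanSpace ℝ (Fin (m + 1))

/-- The point of `Eu m` with given first coordinate and remaining coordinates. -/
def euCons {m : ℕ} (a : ℝ) (v : Fin m → ℝ) : Eu m := WithLp.toLp 2 (Fin.cons a v)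

@[simp] theorem euCons_zero {m : ℕ} (a : ℝ) (v : Fin m → ℝ) : euCons a v 0 = a := rfl

@[simp] theorem euCons_succ {m : ℕ} (a : ℝ) (v : Fin m → ℝ) (i : Fin m) :
    euCons a v i.succ = v i := rfl

theorem eu_norm_sq {m : ℕ} (y : Eu m) : ‖y‖ ^ 2 = y 0 ^ 2 + ∑ i : Fin m, y i.succ ^ 2 := by
  rw [EuclideanSpace.real_norm_sq_eq, Fin.sum_univ_succ]

/-- The denominator in the formula for the stereographic parametrization. -/
def coneDen {m : ℕ} (t : ℝ) (v : Fin m → ℝ) : ℝ := 1 + 4 * t ^ 2 * ∑ i, v i ^ 2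

theorem coneDen_pos {m : ℕ} (t : ℝ) (v : Fin m → ℝ) : 0 < coneDen t v := by
  have : 0 ≤ ∑ i, v i ^ 2 := Finset.sum_nonneg fun i _ => sq_nonneg _
  unfold coneDen; positivity

/-- The base point of the unit ball. -/
def pole (m : ℕ) : Eu m := euCons 1 0

/-- The inversion that takes the half space `(0,1] × ℝᵐ` to the unit ball without a boundary point;
`1 / (2 t)` is the distance to the hyperplane of infinite points. -/
def coneVec {m : ℕ} (t : ℝ) (v : Fin m → ℝ) : Eu m :=
  euCons (1 - 2 * t / coneDen t v) (fun i => 4 * t ^ 2 * v i / coneDen t v)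

theorem norm_coneVec_sq {m : ℕ} (t : ℝ) (v : Fin m → ℝ) :
    ‖coneVec t v‖ ^ 2 = 1 - 4 * t * (1 - t) / coneDen t v := by
  have hq := (coneDen_pos t v).ne'
  rw [eu_norm_sq]
  simp only [coneVec, euCons_zero, euCons_succ, div_pow, mul_pow, ← Finset.sum_div,
    ← Finset.mul_sum]
  have hs : 4 * t ^ 2 * ∑ i, v i ^ 2 = coneDen t v - 1 := by unfold coneDen; ring
  generalize hD : coneDen t v = q at *
  field_simp
  linear_combination (4 * t ^ 2) * hs

/-- For t ≠ 0, `coneVec t v - pole` is the inversion at the origin of the vector (-1/(2t), v), so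
its squared length is the reciprocal of 1/(4t²) + |v|². The slices of constant t are spheres of
radius t, all tangent at the pole. -/
theorem norm_coneVec_sub_sq {m : ℕ} (t : ℝ) (v : Fin m → ℝ) :
    ‖coneVec t v - pole m‖ ^ 2 = 4 * t ^ 2 / coneDen t v := by
  have hq := (coneDen_pos t v).ne'
  rw [eu_norm_sq]
  simp only [coneVec, pole, PiLp.sub_apply, euCons_zero, euCons_succ, Pi.zero_apply, sub_zero,
    div_pow, mul_pow, ← Finset.sum_div, ← Finset.mul_sum]
  have hs : 4 * t ^ 2 * ∑ i, v i ^ 2 = coneDen t v - 1 := by unfold coneDen; ring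
  generalize hD : coneDen t v = q at *
  field_simp
  linear_combination (4 * t ^ 2) * hs

theorem norm_coneVec_le {m : ℕ} (t : I) (v : Fin m → ℝ) : ‖coneVec (t : ℝ) v‖ ≤ 1 := by
  have h : ‖coneVec (t : ℝ) v‖ ^ 2 ≤ 1 := by
    rw [norm_coneVec_sq]
    have h1 : 0 ≤ 4 * (t : ℝ) * (1 - t) :=
      mul_nonneg (mul_nonneg (by norm_num) t.2.1) (sub_nonneg.2 t.2.2)
    have := div_nonneg h1 (coneDen_pos (t : ℝ) v).le
    linarith
  exact (sq_le_one_iff₀ (norm_nonneg _)).1 h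

theorem norm_coneVec_eq_one_iff {m : ℕ} (t : I) (v : Fin m → ℝ) :
    ‖coneVec (t : ℝ) v‖ = 1 ↔ t = 0 ∨ t = 1 := by
  rw [← pow_eq_one_iff_of_nonneg (norm_nonneg _) two_ne_zero, norm_coneVec_sq, sub_eq_self,
    div_eq_zero_iff, mul_eq_zero, mul_eq_zero]
  have := (coneDen_pos (t : ℝ) v).ne'
  constructor
  · rintro ((h | h) | h)
    · rcases h with h | h
      · norm_num at h
      · exact Or.inl (Subtype.ext h)
    · exact Or.inr (Subtype.ext (sub_eq_zero.1 h).symm)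
    · exact absurd h this
  · rintro (rfl | rfl) <;> simp

/-- The squared distance to the pole divided by one minus the first coordinate is 2t; once t is
known, so is the denominator, and the other coordinates give v. -/
theorem coneVec_inj {m : ℕ} {t t' : ℝ} {v v' : Fin m → ℝ} (ht : t ≠ 0) (ht' : t' ≠ 0)
    (h : coneVec t v = coneVec t' v') : t = t' ∧ v = v' := by
  have h1 := congrArg (fun y : Eu m => ‖y - pole m‖ ^ 2) h
  simp only [norm_coneVec_sub_sq] at h1
  have h0 := congrArg (fun y : Eu m => y 0) h
  simp only [coneVec, euCons_zero] at h0
  have hq := (coneDen_pos t v).ne'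
  have hq' := (coneDen_pos t' v').ne'
  have h0' : 2 * t / coneDen t v = 2 * t' / coneDen t' v' := by linarith
  have htt : t = t' := by
    have e1 : 4 * t ^ 2 / coneDen t v = (2 * t) * (2 * t / coneDen t v) := by ring
    have e2 : 4 * t' ^ 2 / coneDen t' v' = (2 * t') * (2 * t' / coneDen t' v') := by ring
    rw [e1, e2, h0'] at h1
    have := mul_right_cancel₀ (div_ne_zero (mul_ne_zero two_ne_zero ht') hq') h1
    linarith
  subst htt
  refine ⟨rfl, funext fun i => ?_⟩
  have hqq : coneDen t v = coneDen t v' := by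
    have h2 : 2 * t ≠ 0 := mul_ne_zero two_ne_zero ht
    field_simp at h0'
    linarith
  have hi := congrArg (fun y : Eu m => y i.succ) h
  simp only [coneVec, euCons_succ, hqq] at hi
  field_simp at hi
  linarith

theorem continuous_euCons {m : ℕ} {Z : Type*} [TopologicalSpace Z] {a : Z → ℝ} {v : Z → Fin m → ℝ}
    (ha : Continuous a) (hv : Continuous v) : Continuous fun z => euCons (a z) (v z) := by
  refine (PiLp.continuous_toLp 2 _).comp (continuous_pi fun i => ?_)
  refine Fin.cases ?_ (fun j => ?_) i
  · simpa using ha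
  · exact (continuous_apply j).comp hv

/-- The stereographic parametrization of the unit ball by the reduced cone on a sphere, as a
function. -/
def ballFun {m : ℕ} (p : I × Sph m) : Eu m := p.2.elim (pole m) fun v => coneVec (p.1 : ℝ) v

@[simp] theorem ballFun_infty {m : ℕ} (t : I) : ballFun (t, (∞ : Sph m)) = pole m := rfl

@[simp] theorem ballFun_coe {m : ℕ} (t : I) (v : Fin m → ℝ) :
    ballFun (t, (v : Sph m)) = coneVec (t : ℝ) v := rfl

theorem continuous_ballFun (m : ℕ) : Continuous (ballFun : I × Sph m → Eu m) := by
  rw [continuous_iff_continuousAt]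
  rintro ⟨t, x⟩
  induction x using OnePoint.rec with
  | coe v =>
    have ho : IsOpenEmbedding (Prod.map id (↑) : I × (Fin m → ℝ) → I × Sph m) :=
      IsOpenEmbedding.id.prodMap OnePoint.isOpenEmbedding_coe
    rw [show ((t, (v : Sph m)) : I × Sph m) = Prod.map id (↑) (t, v) from rfl,
      ← ho.continuousAt_iff]
    refine Continuous.continuousAt ?_
    have hd : Continuous fun p : I × (Fin m → ℝ) => coneDen (p.1 : ℝ) p.2 := by
      unfold coneDen; fun_prop
    have hne : ∀ p : I × (Fin m → ℝ), coneDen (p.1 : ℝ) p.2 ≠ 0 := fun p => (coneDen_pos _ _).ne'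
    refine continuous_euCons (a := fun p : I × (Fin m → ℝ) => 1 - 2 * (p.1 : ℝ) / coneDen p.1 p.2)
      (v := fun p i => 4 * (p.1 : ℝ) ^ 2 * p.2 i / coneDen p.1 p.2)
      (continuous_const.sub (Continuous.div (by fun_prop) hd hne))
      (continuous_pi fun i => Continuous.div (by fun_prop) hd hne)
  | infty =>
    rw [Metric.continuousAt_iff']
    intro ε hε
    have hK : IsCompact (Metric.closedBall (0 : Fin m → ℝ) (1 / ε)) := isCompact_closedBall _ _
    have ho := (OnePoint.isOpen_compl_image_coe (X := Fin m → ℝ)).2 ⟨hK.isClosed, hK⟩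
    filter_upwards [(ho.preimage continuous_snd).mem_nhds (x := (t, (∞ : Sph m))) (by simp)]
      with p hp
    obtain ⟨u, x⟩ := p
    induction x using OnePoint.rec with
    | infty => simpa using hε
    | coe v =>
      rw [ballFun_infty, ballFun_coe, dist_eq_norm]
      have hv : 1 / ε < ‖v‖ := by
        by_contra hle
        exact hp ⟨v, by simpa using hle, rfl⟩
      have hs : (1 / ε) ^ 2 < ∑ i, v i ^ 2 := by
        by_contra hle
        refine absurd ((pi_norm_le_iff_of_nonneg (by positivity)).2 fun i => ?_) (not_le.2 hv)
        rw [Real.norm_eq_abs]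
        refine abs_le_of_sq_le_sq ?_ (by positivity)
        exact (Finset.single_le_sum (f := fun i => v i ^ 2) (fun i _ => sq_nonneg _)
          (Finset.mem_univ i)).trans (not_lt.1 hle)
      refine lt_of_pow_lt_pow_left₀ 2 hε.le ?_
      -- The squared distance to the pole is 4t² / (1 + 4t²|v|²), which is less than ε² as soon as
      -- |v|² > 1/ε², uniformly in t.
      rw [norm_coneVec_sub_sq, div_lt_iff₀ (coneDen_pos _ _), coneDen]
      have h1 : 1 < ε ^ 2 * ∑ i, v i ^ 2 := by
        rw [one_div, inv_pow, inv_lt_iff_one_lt_mul₀ (by positivity)] at hs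
        linarith
      nlinarith [sq_nonneg (u : ℝ), pow_pos hε 2]

theorem norm_pole (m : ℕ) : ‖pole m‖ = 1 := by
  have : ‖pole m‖ ^ 2 = 1 := by rw [eu_norm_sq]; simp [pole]
  nlinarith [norm_nonneg (pole m)]

theorem norm_ballFun_le {m : ℕ} (p : I × Sph m) : ‖ballFun p‖ ≤ 1 := by
  obtain ⟨t, x⟩ := p
  induction x using OnePoint.rec with
  | infty => exact (norm_pole m).le
  | coe v => exact norm_coneVec_le t v

/-- The stereographic parametrization of the unit ball by the reduced cone on a sphere. -/
def ballMap (m : ℕ) : C(I × Sph m, Db (Eu m)) :=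
  ⟨fun p => ⟨ballFun p, norm_ballFun_le p⟩, (continuous_ballFun m).subtype_mk _⟩

theorem norm_ballMap_eq_one_iff {m : ℕ} (t : I) (x : Sph m) :
    ‖(ballMap m (t, x)).1‖ = 1 ↔ t = 0 ∨ t = 1 ∨ x = ∞ := by
  induction x using OnePoint.rec with
  | infty => exact iff_of_true (norm_pole m) (Or.inr (Or.inr rfl))
  | coe v => exact (norm_coneVec_eq_one_iff t v).trans (by simp)

theorem norm_ballMap_lt_one_iff {m : ℕ} (t : I) (x : Sph m) :
    ‖(ballMap m (t, x)).1‖ < 1 ↔ t ≠ 0 ∧ t ≠ 1 ∧ x ≠ ∞ := by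
  rw [lt_iff_le_and_ne, and_iff_right (ballMap m (t, x)).2, Ne, norm_ballMap_eq_one_iff]
  tauto

theorem ballMap_eq_pole_iff {m : ℕ} (t : I) (x : Sph m) :
    (ballMap m (t, x)).1 = pole m ↔ t = 0 ∨ x = ∞ := by
  change ballFun (t, x) = pole m ↔ _
  induction x using OnePoint.rec with
  | infty => simp
  | coe v =>
    have h := norm_coneVec_sub_sq (t : ℝ) v
    have hd := (coneDen_pos (t : ℝ) v).ne'
    rw [ballFun_coe, ← sub_eq_zero, ← norm_eq_zero, ← sq_eq_zero_iff, h]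
    simp [hd]

/-- The ball is the quotient of the cylinder by the base lines. -/
theorem ballMap_eq_iff {m : ℕ} (p p' : I × Sph m) :
    ballMap m p = ballMap m p' ↔ p = p' ∨ ((p.1 = 0 ∨ p.2 = ∞) ∧ (p'.1 = 0 ∨ p'.2 = ∞)) := by
  obtain ⟨t, x⟩ := p
  obtain ⟨t', x'⟩ := p'
  constructor
  · intro h
    by_cases h1 : t = 0 ∨ x = ∞
    · have := (ballMap_eq_pole_iff t x).2 h1
      rw [h, ballMap_eq_pole_iff] at this
      exact Or.inr ⟨h1, this⟩
    · have h2 : ¬ (t' = 0 ∨ x' = ∞) := by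
        rw [← ballMap_eq_pole_iff, ← h, ballMap_eq_pole_iff]; exact h1
      push Not at h1 h2
      obtain ⟨v, rfl⟩ := OnePoint.ne_infty_iff_exists.1 h1.2
      obtain ⟨v', rfl⟩ := OnePoint.ne_infty_iff_exists.1 h2.2
      have := coneVec_inj (fun h0 => h1.1 (Subtype.ext h0)) (fun h0 => h2.1 (Subtype.ext h0))
        (congrArg Subtype.val h : coneVec (t : ℝ) v = coneVec (t' : ℝ) v')
      exact Or.inl (Prod.ext (Subtype.ext this.1) (congrArg OnePoint.some this.2))
  · rintro (h | ⟨h1, h2⟩)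
    · rw [h]
    · exact Subtype.ext (((ballMap_eq_pole_iff t x).2 h1).trans
        ((ballMap_eq_pole_iff t' x').2 h2).symm)

theorem ballMap_surjective (m : ℕ) : Function.Surjective (ballMap m) := by
  rintro ⟨y, hy⟩
  by_cases hp : y = pole m
  · exact ⟨(0, ∞), Subtype.ext hp.symm⟩
  have hn := eu_norm_sq y
  have hs : 0 ≤ ∑ i : Fin m, y i.succ ^ 2 := Finset.sum_nonneg fun i _ => sq_nonneg _
  set S := ∑ i : Fin m, y i.succ ^ 2 with hS
  have hy2 : ‖y‖ ^ 2 ≤ 1 := (sq_le_one_iff₀ (norm_nonneg _)).2 hy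
  have h0 : 0 < 1 - y 0 := by
    by_contra hle
    have h1 : y 0 = 1 := by nlinarith
    have h2 : S = 0 := by nlinarith
    apply hp
    ext i
    refine Fin.cases h1 (fun j => ?_) i
    have := (Finset.sum_eq_zero_iff_of_nonneg fun i _ => sq_nonneg _).1 h2 j (Finset.mem_univ j)
    exact (sq_eq_zero_iff).1 this
  -- `D` is the squared distance of y to the pole; the choices t = D / (2(1 - y₀)) and v =
  -- (remaining coordinates) / D solve the equations of the inversion, and D ≤ 2(1 - y₀) says that y
  -- is in the unit ball.
  set D := (1 - y 0) ^ 2 + S with hD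
  have hDpos : 0 < D := by positivity
  have hD2 : D ≤ 2 * (1 - y 0) := by rw [hD]; nlinarith
  let t : I := ⟨D / (2 * (1 - y 0)), by positivity, (div_le_one (by positivity)).2 hD2⟩
  let v : Fin m → ℝ := fun i => y i.succ / D
  have hv : ∑ i, v i ^ 2 = S / D ^ 2 := by simp only [v, div_pow, ← Finset.sum_div, hS]
  have hq : coneDen (t : ℝ) v = D / (1 - y 0) ^ 2 := by
    have hSD : S = D - (1 - y 0) ^ 2 := by rw [hD]; ring
    rw [coneDen, hv, hSD]
    change 1 + 4 * (D / (2 * (1 - y 0))) ^ 2 * _ = _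
    field_simp
    ring
  refine ⟨(t, (v : Sph m)), Subtype.ext ?_⟩
  change coneVec (t : ℝ) v = y
  ext i
  refine Fin.cases ?_ (fun j => ?_) i
  · simp only [coneVec, euCons_zero, hq]
    change 1 - 2 * (D / (2 * (1 - y 0))) / _ = _
    field_simp
    ring
  · simp only [coneVec, euCons_succ, hq]
    change 4 * (D / (2 * (1 - y 0))) ^ 2 * (y j.succ / D) / _ = _
    field_simp
    ring

instance (m : ℕ) : CompactSpace (Db (Eu m)) :=
  isCompact_iff_compactSpace.1 (by
    have := isCompact_closedBall (0 : Eu m) 1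
    rwa [show Metric.closedBall (0 : Eu m) 1 = {y | ‖y‖ ≤ 1} by ext; simp] at this)

theorem isQuotientMap_ballMap (m : ℕ) : IsQuotientMap (ballMap m) :=
  (ballMap m).continuous.isClosedMap.isQuotientMap (ballMap m).continuous (ballMap_surjective m)

/-- The boundary of the ball is the sphere. -/
def sphHomeo (m : ℕ) : Sph m ≃ₜ Sb (Eu m) :=
  Continuous.homeoOfEquivCompactToT2
    (f := Equiv.ofBijective (fun x : Sph m => (⟨(ballMap m (1, x)).1,
      (norm_ballMap_eq_one_iff 1 x).2 (Or.inr (Or.inl rfl))⟩ : Sb (Eu m))) (by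
    constructor
    · intro x x' h
      have h' : ballMap m (1, x) = ballMap m (1, x') := Subtype.ext (Subtype.mk.inj h)
      rw [ballMap_eq_iff] at h'
      rcases h' with h' | ⟨h1, h2⟩
      · exact congrArg Prod.snd h'
      · simp at h1 h2
        rw [h1, h2]
    · rintro ⟨y, hy⟩
      obtain ⟨⟨t, x⟩, h⟩ := ballMap_surjective m ⟨y, hy.le⟩
      have hy' : ‖(ballMap m (t, x)).1‖ = 1 := by rw [h]; exact hy
      rw [norm_ballMap_eq_one_iff] at hy'
      have key : ∃ x', ballMap m (1, x') = ballMap m (t, x) := by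
        rcases hy' with h | h | h
        · exact ⟨∞, (ballMap_eq_iff _ _).2 (Or.inr ⟨Or.inr rfl, Or.inl h⟩)⟩
        · exact ⟨x, by rw [h]⟩
        · exact ⟨∞, (ballMap_eq_iff _ _).2 (Or.inr ⟨Or.inr rfl, Or.inr h⟩)⟩
      obtain ⟨x', hx'⟩ := key
      exact ⟨x', Subtype.ext (by
        change (ballMap m (1, x')).1 = y
        rw [hx', h])⟩))
    (((continuous_subtype_val.comp ((ballMap m).continuous.comp
      (by fun_prop : Continuous fun x : Sph m => ((1 : I), x))))).subtype_mk _)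

theorem bdry_sphHomeo {m : ℕ} (x : Sph m) : bdry (Eu m) (sphHomeo m x) = ballMap m (1, x) := rfl

/-! ### Reduced mapping cones -/

/-- A space `X` that is the reduced mapping cone of a map `f : S^m ⟶ B`. -/
structure ConeAt (X B : Type) [TopologicalSpace X] [TopologicalSpace B] (m : ℕ) where
  i : C(B, X)
  κ : C(I × Sph m, X)
  f : C(Sph m, B)
  b0 : B
  glue : ∀ x, κ (1, x) = i (f x)
  apex : ∀ x, κ (0, x) = i b0
  base : ∀ t, κ (t, ∞) = i b0
  inj_i : Function.Injective i
  inj_κ : ∀ t x t' x', t ≠ 0 → t ≠ 1 → x ≠ ∞ → κ (t, x) = κ (t', x') → t = t' ∧ x = x'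
  disj : ∀ t x b, t ≠ 0 → t ≠ 1 → x ≠ ∞ → κ (t, x) ≠ i b
  surj : ∀ z, (∃ b, i b = z) ∨ ∃ p, κ p = z
  proper : IsProperMap (Sum.elim i κ)

namespace ConeAt

variable {X B : Type} [TopologicalSpace X] [TopologicalSpace B] {m : ℕ} (K : ConeAt X B m)

theorem κ_eq_b0 {p : I × Sph m} (h : p.1 = 0 ∨ p.2 = ∞) : K.κ p = K.i K.b0 := by
  obtain ⟨t, x⟩ := p
  rcases h with rfl | rfl
  · exact K.apex x
  · exact K.base t

theorem κ_eq_of_ballMap_eq {p p' : I × Sph m} (h : ballMap m p = ballMap m p') :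
    K.κ p = K.κ p' := by
  rcases (ballMap_eq_iff p p').1 h with h | ⟨h1, h2⟩
  · rw [h]
  · rw [K.κ_eq_b0 h1, K.κ_eq_b0 h2]

/-- The characteristic map of the cell. -/
def χ : C(Db (Eu m), X) where
  toFun y := K.κ (Function.surjInv (ballMap_surjective m) y)
  continuous_toFun := by
    rw [(isQuotientMap_ballMap m).continuous_iff]
    convert K.κ.continuous using 1
    funext p
    exact K.κ_eq_of_ballMap_eq (Function.surjInv_eq (ballMap_surjective m) _)

@[simp] theorem χ_ballMap (p : I × Sph m) : K.χ (ballMap m p) = K.κ p :=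
  K.κ_eq_of_ballMap_eq (Function.surjInv_eq (ballMap_surjective m) _)

/-- The cell structure of a reduced mapping cone. -/
def cell : CellAt X B (Eu m) where
  i := K.i
  χ := K.χ
  φ := K.f.comp ⟨(sphHomeo m).symm, (sphHomeo m).symm.continuous⟩
  comm y := by
    obtain ⟨x, rfl⟩ := (sphHomeo m).surjective y
    rw [bdry_sphHomeo, χ_ballMap, K.glue]
    simp
  inj_i := K.inj_i
  inj_χ y y' hy h := by
    obtain ⟨⟨t, x⟩, rfl⟩ := ballMap_surjective m y
    obtain ⟨⟨t', x'⟩, rfl⟩ := ballMap_surjective m y'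
    rw [norm_ballMap_lt_one_iff] at hy
    rw [χ_ballMap, χ_ballMap] at h
    obtain ⟨rfl, rfl⟩ := K.inj_κ _ _ _ _ hy.1 hy.2.1 hy.2.2 h
    rfl
  disj y b hy := by
    obtain ⟨⟨t, x⟩, rfl⟩ := ballMap_surjective m y
    rw [norm_ballMap_lt_one_iff] at hy
    rw [χ_ballMap]
    exact K.disj _ _ _ hy.1 hy.2.1 hy.2.2
  surj x := by
    rcases K.surj x with h | ⟨p, hp⟩
    · exact Or.inl h
    · exact Or.inr ⟨ballMap m p, by rw [χ_ballMap, hp]⟩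
  proper := by
    have hc : Continuous (Sum.map id (ballMap m) : B ⊕ (I × Sph m) → B ⊕ Db (Eu m)) :=
      continuous_id.sumMap (ballMap m).continuous
    have hs : Function.Surjective (Sum.map id (ballMap m) : B ⊕ (I × Sph m) → B ⊕ Db (Eu m)) :=
      Sum.map_surjective.2 ⟨Function.surjective_id, ballMap_surjective m⟩
    refine isProperMap_of_comp_of_surj (f := Sum.map id (ballMap m)) hc
      (K.i.continuous.sumElim K.χ.continuous) ?_ hs
    convert K.proper using 1
    funext s
    cases s with
    | inl b => rfl
    | inr p => exact K.χ_ballMap p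

end ConeAt

/-! ### The sphere as the reduced mapping cone of the map to a point. -/

theorem wind_eq_infty_iff (t : I) : wind t = ∞ ↔ t = 0 ∨ t = 1 := by
  constructor
  · intro h
    by_contra hne
    push Not at hne
    have t0 : 0 < (t : ℝ) := lt_of_le_of_ne t.2.1 fun h0 => hne.1 (Subtype.ext h0.symm)
    have t1 : (t : ℝ) < 1 := lt_of_le_of_ne t.2.2 fun h0 => hne.2 (Subtype.ext h0)
    have : 0 < Real.sin (Real.pi * t) :=
      Real.sin_pos_of_pos_of_lt_pi (by have := Real.pi_pos; positivity)
        (by have := Real.pi_pos; nlinarith)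
    rw [wind, if_neg this.ne'] at h
    exact OnePoint.coe_ne_infty _ h
  · rintro (rfl | rfl) <;> simp

theorem susp_eq_infty_iff {m : ℕ} (t : I) (x : Sph m) :
    susp m (t, x) = ∞ ↔ t = 0 ∨ t = 1 ∨ x = ∞ := by
  change smash (Nat.add_comm 1 m) (wind t, x) = ∞ ↔ _
  induction x using OnePoint.rec with
  | infty => simp
  | coe v =>
    by_cases h : wind t = ∞
    · rw [h]
      have := (wind_eq_infty_iff t).1 h
      simp only [smash_infty_left, true_iff]
      tauto
    · obtain ⟨s, hs⟩ := OnePoint.ne_infty_iff_exists.1 h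
      rw [← hs, smash_cons]
      rw [wind_eq_infty_iff] at h
      have h2 : (v : Sph m) ≠ ∞ := OnePoint.coe_ne_infty v
      simp only [OnePoint.coe_ne_infty, false_iff]
      tauto

theorem susp_inj {m : ℕ} {t t' : I} {x x' : Sph m} (h0 : susp m (t, x) ≠ ∞)
    (h : susp m (t, x) = susp m (t', x')) : t = t' ∧ x = x' := by
  have h0' : susp m (t', x') ≠ ∞ := h ▸ h0
  rw [Ne, susp_eq_infty_iff] at h0 h0'
  push Not at h0 h0'
  have key : ∀ (t : I) (x : Sph m), t ≠ 0 → t ≠ 1 → x ≠ ∞ → ∃ (s : Fin 1 → ℝ) (v : Fin m → ℝ),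
      wind t = s ∧ x = v := by
    intro t x h1 h2 h3
    have hw : wind t ≠ ∞ := by rw [Ne, wind_eq_infty_iff]; tauto
    obtain ⟨s, hs⟩ := OnePoint.ne_infty_iff_exists.1 hw
    obtain ⟨v, hv⟩ := OnePoint.ne_infty_iff_exists.1 h3
    exact ⟨s, v, hs.symm, hv.symm⟩
  obtain ⟨s, v, hs, rfl⟩ := key t x h0.1 h0.2.1 h0.2.2
  obtain ⟨s', v', hs', rfl⟩ := key t' x' h0'.1 h0'.2.1 h0'.2.2
  change smash (Nat.add_comm 1 m) (wind t, (v : Sph m)) =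
    smash (Nat.add_comm 1 m) (wind t', (v' : Sph m)) at h
  rw [hs, hs', smash_cons, smash_cons] at h
  have h' := OnePoint.coe_injective h
  have e0 : s 0 = s' 0 := by simpa using congrFun h' 0
  have e1 : v = v' := funext fun i => by simpa using congrFun h' i.succ
  exact ⟨by rw [← unwind_of_wind_eq hs, ← unwind_of_wind_eq hs', e0], by rw [e1]⟩

/-- The sphere as the reduced mapping cone of the map to a point. -/
def coneSph (m : ℕ) : ConeAt (Sph (m + 1)) PUnit m where
  i := ContinuousMap.const _ ∞
  κ := susp m
  f := ContinuousMap.const _ PUnit.unit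
  b0 := PUnit.unit
  glue x := (susp_eq_infty_iff 1 x).2 (Or.inr (Or.inl rfl))
  apex x := (susp_eq_infty_iff 0 x).2 (Or.inl rfl)
  base t := (susp_eq_infty_iff t ∞).2 (Or.inr (Or.inr rfl))
  inj_i _ _ _ := rfl
  inj_κ t x t' x' h0 h1 hx h := susp_inj (by rw [Ne, susp_eq_infty_iff]; tauto) h
  disj t x b h0 h1 hx h := by
    have : susp m (t, x) = ∞ := h
    rw [susp_eq_infty_iff] at this
    tauto
  surj z := Or.inr (susp_surjective m z)
  proper := (continuous_const.sumElim (susp m).continuous).isProperMap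

/-! ### The Moore space as a mapping cone -/

section Moore

variable {d m : ℕ}

/-- The quotient map onto the Moore space. -/
def Moore.mk (d m : ℕ) : C(Sph m ⊕ (I × Sph m), Moore d m) := ⟨Quot.mk _, continuous_quot_mk⟩

@[simp] theorem degMap_infty : degMap d m ∞ = ∞ := by cases m <;> rfl

open Classical in
/-- Representatives of the points of the Moore space. -/
def Moore.normal (d m : ℕ) : Sph m ⊕ (I × Sph m) → Sph m ⊕ (I × Sph m) :=
  Sum.elim Sum.inl fun p => if p.1 = 1 then Sum.inl (degMap d m p.2) else
    if p.1 = 0 ∨ p.2 = ∞ then Sum.inl ∞ else Sum.inr p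

/-- At (1, ∞) the clause for t = 1 takes precedence; it gives the same answer because the degree map
fixes the base point. -/
theorem Moore.normal_base {t : I} {x : Sph m} (h : t = 0 ∨ x = ∞) :
    Moore.normal d m (Sum.inr (t, x)) = Sum.inl ∞ := by
  simp only [Moore.normal, Sum.elim_inr]
  by_cases h1 : t = 1
  · subst h1
    simp at h
    subst h
    simp
  · rw [if_neg h1, if_pos h]

theorem Moore.normal_one (x : Sph m) :
    Moore.normal d m (Sum.inr (1, x)) = Sum.inl (degMap d m x) := by
  simp [Moore.normal]

theorem Moore.normal_inr {t : I} {x : Sph m} (h0 : t ≠ 0) (h1 : t ≠ 1) (hx : x ≠ ∞) :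
    Moore.normal d m (Sum.inr (t, x)) = Sum.inr (t, x) := by
  simp [Moore.normal, h0, h1, hx]

theorem Moore.normal_rel {z z' : Sph m ⊕ (I × Sph m)} (h : MooreRel d m z z') :
    Moore.normal d m z = Moore.normal d m z' := by
  cases h with
  | glue x => rw [Moore.normal_one]; rfl
  | apex x => rw [Moore.normal_base (Or.inl rfl)]; rfl
  | base t => rw [Moore.normal_base (Or.inr rfl)]; rfl

theorem Moore.mk_normal (z : Sph m ⊕ (I × Sph m)) :
    Moore.mk d m (Moore.normal d m z) = Moore.mk d m z := by
  rcases z with x | ⟨t, x⟩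
  · rfl
  · by_cases h1 : t = 1
    · subst h1
      rw [Moore.normal_one]
      exact (Quot.sound (MooreRel.glue x)).symm
    · by_cases h0 : t = 0
      · subst h0
        rw [Moore.normal_base (Or.inl rfl)]
        exact (Quot.sound (MooreRel.apex x)).symm
      · by_cases hx : x = ∞
        · subst hx
          rw [Moore.normal_base (Or.inr rfl)]
          exact (Quot.sound (MooreRel.base t)).symm
        · rw [Moore.normal_inr h0 h1 hx]

/-- `normal` is constant on the generating relations and selects a representative of each class, so
the generated equivalence relation becomes an equality. -/
theorem Moore.mk_eq_iff {z z' : Sph m ⊕ (I × Sph m)} :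
    Moore.mk d m z = Moore.mk d m z' ↔ Moore.normal d m z = Moore.normal d m z' := by
  constructor
  · intro h
    exact congrArg (Quot.lift (Moore.normal d m) fun _ _ => Moore.normal_rel) h
  · intro h
    rw [← Moore.mk_normal z, h, Moore.mk_normal]

/-- The saturation of a closed set C is explicit. Its trace A on the sphere is closed by
compactness; on the cylinder it consists of C, the points at t = 1 that the degree map sends into A,
and all base lines in case ∞ is in A. -/
theorem Moore.isClosedMap_mk (d m : ℕ) : IsClosedMap (Moore.mk d m) := by
  intro C hC
  have hq : IsQuotientMap (Moore.mk d m) := isQuotientMap_quot_mk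
  rw [← hq.isClosed_preimage]
  have hS : IsClosed (({0} ×ˢ Set.univ ∪ Set.univ ×ˢ {∞}) : Set (I × Sph m)) :=
    (isClosed_singleton.prod isClosed_univ).union (isClosed_univ.prod isClosed_singleton)
  let A : Set (Sph m) := {b | ∃ c ∈ C, Moore.normal d m c = Sum.inl b}
  have hA : IsClosed A := by
    have e : A = (Sum.inl ⁻¹' C ∪ degMap d m '' {x | Sum.inr (1, x) ∈ C}) ∪
        {b | b = ∞ ∧ (Sum.inr ⁻¹' C ∩ ({0} ×ˢ Set.univ ∪ Set.univ ×ˢ {∞})).Nonempty} := by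
      ext b
      constructor
      · rintro ⟨c | ⟨t, x⟩, hc, h⟩
        · exact Or.inl (Or.inl (by
            have : c = b := Sum.inl.inj h
            subst this; exact hc))
        · by_cases hb : t = 0 ∨ x = ∞
          · rw [Moore.normal_base hb] at h
            refine Or.inr ⟨(Sum.inl.inj h).symm, (t, x), hc, ?_⟩
            rcases hb with hb | hb
            · exact Or.inl ⟨hb, trivial⟩
            · exact Or.inr ⟨trivial, hb⟩
          · push Not at hb
            by_cases h1 : t = 1
            · subst h1
              rw [Moore.normal_one] at h
              exact Or.inl (Or.inr ⟨x, hc, Sum.inl.inj h⟩)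
            · rw [Moore.normal_inr hb.1 h1 hb.2] at h
              exact absurd h Sum.inr_ne_inl
      · rintro ((h | ⟨x, hx, rfl⟩) | ⟨rfl, ⟨t, x⟩, hc, h⟩)
        · exact ⟨Sum.inl b, h, rfl⟩
        · exact ⟨_, hx, Moore.normal_one x⟩
        · refine ⟨_, hc, Moore.normal_base ?_⟩
          rcases h with h | h
          · exact Or.inl h.1
          · exact Or.inr h.2
    rw [e]
    refine ((hC.preimage continuous_inl).union ?_).union ?_
    · refine (IsClosed.isCompact ?_).image (degMap d m).continuous |>.isClosed
      exact hC.preimage (continuous_inr.comp (by fun_prop))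
    · by_cases hne :
        (Sum.inr ⁻¹' C ∩ ({0} ×ˢ Set.univ ∪ Set.univ ×ˢ {∞} : Set (I × Sph m))).Nonempty
      · simp [hne]
      · simp [hne]
  have e : Moore.mk d m ⁻¹' (Moore.mk d m '' C) = {z | Sum.elim (fun b => b ∈ A)
      (fun p => Sum.inr p ∈ C ∨ (p.1 = 1 ∧ degMap d m p.2 ∈ A) ∨
        (∞ ∈ A ∧ p ∈ ({0} ×ˢ Set.univ ∪ Set.univ ×ˢ {∞} : Set (I × Sph m)))) z} := by
    ext z
    simp only [Set.mem_preimage, Set.mem_image, Moore.mk_eq_iff]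
    rcases z with b | ⟨t, x⟩
    · rfl
    · change _ ↔ Sum.inr (t, x) ∈ C ∨ (t = 1 ∧ degMap d m x ∈ A) ∨
        (∞ ∈ A ∧ (t, x) ∈ ({0} ×ˢ Set.univ ∪ Set.univ ×ˢ {∞} : Set (I × Sph m)))
      constructor
      · rintro ⟨c, hc, h⟩
        by_cases hb : t = 0 ∨ x = ∞
        · rw [Moore.normal_base hb] at h
          refine Or.inr (Or.inr ⟨⟨c, hc, h⟩, ?_⟩)
          rcases hb with hb | hb
          · exact Or.inl ⟨hb, trivial⟩
          · exact Or.inr ⟨trivial, hb⟩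
        · push Not at hb
          by_cases h1 : t = 1
          · subst h1
            rw [Moore.normal_one] at h
            exact Or.inr (Or.inl ⟨rfl, c, hc, h⟩)
          · rw [Moore.normal_inr hb.1 h1 hb.2] at h
            left
            rcases c with c | ⟨t', x'⟩
            · exact absurd h Sum.inl_ne_inr
            · have h' := h
              by_cases hb' : t' = 0 ∨ x' = ∞
              · rw [Moore.normal_base hb'] at h'
                exact absurd h' Sum.inl_ne_inr
              · push Not at hb'
                by_cases h1' : t' = 1
                · subst h1'
                  rw [Moore.normal_one] at h'
                  exact absurd h' Sum.inl_ne_inr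
                · rw [Moore.normal_inr hb'.1 h1' hb'.2] at h'
                  rw [← h']; exact hc
      · rintro (h | ⟨rfl, c, hc, h⟩ | ⟨⟨c, hc, h⟩, hp⟩)
        · exact ⟨_, h, rfl⟩
        · exact ⟨c, hc, by rw [h, Moore.normal_one]⟩
        · refine ⟨c, hc, ?_⟩
          rw [h, Moore.normal_base]
          rcases hp with hp | hp
          · exact Or.inl hp.1
          · exact Or.inr hp.2
  rw [e, isClosed_sum_iff]
  refine ⟨hA, ?_⟩
  refine IsClosed.union (hC.preimage continuous_inr) (IsClosed.union
    (isClosed_singleton.prod (hA.preimage (degMap d m).continuous)) ?_)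
  change IsClosed {p | ∞ ∈ A ∧ p ∈ ({0} ×ˢ Set.univ ∪ Set.univ ×ˢ {∞} : Set (I × Sph m))}
  by_cases h : ∞ ∈ A
  · simp only [h, true_and]
    exact hS
  · simp [h]

theorem Moore.isProperMap_mk (d m : ℕ) : IsProperMap (Moore.mk d m) := by
  refine isProperMap_iff_isClosedMap_and_compact_fibers.2
    ⟨(Moore.mk d m).continuous, Moore.isClosedMap_mk d m, fun y => ?_⟩
  obtain ⟨z, rfl⟩ := Quot.exists_rep y
  refine IsClosed.isCompact (IsClosed.preimage (Moore.mk d m).continuous ?_)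
  have := Moore.isClosedMap_mk d m {z} isClosed_singleton
  rwa [Set.image_singleton] at this

/-- The Moore space as a reduced mapping cone. -/
def coneMoore (d m : ℕ) : ConeAt (Moore d m) (Sph m) m where
  i := Moore.incl d m
  κ := (Moore.mk d m).comp ⟨Sum.inr, continuous_inr⟩
  f := degMap d m
  b0 := ∞
  glue x := Quot.sound (MooreRel.glue x)
  apex x := Quot.sound (MooreRel.apex x)
  base t := Quot.sound (MooreRel.base t)
  inj_i x x' h := Sum.inl.inj (Moore.mk_eq_iff.1 h)
  inj_κ t x t' x' h0 h1 hx h := by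
    have h2 : Moore.normal d m (Sum.inr (t, x)) = Moore.normal d m (Sum.inr (t', x')) :=
      Moore.mk_eq_iff.1 h
    rw [Moore.normal_inr h0 h1 hx] at h2
    by_cases hb' : t' = 0 ∨ x' = ∞
    · rw [Moore.normal_base hb'] at h2
      exact absurd h2 Sum.inr_ne_inl
    · push Not at hb'
      by_cases h1' : t' = 1
      · subst h1'
        rw [Moore.normal_one] at h2
        exact absurd h2 Sum.inr_ne_inl
      · rw [Moore.normal_inr hb'.1 h1' hb'.2] at h2
        exact Prod.ext_iff.1 (Sum.inr.inj h2)
  disj t x b h0 h1 hx h := by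
    have h2 : Moore.normal d m (Sum.inr (t, x)) = Moore.normal d m (Sum.inl b) :=
      Moore.mk_eq_iff.1 h
    rw [Moore.normal_inr h0 h1 hx] at h2
    exact absurd h2 Sum.inr_ne_inl
  surj z := by
    obtain ⟨w, rfl⟩ := Quot.exists_rep z
    rcases w with x | p
    · exact Or.inl ⟨x, rfl⟩
    · exact Or.inr ⟨p, rfl⟩
  proper := by
    convert Moore.isProperMap_mk d m using 1
    funext s
    cases s <;> rfl

end Moore

/-! ### The homology of a product with a sphere -/

section Basic

variable {R : Type} [CommRing R] {X Y Z : Type} [TopologicalSpace X] [TopologicalSpace Y]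
  [TopologicalSpace Z]

/-- The second projection. -/
def sndMap (X Y : Type) [TopologicalSpace X] [TopologicalSpace Y] : C(X × Y, Y) :=
  ⟨Prod.snd, continuous_snd⟩

/-- The first projection. -/
def fstMap (X Y : Type) [TopologicalSpace X] [TopologicalSpace Y] : C(X × Y, X) :=
  ⟨Prod.fst, continuous_fst⟩

/-- The inclusion of the slice over a point. -/
def sliceMap (x : X) (Y : Type) [TopologicalSpace Y] : C(Y, X × Y) :=
  ⟨fun y => (x, y), by fun_prop⟩

/-- The product of a map with an identity map. -/
def idProd (X : Type) [TopologicalSpace X] (f : C(Y, Z)) : C(X × Y, X × Z) :=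
  (ContinuousMap.id X).prodMap f

theorem chp_fstMap : CHP (fstMap X Y) := CHP.fst

theorem hmap_hmap_eq {f : C(X, Y)} {g : C(Y, Z)} {h : C(X, Z)} (e : ∀ x, g (f x) = h x) (k : ℕ)
    (z : Hom R k X) : hmap R k g (hmap R k f z) = hmap R k h z := by
  rw [← hmap_comp_apply, show g.comp f = h from ContinuousMap.ext e]

theorem hmap_hmap_eq_self {f : C(X, Y)} {g : C(Y, X)} (e : ∀ x, g (f x) = x) (k : ℕ)
    (z : Hom R k X) : hmap R k g (hmap R k f z) = z := by
  rw [hmap_hmap_eq (h := ContinuousMap.id X) e, hmap_id_apply]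

theorem hmap_congr_homotopic {f g : C(X, Y)} (h : f.Homotopic g) (k : ℕ) (z : Hom R k X) :
    hmap R k f z = hmap R k g z := by rw [hmap_homotopic R k h]

theorem hmap_eq_zero_of_const {f : C(X, Y)} {y : Y} (h : ∀ x, f x = y) {k : ℕ} (hk : k ≠ 0)
    (z : Hom R k X) : hmap R k f z = 0 := by
  rw [← hmap_hmap_eq (f := toPt X) (g := ContinuousMap.const _ y) fun x => (h x).symm,
    hom_point_eq_zero k hk (hmap R k (toPt X) z), map_zero]

theorem hmap_eq_zero_of_acyclic {f : C(X, Y)} {g : C(Y, Z)} (hY : HIso R (toPt Y)) {k : ℕ}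
    (hk : k ≠ 0) (z : Hom R k X) : hmap R k g (hmap R k f z) = 0 := by
  rw [hom_eq_zero_of_hIso_toPt hY hk (hmap R k f z), map_zero]

theorem hIso_sndMap {x : X} (h : (ContinuousMap.const X x).Homotopic (ContinuousMap.id X)) :
    HIso R (sndMap X Y) := by
  refine HIso.of_homotopyInverse (sliceMap x Y) ?_ ?_
  · obtain ⟨H⟩ := h
    refine ⟨⟨⟨fun p => (H (p.1, p.2.1), p.2.2), by fun_prop⟩, fun p => ?_, fun p => ?_⟩⟩
    · exact Prod.ext (H.apply_zero p.1) rfl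
    · exact Prod.ext (H.apply_one p.1) rfl
  · exact ContinuousMap.Homotopic.refl _

end Basic

/-- The base point of the ball. -/
def ballBase (m : ℕ) : Db (Eu m) := ⟨pole m, (norm_pole m).le⟩

/-- The linear contraction of the ball to its base point. -/
def ballContract (m : ℕ) : C(Db (Eu m) × I, Db (Eu m)) where
  toFun p := ⟨(1 - (p.2 : ℝ)) • p.1.1 + (p.2 : ℝ) • pole m, by
    refine (norm_add_le _ _).trans ?_
    rw [norm_smul, norm_smul, norm_pole, Real.norm_of_nonneg (sub_nonneg.2 p.2.2.2),
      Real.norm_of_nonneg p.2.2.1]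
    have := p.1.2
    nlinarith [p.2.2.1, p.2.2.2]⟩
  continuous_toFun := by
    refine Continuous.subtype_mk ?_ _
    fun_prop

theorem ballContract_zero {m : ℕ} (y : Db (Eu m)) : ballContract m (y, 0) = y :=
  Subtype.ext (by simp [ballContract])

theorem ballContract_one {m : ℕ} (y : Db (Eu m)) : ballContract m (y, 1) = ballBase m :=
  Subtype.ext (by simp [ballContract, ballBase])

theorem ballContract_base {m : ℕ} (t : I) : ballContract m (ballBase m, t) = ballBase m :=
  Subtype.ext (by simp [ballContract, ballBase, ← add_smul])

theorem ball_contractible (m : ℕ) : (ContinuousMap.const (Db (Eu m)) (ballBase m)).Homotopic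
    (ContinuousMap.id _) := by
  refine ContinuousMap.Homotopic.symm ⟨⟨⟨fun p => ballContract m (p.2, p.1), by fun_prop⟩,
    fun y => ?_, fun y => ?_⟩⟩
  · exact ballContract_zero y
  · exact ballContract_one y

theorem ballMap_base {m : ℕ} (t : I) : ballMap m (t, ∞) = ballBase m := rfl

theorem ConeAt.χ_base {X B : Type} [TopologicalSpace X] [TopologicalSpace B] {m : ℕ}
    (K : ConeAt X B m) : K.χ (ballBase m) = K.i K.b0 := by
  rw [← ballMap_base 1, K.χ_ballMap, K.base]

section Cross

variable (R : Type) [CommRing R] (a : ℕ) (Y : Type) [TopologicalSpace Y]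

/-- The boundary part of the product of a sphere and a space. -/
def sphBdry : C(Sph a × Y, Pull (coneSph a).cell.χb (fstMap (Sph (a + 1)) Y)) :=
  ⟨fun p => ⟨(sphHomeo a p.1, (∞, p.2)), by
    change (coneSph a).χ (bdry _ (sphHomeo a p.1)) = ∞
    rw [bdry_sphHomeo, ConeAt.χ_ballMap, ConeAt.glue]
    rfl⟩, by fun_prop⟩

theorem hIso_sphBdry : HIso R (sphBdry a Y) := by
  refine HIso.of_inverse ⟨fun p => ((sphHomeo a).symm p.1.1, p.1.2.2), by fun_prop⟩ ?_ ?_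
  · rintro ⟨x, y⟩
    exact Prod.ext ((sphHomeo a).symm_apply_apply x) rfl
  · rintro ⟨⟨z, x, y⟩, h⟩
    apply Subtype.ext
    refine Prod.ext ((sphHomeo a).apply_symm_apply z) (Prod.ext ?_ rfl)
    obtain ⟨w, rfl⟩ := (sphHomeo a).surjective z
    refine Eq.trans ?_ h
    symm
    change (coneSph a).χ (bdry _ (sphHomeo a w)) = ∞
    rw [bdry_sphHomeo, ConeAt.χ_ballMap, ConeAt.glue]
    rfl

/-- The connecting homomorphism of the decomposition of a sphere into a point and a cell. -/
def sphδ (k : ℕ) : Hom R (k + 1) (Sph (a + 1) × Y) →ₗ[R] Hom R k (Sph a × Y) :=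
  (hIso_sphBdry R a Y).inv k ∘ₗ (coneSph a).cell.cδ R chp_fstMap k

/-- The part of the product over the base point. -/
def sphBase : C(Y, Pull (coneSph a).cell.i (fstMap (Sph (a + 1)) Y)) :=
  ⟨fun y => ⟨(PUnit.unit, (∞, y)), rfl⟩, by fun_prop⟩

/-- The part of the product over the cell. -/
def sphBall : C(Db (Eu a) × Y, Pull (coneSph a).cell.χ (fstMap (Sph (a + 1)) Y)) :=
  ⟨fun p => ⟨(p.1, ((coneSph a).cell.χ p.1, p.2)), rfl⟩, by fun_prop⟩

/-- The inclusion of the boundary part in the ball part. -/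
def sphToBall : C(Sph a × Y, Db (Eu a) × Y) := ⟨fun p => (ballMap a (1, p.1), p.2), by fun_prop⟩

theorem hIso_sphBase : HIso R (sphBase a Y) := by
  refine HIso.of_inverse ⟨fun p => p.1.2.2, by fun_prop⟩ (fun _ => rfl) ?_
  rintro ⟨⟨u, x, y⟩, h⟩
  exact Subtype.ext (Prod.ext rfl (Prod.ext h rfl))

theorem hIso_sphBall : HIso R (sphBall a Y) := by
  refine HIso.of_inverse ⟨fun p => (p.1.1, p.1.2.2), by fun_prop⟩ (fun _ => rfl) ?_
  rintro ⟨⟨u, x, y⟩, h⟩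
  exact Subtype.ext (Prod.ext rfl (Prod.ext h rfl))

/-- The projection S^(a+1) × Y → S^(a+1) is treated as a fibration over a point with a cell
attached; the parts over point, ball and boundary are products with Y. -/
theorem sph_mvSquare : MVSquare R (sndMap (Sph a) Y) (sphToBall a Y)
    (sliceMap ∞ Y) (((coneSph a).χ).prodMap (ContinuousMap.id Y)) (sphδ R a Y) := by
  have S := (coneSph a).cell.mvSquare (R := R) (π := fstMap (Sph (a + 1)) Y) chp_fstMap
  have e1 : (sphBase a Y).comp (sndMap (Sph a) Y) = ((coneSph a).cell.toB _).comp (sphBdry a Y) :=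
    ContinuousMap.ext fun _ => rfl
  have e2 : (sphBall a Y).comp (sphToBall a Y) =
      ((coneSph a).cell.toD _).comp (sphBdry a Y) := by
    ext p : 1
    apply Subtype.ext
    refine Prod.ext rfl (Prod.ext ?_ rfl)
    change (coneSph a).χ (ballMap a (1, p.1)) = ∞
    rw [ConeAt.χ_ballMap, ConeAt.glue]
    rfl
  exact S.pull (hIso_sphBdry R a Y) (hIso_sphBase R a Y) (hIso_sphBall R a Y) e1 e2
    (ContinuousMap.ext fun _ => rfl) (ContinuousMap.ext fun _ => rfl)

variable {R a Y}

theorem sphδ_natural {Y' : Type} [TopologicalSpace Y'] (f : C(Y, Y')) (k : ℕ)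
    (z : Hom R (k + 1) (Sph (a + 1) × Y)) :
    sphδ R a Y' k (hmap R (k + 1) (idProd _ f) z) = hmap R k (idProd _ f) (sphδ R a Y k z) := by
  have h := (coneSph a).cell.cδ_natural (R := R) (coneSph a).cell (π := fstMap (Sph (a + 1)) Y)
    (π' := fstMap (Sph (a + 1)) Y') chp_fstMap chp_fstMap (idProd _ f) (ContinuousMap.id _)
    (fun _ => rfl) (fun _ => rfl) (fun b => ⟨b, rfl⟩) k z
  change (hIso_sphBdry R a Y').inv k _ = hmap R k (idProd _ f) ((hIso_sphBdry R a Y).inv k _)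
  rw [h, HIso.inv_eq_iff]
  generalize (coneSph a).cell.cδ R chp_fstMap k z = w
  obtain ⟨w, rfl⟩ := (hIso_sphBdry R a Y k).2 w
  rw [HIso.inv_hmap]
  exact hmap_comm R k (by intro _; rfl) w

/-- The ball contracts to its base point, so both summands come from the slice at ∞, where the
projection to Y is injective in homology. -/
theorem eq_zero_of_sum {k : ℕ} {z : Hom R k (Sph (a + 1) × Y)} (hz : hmap R k (sndMap _ Y) z = 0)
    (u : Hom R k Y) (v : Hom R k (Db (Eu a) × Y)) (h : z = hmap R k (sliceMap ∞ Y) u +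
      hmap R k (((coneSph a).χ).prodMap (ContinuousMap.id Y)) v) : z = 0 := by
  have hj : hmap R k (((coneSph a).χ).prodMap (ContinuousMap.id Y)) v =
      hmap R k (sliceMap ∞ Y) (hmap R k (sndMap _ Y) v) := by
    have hh : (((coneSph a).χ).prodMap (ContinuousMap.id Y)).Homotopic
        ((sliceMap (∞ : Sph (a + 1)) Y).comp (sndMap (Db (Eu a)) Y)) := by
      refine ⟨⟨⟨fun p => ((coneSph a).χ (ballContract a (p.2.1, p.1)), p.2.2), by fun_prop⟩,
        fun p => ?_, fun p => ?_⟩⟩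
      · exact Prod.ext (congrArg (coneSph a).χ (ballContract_zero p.1)) rfl
      · refine Prod.ext ?_ rfl
        change (coneSph a).χ (ballContract a (p.1, 1)) = ∞
        rw [ballContract_one, ConeAt.χ_base]
        rfl
    rw [hmap_congr_homotopic hh, hmap_comp_apply]
  rw [hj, ← map_add] at h
  rw [h, hmap_hmap_eq_self (by intro _; rfl)] at hz
  rw [h, hz, map_zero]

theorem sphδ_inj {k : ℕ} {z : Hom R (k + 1) (Sph (a + 1) × Y)}
    (hz : hmap R (k + 1) (sndMap _ Y) z = 0) (h : sphδ R a Y k z = 0) : z = 0 := by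
  obtain ⟨u, v, e⟩ := (sph_mvSquare R a Y).exact_total k z h
  exact eq_zero_of_sum hz u v e

theorem sphδ_surj {k : ℕ} {w : Hom R k (Sph a × Y)} (hw : hmap R k (sndMap _ Y) w = 0) :
    ∃ z, hmap R (k + 1) (sndMap _ Y) z = 0 ∧ sphδ R a Y k z = w := by
  have S := sph_mvSquare R a Y
  obtain ⟨z, hz⟩ := S.exact_inter k w hw (by
    apply (hIso_sndMap (R := R) (Y := Y) (ball_contractible a) k).1
    rw [map_zero, hmap_hmap_eq (h := sndMap (Sph a) Y) (by intro _; rfl), hw])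
  -- The slice part is removed to make the class reduced; it does not affect the connecting
  -- homomorphism.
  refine ⟨z - hmap R (k + 1) (sliceMap ∞ Y) (hmap R (k + 1) (sndMap _ Y) z), ?_, ?_⟩
  · rw [map_sub, hmap_hmap_eq_self (by intro _; rfl), sub_self]
  · rw [map_sub, S.δ_left, sub_zero, hz]

theorem hmap_snd_sphδ (k : ℕ) (z : Hom R (k + 1) (Sph (a + 1) × Y)) :
    hmap R k (sndMap _ Y) (sphδ R a Y k z) = 0 := (sph_mvSquare R a Y).left_δ k z

/-- Reduced classes of degree less than the dimension of the sphere vanish. -/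
theorem eq_zero_of_lt : ∀ (a k : ℕ), k < a → ∀ (z : Hom R k (Sph a × Y)),
    hmap R k (sndMap _ Y) z = 0 → z = 0 := by
  intro a
  induction a with
  | zero => intro k hk; exact absurd hk (Nat.not_lt_zero k)
  | succ a ih =>
    intro k hk z hz
    match k, hk, z, hz with
    | 0, hk, z, hz =>
      obtain ⟨u, v, e⟩ := (sph_mvSquare R a Y).exact_zero z
      exact eq_zero_of_sum hz u v e
    | k + 1, hk, z, hz =>
      exact sphδ_inj hz (ih k (by omega) _ (hmap_snd_sphδ k z))

variable (R a Y) in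
/-- The reduced classes of the product of a sphere and a space. -/
abbrev redHom (k : ℕ) : Submodule R (Hom R k (Sph a × Y)) :=
  LinearMap.ker (hmap R k (sndMap (Sph a) Y))

variable (R a Y) in
/-- The suspension isomorphism. -/
def suspEquiv (k : ℕ) : redHom R (a + 1) Y (k + 1) ≃ₗ[R] redHom R a Y k :=
  LinearEquiv.ofBijective ((sphδ R a Y k).restrict fun z _ => hmap_snd_sphδ k z) (by
    constructor
    · rw [injective_iff_map_eq_zero]
      rintro ⟨z, hz⟩ h
      exact Subtype.ext (sphδ_inj hz (congrArg Subtype.val h))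
    · rintro ⟨w, hw⟩
      obtain ⟨z, hz, h⟩ := sphδ_surj hw
      exact ⟨⟨z, hz⟩, Subtype.ext h⟩)

/-! ### The two-point sphere and the cross product. -/

/-- The point of `S^0` other than the base point. -/
def sphPt : Sph 0 := ((0 : Fin 0 → ℝ) : Sph 0)

theorem sph_zero_cases (x : Sph 0) : x = ∞ ∨ x = sphPt := by
  induction x using OnePoint.rec with
  | infty => exact Or.inl rfl
  | coe v => exact Or.inr (congrArg _ (Subsingleton.elim v 0))

theorem isOpen_sph_zero (s : Set (Sph 0)) : IsOpen s := by
  have h0 : IsOpen ({∞} : Set (Sph 0)) := by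
    have := (OnePoint.isOpen_compl_image_coe (X := Fin 0 → ℝ) (s := Set.univ)).2
      ⟨isClosed_univ, isCompact_univ⟩
    convert this using 1
    ext x
    induction x using OnePoint.rec <;> simp
  have h1 : IsOpen ({sphPt} : Set (Sph 0)) := by
    have : IsOpen ((↑) '' (Set.univ : Set (Fin 0 → ℝ)) : Set (Sph 0)) :=
      OnePoint.isOpenMap_coe _ isOpen_univ
    convert this using 1
    ext x
    rcases sph_zero_cases x with rfl | rfl
    · simp [sphPt]
    · simp [sphPt]
  have : s = (⋃ x ∈ s, {x}) := by simp
  rw [this]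
  refine isOpen_biUnion fun x _ => ?_
  rcases sph_zero_cases x with rfl | rfl
  · exact h0
  · exact h1

theorem sphPt_ne : sphPt ≠ ∞ := OnePoint.coe_ne_infty _

variable (Y) in
/-- The cover of the product with a two-point space. -/
def coverZero : Cover (Sph 0 × Y) where
  U := Prod.fst ⁻¹' {∞}
  V := Prod.fst ⁻¹' {sphPt}
  isOpen_U := (isOpen_sph_zero _).preimage continuous_fst
  isOpen_V := (isOpen_sph_zero _).preimage continuous_fst
  union_eq := by
    ext p
    have := sph_zero_cases p.1
    simpa using this

instance : IsEmpty ((coverZero Y).U ∩ (coverZero Y).V : Set (Sph 0 × Y)) :=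
  ⟨fun p => sphPt_ne ((show p.1.1 = sphPt from p.2.2).symm.trans (show p.1.1 = ∞ from p.2.1))⟩

theorem hIso_slice (x : Sph 0) : HIso R (⟨fun y => ⟨(x, y), rfl⟩, by fun_prop⟩ :
    C(Y, (Prod.fst ⁻¹' {x} : Set (Sph 0 × Y)))) := by
  refine HIso.of_inverse ⟨fun p => p.1.2, by fun_prop⟩ (fun _ => rfl) ?_
  rintro ⟨⟨x, y⟩, h⟩
  have : x = _ := h
  subst this
  rfl

theorem zero_exists_sum (k : ℕ) (z : Hom R k (Sph 0 × Y)) : ∃ u v : Hom R k Y,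
    z = hmap R k (sliceMap ∞ Y) u + hmap R k (sliceMap sphPt Y) v := by
  have h : ∃ u v, z = hmap R k (inc (coverZero Y).U) u + hmap R k (inc (coverZero Y).V) v := by
    match k, z with
    | 0, z => exact (coverZero Y).mvSquare.exact_zero z
    | k + 1, z => exact (coverZero Y).mvSquare.exact_total k z (hom_eq_zero_of_isEmpty _ _)
  obtain ⟨u, v, rfl⟩ := h
  obtain ⟨u, rfl⟩ := (hIso_slice (R := R) (Y := Y) ∞ k).2 u
  obtain ⟨v, rfl⟩ := (hIso_slice (R := R) (Y := Y) sphPt k).2 v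
  refine ⟨u, v, ?_⟩
  congr 1
  · exact hmap_hmap_eq (by intro _; rfl) k u
  · exact hmap_hmap_eq (by intro _; rfl) k v

theorem zero_sum_inj {k : ℕ} {u : Hom R k Y}
    (h : hmap R k (sliceMap sphPt Y) u = hmap R k (sliceMap ∞ Y) u) : u = 0 := by
  have e1 := hmap_hmap_eq (R := R) (f := (⟨fun y => ⟨((∞ : Sph 0), y), rfl⟩, by fun_prop⟩ :
    C(Y, (coverZero Y).U))) (g := inc (coverZero Y).U) (h := sliceMap ∞ Y) (by intro _; rfl) k u
  have e2 := hmap_hmap_eq (R := R) (f := (⟨fun y => ⟨(sphPt, y), rfl⟩, by fun_prop⟩ :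
    C(Y, (coverZero Y).V))) (g := inc (coverZero Y).V) (h := sliceMap sphPt Y) (by intro _; rfl) k u
  obtain ⟨w, hw, -⟩ := (coverZero Y).mvSquare.exact_sum k _ _ (e1.trans (h.symm.trans e2.symm))
  rw [hom_eq_zero_of_isEmpty k w, map_zero] at hw
  exact (hIso_slice (R := R) (Y := Y) ∞ k).1 (hw.symm.trans (map_zero _).symm)

variable (R) in
/-- The cross product with the fundamental class of a sphere. -/
def cross (k : ℕ) : (a : ℕ) → (Y : Type) → [TopologicalSpace Y] →
    Hom R k Y →ₗ[R] redHom R a Y (k + a)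
  | 0, Y, _ => (hmap R k (sliceMap sphPt Y) - hmap R k (sliceMap ∞ Y)).codRestrict _ fun u => by
      change hmap R k _ (hmap R k (sliceMap sphPt Y) u - hmap R k (sliceMap ∞ Y) u) = 0
      rw [map_sub, hmap_hmap_eq_self (by intro _; rfl),
        hmap_hmap_eq_self (by intro _; rfl), sub_self]
  | a + 1, Y, _ => (suspEquiv R a Y (k + a)).symm.toLinearMap ∘ₗ cross k a Y

theorem cross_zero {k : ℕ} (u : Hom R k Y) : (cross R k 0 Y u).1 =
    hmap R k (sliceMap sphPt Y) u - hmap R k (sliceMap ∞ Y) u := by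
  simp only [cross]
  rfl

theorem cross_succ {k a : ℕ} (u : Hom R k Y) :
    cross R k (a + 1) Y u = (suspEquiv R a Y (k + a)).symm (cross R k a Y u) := by
  simp only [cross]
  rfl

theorem sphδ_cross {k a : ℕ} (u : Hom R k Y) :
    sphδ R a Y (k + a) (cross R k (a + 1) Y u).1 = (cross R k a Y u).1 := by
  rw [cross_succ]
  exact congrArg Subtype.val ((suspEquiv R a Y (k + a)).apply_symm_apply (cross R k a Y u))

theorem hmap_snd_cross {k a : ℕ} (u : Hom R k Y) :
    hmap R (k + a) (sndMap _ Y) (cross R k a Y u).1 = 0 := (cross R k a Y u).2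

/-- This is the Künneth isomorphism for a sphere factor: the base case is the disjoint union of two
copies of Y, and each further dimension is a suspension isomorphism. -/
theorem cross_bijective (k a : ℕ) : Function.Bijective (cross R k a Y) := by
  induction a with
  | zero =>
    constructor
    · rw [injective_iff_map_eq_zero]
      intro u hu
      have := congrArg Subtype.val hu
      rw [cross_zero] at this
      exact zero_sum_inj (sub_eq_zero.1 this)
    · rintro ⟨z, hz⟩
      obtain ⟨u, v, rfl⟩ := zero_exists_sum k z
      have hz' : hmap R k (sndMap (Sph 0) Y) (hmap R k (sliceMap ∞ Y) u) +
          hmap R k (sndMap (Sph 0) Y) (hmap R k (sliceMap sphPt Y) v) = 0 := by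
        rw [← map_add]; exact hz
      rw [hmap_hmap_eq_self (by intro _; rfl), hmap_hmap_eq_self (by intro _; rfl)] at hz'
      refine ⟨v, Subtype.ext ?_⟩
      rw [cross_zero]
      dsimp only
      rw [eq_neg_of_add_eq_zero_left hz', map_neg]
      abel
  | succ a ih =>
    have : ⇑(cross R k (a + 1) Y) = (suspEquiv R a Y (k + a)).symm ∘ cross R k a Y :=
      funext cross_succ
    rw [this]
    exact (suspEquiv R a Y (k + a)).symm.bijective.comp ih

theorem cross_natural {Y' : Type} [TopologicalSpace Y'] (f : C(Y, Y')) (k a : ℕ) (u : Hom R k Y) :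
    hmap R (k + a) (idProd _ f) (cross R k a Y u).1 = (cross R k a Y' (hmap R k f u)).1 := by
  induction a with
  | zero =>
    rw [cross_zero, cross_zero]
    change hmap R k _ (hmap R k (sliceMap sphPt Y) u - hmap R k (sliceMap ∞ Y) u) = _
    rw [map_sub]
    congr 1
    · exact hmap_comm R k (by intro _; rfl) u
    · exact hmap_comm R k (by intro _; rfl) u
  | succ a ih =>
    rw [← sub_eq_zero]
    have e : hmap R (k + (a + 1)) (idProd _ f) (cross R k (a + 1) Y u).1 =
        hmap R (k + a + 1) (idProd _ f) (cross R k (a + 1) Y u).1 := rfl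
    have h1 : hmap R (k + a + 1) (sndMap _ Y') (cross R k (a + 1) Y' (hmap R k f u)).1 = 0 :=
      hmap_snd_cross _
    have h2 : hmap R (k + a + 1) (sndMap _ Y) (cross R k (a + 1) Y u).1 = 0 := hmap_snd_cross _
    rw [e]
    -- A reduced class is determined by its image under `sphδ`, and that map commutes with `idProd`;
    -- so the difference is tested there.
    refine sphδ_inj (k := k + a) ?_ ?_
    · refine (map_sub (hmap R (k + a + 1) (sndMap _ Y')) _ _).trans ?_
      rw [h1, sub_zero, hmap_comm R _ (f' := sndMap (Sph (a + 1)) Y) (g' := f)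
        (by intro _; rfl), h2, map_zero]
    · refine (map_sub (sphδ R a Y' (k + a)) _ _).trans ?_
      rw [sphδ_natural, sphδ_cross, sphδ_cross, ih, sub_self]

/-- Every reduced class is a cross product. -/
theorem exists_cross {k a : ℕ} {z : Hom R (k + a) (Sph a × Y)}
    (hz : hmap R (k + a) (sndMap _ Y) z = 0) : ∃ u, (cross R k a Y u).1 = z := by
  obtain ⟨u, hu⟩ := (cross_bijective (R := R) (Y := Y) k a).2 ⟨z, hz⟩
  exact ⟨u, congrArg Subtype.val hu⟩

theorem cross_eq_zero {k a : ℕ} {u : Hom R k Y} (h : (cross R k a Y u).1 = 0) : u = 0 :=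
  (cross_bijective k a).1 (Subtype.ext (by rw [h, map_zero]; rfl))

/-- Every class is the sum of a reduced class and a class of the slice at the base point. -/
theorem exists_red_add (k : ℕ) (z : Hom R k (Sph a × Y)) : ∃ z', hmap R k (sndMap _ Y) z' = 0 ∧
    z = z' + hmap R k (sliceMap ∞ Y) (hmap R k (sndMap _ Y) z) :=
  ⟨z - hmap R k (sliceMap ∞ Y) (hmap R k (sndMap _ Y) z), by
    rw [map_sub, hmap_hmap_eq_self (by intro _; rfl), sub_self], by abel⟩

end Cross

/-! ### The homology of spheres and smash products -/

section Spheres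

variable {R : Type} [CommRing R]

theorem hIso_fst_pt (X : Type) [TopologicalSpace X] : HIso R (fstMap X PUnit) :=
  HIso.of_inverse ⟨fun x => (x, PUnit.unit), by fun_prop⟩ (fun _ => rfl) (fun _ => rfl)

/-- The homology of a sphere in its dimension is free on one generator. -/
theorem exists_fundamental {m : ℕ} (hm : 1 ≤ m) : ∃ s : Hom R m (Sph m),
    (∀ z, ∃ r : R, z = r • s) ∧ ∀ r : R, r • s = 0 → r = 0 := by
  -- `cross` lands in degree 0 + m, which is not definitionally m; quantifying over the degree
  -- avoids casts between homology groups.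
  suffices h : ∀ K, K = 0 + m → ∃ s : Hom R K (Sph m),
      (∀ z, ∃ r : R, z = r • s) ∧ ∀ r : R, r • s = 0 → r = 0 from h m (Nat.zero_add m).symm
  rintro K rfl
  refine ⟨hmap R _ (fstMap _ _) (cross R 0 m PUnit (ptClass R)).1, fun z => ?_, fun r hr => ?_⟩
  · obtain ⟨z, rfl⟩ := (hIso_fst_pt (R := R) (Sph m) (0 + m)).2 z
    obtain ⟨u, rfl⟩ := exists_cross (k := 0) (z := z) (hom_point_eq_zero _ (by omega) _)
    obtain ⟨r, rfl⟩ := exists_smul_ptClass u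
    exact ⟨r, by rw [map_smul]; exact map_smul (hmap R (0 + m) (fstMap _ _)) r _⟩
  · rw [← map_smul] at hr
    have h1 := (hIso_fst_pt (R := R) (Sph m) (0 + m)).1 (hr.trans (map_zero _).symm)
    have h2 : (cross R 0 m PUnit (r • ptClass R)).1 = 0 := by rw [map_smul]; exact h1
    exact smul_ptClass_eq_zero (cross_eq_zero h2)

theorem sph_hom_zero {m : ℕ} (hm : 1 ≤ m) (z : Hom R 0 (Sph m)) :
    z = hmap R 0 (ContinuousMap.const _ ∞) (hmap R 0 (toPt _) z) := by
  obtain ⟨z, rfl⟩ := (hIso_fst_pt (R := R) (Sph m) 0).2 z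
  rw [hmap_hmap_eq (h := sndMap (Sph m) PUnit) (by intro _; rfl)]
  obtain ⟨z', hz', e⟩ := exists_red_add 0 z
  rw [eq_zero_of_lt m 0 hm z' hz', zero_add] at e
  conv_lhs => rw [e]
  exact hmap_hmap_eq (by intro _; rfl) _ _

/-! ### Punctured spheres and the top homology of a smash product. -/

/-- The complement of a point of a sphere. -/
abbrev SphNe {c : ℕ} (p : Sph c) : Type := {x : Sph c // x ≠ p}

/-- The origin of a sphere. -/
def origin (c : ℕ) : Sph c := ((0 : Fin c → ℝ) : Sph c)

/-- The finite points of a sphere. -/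
def finHomeo (c : ℕ) : (Fin c → ℝ) ≃ₜ SphNe (∞ : Sph c) :=
  OnePoint.isOpenEmbedding_coe.isEmbedding.toHomeomorph.trans
    (Homeomorph.setCongr (s := Set.range (OnePoint.some : (Fin c → ℝ) → Sph c)) (t := {x | x ≠ ∞})
      (by ext x; exact OnePoint.ne_infty_iff_exists.symm))

@[simp] theorem finHomeo_coe {c : ℕ} (v : Fin c → ℝ) : (finHomeo c v).1 = (v : Sph c) := rfl

theorem coe_finHomeo_symm {c : ℕ} (x : SphNe (∞ : Sph c)) :
    (((finHomeo c).symm x : Fin c → ℝ) : Sph c) = x := by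
  rw [← finHomeo_coe, Homeomorph.apply_symm_apply]

theorem sphNe_infty_contractible (c : ℕ) :
    ∃ p : SphNe (∞ : Sph c), (ContinuousMap.const _ p).Homotopic (ContinuousMap.id _) := by
  refine ⟨finHomeo c 0, ⟨⟨⟨fun q => finHomeo c ((q.1 : ℝ) • (finHomeo c).symm q.2), by fun_prop⟩,
    fun x => ?_, fun x => ?_⟩⟩⟩
  · simp
  · simp

/-- Moving the points of a sphere away from the origin. -/
def expandFun (c : ℕ) (p : SphNe (origin c) × I) : Sph c :=
  open Classical in
  p.1.1.elim ∞ fun v => if p.2 = 1 then ∞ else (((1 - (p.2 : ℝ))⁻¹ • v : Fin c → ℝ) : Sph c)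

theorem one_sub_pos {u : I} (h : u ≠ 1) : 0 < 1 - (u : ℝ) :=
  sub_pos.2 (lt_of_le_of_ne u.2.2 fun h' => h (Subtype.ext h'))

theorem expandFun_one {c : ℕ} (x : SphNe (origin c)) : expandFun c (x, 1) = ∞ := by
  obtain ⟨x, hx⟩ := x
  induction x using OnePoint.rec with
  | infty => rfl
  | coe v => simp [expandFun]

theorem expandFun_coe {c : ℕ} {v : Fin c → ℝ} (h : (v : Sph c) ≠ origin c) {u : I} (hu : u ≠ 1) :
    expandFun c (⟨v, h⟩, u) = (((1 - (u : ℝ))⁻¹ • v : Fin c → ℝ) : Sph c) := by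
  simp [expandFun, hu]

/-- The map multiplies by 1 / (1 - u). Continuity where the value is ∞ holds because the expanded
norm exceeds M as soon as M(1 - u) < ‖v‖, a condition that holds near the point ∞ and, v being
nonzero, near u = 1. -/
theorem continuous_expandFun (c : ℕ) : Continuous (expandFun c) := by
  apply continuous_to_onePoint
  · intro U hU
    rw [isOpen_iff_mem_nhds]
    rintro ⟨⟨x, hx⟩, u⟩ ⟨w, hw, hwx⟩
    induction x using OnePoint.rec with
    | infty => exact absurd hwx (OnePoint.coe_ne_infty _)
    | coe v =>
      by_cases hu : u = 1
      · subst hu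
        rw [expandFun_one] at hwx
        exact absurd hwx (OnePoint.coe_ne_infty _)
      rw [expandFun_coe hx hu] at hwx
      have hw' := OnePoint.coe_injective hwx
      subst hw'
      have ho : IsOpenEmbedding (Prod.map (↑) id : (Fin c → ℝ) × I → Sph c × I) :=
        OnePoint.isOpenEmbedding_coe.prodMap IsOpenEmbedding.id
      have hc : ContinuousAt (fun p : (Fin c → ℝ) × I => (1 - (p.2 : ℝ))⁻¹ • p.1) (v, u) := by
        have h0 : ContinuousAt (fun p : (Fin c → ℝ) × I => 1 - (p.2 : ℝ)) (v, u) := by fun_prop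
        exact (h0.inv₀ (one_sub_pos hu).ne').smul continuous_fst.continuousAt
      have h1 : ∀ᶠ p : (Fin c → ℝ) × I in 𝓝 (v, u), (1 - (p.2 : ℝ))⁻¹ • p.1 ∈ U ∧ p.2 ≠ 1 :=
        (hc.eventually_mem (hU.mem_nhds hw)).and
          (continuous_snd.continuousAt.eventually_ne hu)
      have h2 := ho.isOpenMap.image_mem_nhds h1
      have h3 : Continuous fun p : SphNe (origin c) × I => (p.1.1, p.2) := by fun_prop
      filter_upwards [h3.continuousAt.preimage_mem_nhds (x := (⟨(v : Sph c), hx⟩, u)) h2] with p hp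
      obtain ⟨⟨x', hx'⟩, u'⟩ := p
      obtain ⟨⟨v', u''⟩, ⟨hv, hu''⟩, he⟩ := hp
      have e1 : (v' : Sph c) = x' := congrArg Prod.fst he
      have e2 : u'' = u' := congrArg Prod.snd he
      subst e1 e2
      exact ⟨_, hv, (expandFun_coe hx' hu'').symm⟩
  · rintro K hK ⟨⟨x, hx⟩, u⟩ h
    obtain ⟨M, hM0, hM⟩ := hK.isBounded.exists_pos_norm_le
    have key : ∀ (v : Fin c → ℝ) (hv : (v : Sph c) ≠ origin c) (u : I),
        M * (1 - u) < ‖v‖ → expandFun c (⟨v, hv⟩, u) ∉ ((↑) '' K : Set (Sph c)) := by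
      rintro v hv u hlt ⟨w, hw, hwe⟩
      by_cases hu : u = 1
      · subst hu
        rw [expandFun_one] at hwe
        exact absurd hwe (OnePoint.coe_ne_infty _)
      · rw [expandFun_coe hv hu] at hwe
        have := hM w hw
        rw [OnePoint.coe_injective hwe, norm_smul, norm_inv,
          Real.norm_of_nonneg (one_sub_pos hu).le,
          inv_mul_le_iff₀ (one_sub_pos hu)] at this
        linarith
    have h3 : Continuous fun p : SphNe (origin c) × I => (p.1.1, p.2) := by fun_prop
    induction x using OnePoint.rec with
    | infty =>
      have hB : IsCompact (Metric.closedBall (0 : Fin c → ℝ) M) := isCompact_closedBall _ _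
      have ho := (OnePoint.isOpen_compl_image_coe (X := Fin c → ℝ)).2 ⟨hB.isClosed, hB⟩
      filter_upwards [(ho.preimage (continuous_fst.comp h3)).mem_nhds (x := (⟨∞, hx⟩, u)) (by simp)]
        with p hp
      obtain ⟨⟨x', hx'⟩, u'⟩ := p
      induction x' using OnePoint.rec with
      | infty =>
        rintro ⟨w, -, hw⟩
        exact OnePoint.coe_ne_infty _ hw
      | coe v' =>
        refine key v' hx' u' ?_
        have : M < ‖v'‖ := by
          by_contra hle
          exact hp ⟨v', by simpa using hle, rfl⟩
        have h0 := u'.2.1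
        nlinarith
    | coe v =>
      by_cases hu : u = 1
      · subst hu
        have ho : IsOpenEmbedding (Prod.map (↑) id : (Fin c → ℝ) × I → Sph c × I) :=
          OnePoint.isOpenEmbedding_coe.prodMap IsOpenEmbedding.id
        have hv0 : v ≠ 0 := fun h0 => hx (by rw [h0]; rfl)
        have h1 : ∀ᶠ p : (Fin c → ℝ) × I in 𝓝 (v, 1), M * (1 - p.2) < ‖p.1‖ := by
          refine (IsOpen.mem_nhds (isOpen_lt (by fun_prop) (by fun_prop)) ?_)
          simpa using hv0
        have h2 := ho.isOpenMap.image_mem_nhds h1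
        filter_upwards [h3.continuousAt.preimage_mem_nhds (x := (⟨(v : Sph c), hx⟩, 1)) h2]
          with p hp
        obtain ⟨⟨x', hx'⟩, u'⟩ := p
        obtain ⟨⟨v', u''⟩, hv, he⟩ := hp
        have e1 : (v' : Sph c) = x' := congrArg Prod.fst he
        have e2 : u'' = u' := congrArg Prod.snd he
        subst e1 e2
        exact key v' hx' u'' hv
      · rw [expandFun_coe hx hu] at h
        exact absurd h (OnePoint.coe_ne_infty _)

theorem expandFun_ne {c : ℕ} (p : SphNe (origin c) × I) : expandFun c p ≠ origin c := by
  obtain ⟨⟨x, hx⟩, u⟩ := p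
  induction x using OnePoint.rec with
  | infty => exact OnePoint.infty_ne_coe _
  | coe v =>
    by_cases hu : u = 1
    · subst hu
      rw [expandFun_one]
      exact OnePoint.infty_ne_coe _
    · rw [expandFun_coe hx hu]
      intro h
      have := OnePoint.coe_injective h
      rw [smul_eq_zero] at this
      rcases this with h0 | h0
      · exact absurd h0 (inv_ne_zero (one_sub_pos hu).ne')
      · exact hx (by rw [h0]; rfl)

theorem sphNe_origin_contractible (c : ℕ) :
    ∃ p : SphNe (origin c), (ContinuousMap.const _ p).Homotopic (ContinuousMap.id _) := by
  refine ⟨⟨∞, OnePoint.infty_ne_coe _⟩, ContinuousMap.Homotopic.symm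
    ⟨⟨⟨fun q => ⟨expandFun c (q.2, q.1), expandFun_ne _⟩, ?_⟩, fun x => ?_, fun x => ?_⟩⟩⟩
  · exact Continuous.subtype_mk ((continuous_expandFun c).comp (by fun_prop)) _
  · apply Subtype.ext
    obtain ⟨x, hx⟩ := x
    induction x using OnePoint.rec with
    | infty => rfl
    | coe v =>
      change expandFun c (⟨v, hx⟩, 0) = v
      rw [expandFun_coe hx (by simp)]
      simp
  · exact Subtype.ext (expandFun_one x)

theorem hIso_toPt_prod {X Y : Type} [TopologicalSpace X] [TopologicalSpace Y]
    (hX : ∃ p : X, (ContinuousMap.const _ p).Homotopic (ContinuousMap.id _))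
    (hY : ∃ p : Y, (ContinuousMap.const _ p).Homotopic (ContinuousMap.id _)) :
    HIso R (toPt (X × Y)) := by
  obtain ⟨_, hx⟩ := hX
  obtain ⟨_, hy⟩ := hY
  exact HIso.of_comp (hIso_toPt hy) (hIso_sndMap (Y := Y) hx) fun _ => rfl

/-- The complement of the origin in a product of spheres. -/
abbrev ProdNe (a b : ℕ) : Set (Sph a × Sph b) := {p | p.1 ≠ origin a ∨ p.2 ≠ origin b}

/-- The cover of `ProdNe` by the subsets where one of the coordinates is not the origin. -/
def prodNeCover (a b : ℕ) : Cover (ProdNe a b) where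
  U := {p | p.1.1 ≠ origin a}
  V := {p | p.1.2 ≠ origin b}
  isOpen_U := isOpen_ne.preimage (continuous_fst.comp continuous_subtype_val)
  isOpen_V := isOpen_ne.preimage (continuous_snd.comp continuous_subtype_val)
  union_eq := by ext p; exact iff_of_true p.2 trivial

/-- Removing the origin from a product of spheres leaves a space with the homology of a wedge: the
two open pieces project by homology isomorphisms to S^b and S^a, and they meet in a contractible
set. Positive-degree classes are therefore detected by the projections. -/
theorem prodNe_eq_zero {a b k : ℕ} (z : Hom R (k + 1) (ProdNe a b))
    (h1 : hmap R (k + 1) ((fstMap _ _).comp (inc (ProdNe a b))) z = 0)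
    (h2 : hmap R (k + 1) ((sndMap _ _).comp (inc (ProdNe a b))) z = 0) : z = 0 := by
  have S := (prodNeCover a b).mvSquare (R := R)
  have hac : HIso R (toPt ((prodNeCover a b).U ∩ (prodNeCover a b).V : Set (ProdNe a b))) := by
    refine HIso.of_comp (hIso_toPt_prod (R := R) (sphNe_origin_contractible a)
      (sphNe_origin_contractible b)) (f := ⟨fun p => (⟨p.1.1.1, p.2.1⟩, ⟨p.1.1.2, p.2.2⟩),
        by fun_prop⟩) ?_ (fun _ => rfl)
    exact HIso.of_inverse ⟨fun q => ⟨⟨(q.1.1, q.2.1), Or.inl q.1.2⟩, q.1.2, q.2.2⟩, by fun_prop⟩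
      (fun _ => rfl) (fun _ => rfl)
  -- The intersection is acyclic, so even in degree 0 a class is detected by the map to a point;
  -- that map factors through U, where connecting classes vanish.
  have hδ : mvδ R (prodNeCover a b) k z = 0 := by
    apply (hac k).1
    rw [map_zero, ← hmap_hmap_eq (f := incl Set.inter_subset_left)
      (g := toPt (prodNeCover a b).U) (by intro _; rfl), S.left_δ, map_zero]
  obtain ⟨u, v, rfl⟩ := S.exact_total k z hδ
  have hU : HIso R (((sndMap _ _).comp (inc (ProdNe a b))).comp (inc (prodNeCover a b).U)) := by
    obtain ⟨p, hp⟩ := sphNe_origin_contractible a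
    refine HIso.of_comp (hIso_sndMap (R := R) (Y := Sph b) hp)
      (f := ⟨fun p => (⟨p.1.1.1, p.2⟩, p.1.1.2), by fun_prop⟩) ?_ (fun _ => rfl)
    exact HIso.of_inverse ⟨fun q => ⟨⟨(q.1.1, q.2), Or.inl q.1.2⟩, q.1.2⟩, by fun_prop⟩
      (fun _ => rfl) (fun _ => rfl)
  have hV : HIso R (((fstMap _ _).comp (inc (ProdNe a b))).comp (inc (prodNeCover a b).V)) := by
    obtain ⟨p, hp⟩ := sphNe_origin_contractible b
    refine HIso.of_comp (hIso_sndMap (R := R) (Y := Sph a) hp)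
      (f := ⟨fun p => (⟨p.1.1.2, p.2⟩, p.1.1.1), by fun_prop⟩) ?_ (fun _ => rfl)
    exact HIso.of_inverse ⟨fun q => ⟨⟨(q.2, q.1.1), Or.inr q.1.2⟩, q.1.2⟩, by fun_prop⟩
      (fun _ => rfl) (fun _ => rfl)
  have eU : hmap R (k + 1) (((fstMap _ _).comp (inc (ProdNe a b))).comp (inc (prodNeCover a b).U)) u
      = 0 := by
    obtain ⟨p, hp⟩ := sphNe_origin_contractible a
    rw [← hmap_hmap_eq (f := (⟨fun p => ⟨p.1.1.1, p.2⟩, by fun_prop⟩ :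
      C((prodNeCover a b).U, SphNe (origin a)))) (g := ⟨Subtype.val, continuous_subtype_val⟩)
      (by intro _; rfl)]
    exact hmap_eq_zero_of_acyclic (hIso_toPt hp) (Nat.succ_ne_zero k) u
  have eV : hmap R (k + 1) (((sndMap _ _).comp (inc (ProdNe a b))).comp (inc (prodNeCover a b).V)) v
      = 0 := by
    obtain ⟨p, hp⟩ := sphNe_origin_contractible b
    rw [← hmap_hmap_eq (f := (⟨fun p => ⟨p.1.1.2, p.2⟩, by fun_prop⟩ :
      C((prodNeCover a b).V, SphNe (origin b)))) (g := ⟨Subtype.val, continuous_subtype_val⟩)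
      (by intro _; rfl)]
    exact hmap_eq_zero_of_acyclic (hIso_toPt hp) (Nat.succ_ne_zero k) v
  rw [map_add, ← hmap_comp_apply, ← hmap_comp_apply] at h1 h2
  rw [eU, zero_add] at h1
  rw [eV, add_zero] at h2
  rw [(hU (k + 1)).1 (h2.trans (map_zero _).symm), (hV (k + 1)).1 (h1.trans (map_zero _).symm)]
  simp

/-- The cover of a sphere by the complements of the origin and the base point. -/
def sphCover (c : ℕ) : Cover (Sph c) where
  U := {x | x ≠ origin c}
  V := {x | x ≠ ∞}
  isOpen_U := isOpen_ne
  isOpen_V := isOpen_ne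
  union_eq := by
    ext x
    induction x using OnePoint.rec <;> simp [origin]

/-- The cover of a product of spheres by the complement of the origin and the finite points. -/
def prodCover (a b : ℕ) : Cover (Sph a × Sph b) where
  U := ProdNe a b
  V := {p | p.1 ≠ ∞ ∧ p.2 ≠ ∞}
  isOpen_U := (isOpen_ne.preimage continuous_fst).union (isOpen_ne.preimage continuous_snd)
  isOpen_V := (isOpen_ne.preimage continuous_fst).inter (isOpen_ne.preimage continuous_snd)
  union_eq := by
    ext ⟨x, y⟩
    induction x using OnePoint.rec <;> induction y using OnePoint.rec <;> simp [origin]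

theorem smash_coe {a b : ℕ} (v : Fin a → ℝ) (w : Fin b → ℝ) :
    smash (rfl : a + b = a + b) ((v : Sph a), (w : Sph b)) = ((Fin.append v w : Fin (a + b) → ℝ) :
      Sph (a + b)) := rfl

theorem append_eq_zero {a b : ℕ} {v : Fin a → ℝ} {w : Fin b → ℝ} (h : Fin.append v w = 0) :
    v = 0 ∧ w = 0 :=
  ⟨funext fun i => by simpa using congrFun h (Fin.castAdd b i),
    funext fun i => by simpa using congrFun h (Fin.natAdd a i)⟩

theorem smash_mapsTo_U (a b : ℕ) : Set.MapsTo (smash (rfl : a + b = a + b)) (prodCover a b).U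
    (sphCover (a + b)).U := by
  rintro ⟨x, y⟩ h
  change smash rfl (x, y) ≠ origin (a + b)
  induction x using OnePoint.rec with
  | infty => exact OnePoint.infty_ne_coe _
  | coe v =>
    induction y using OnePoint.rec with
    | infty => rw [smash_infty_right]; exact OnePoint.infty_ne_coe _
    | coe w =>
      rw [smash_coe]
      intro h0
      obtain ⟨rfl, rfl⟩ := append_eq_zero (OnePoint.coe_injective h0)
      rcases h with h | h
      · exact h rfl
      · exact h rfl

theorem smash_mapsTo_V (a b : ℕ) : Set.MapsTo (smash (rfl : a + b = a + b)) (prodCover a b).V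
    (sphCover (a + b)).V := by
  rintro ⟨x, y⟩ h
  obtain ⟨v, rfl⟩ := OnePoint.ne_infty_iff_exists.1 h.1
  obtain ⟨w, hw⟩ := OnePoint.ne_infty_iff_exists.1 h.2
  change smash rfl ((v : Sph a), y) ≠ ∞
  rw [← show (w : Sph b) = y from hw, smash_coe]
  exact OnePoint.coe_ne_infty _

/-- The coordinates of a finite point of a sphere, divided into two groups. -/
def splitMap (a b : ℕ) : C(SphNe (∞ : Sph (a + b)), Sph a × Sph b) :=
  ⟨fun x => (((fun i => (finHomeo _).symm x (Fin.castAdd b i) : Fin a → ℝ) : Sph a),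
    ((fun i => (finHomeo _).symm x (Fin.natAdd a i) : Fin b → ℝ) : Sph b)), by
    refine Continuous.prodMk (OnePoint.continuous_coe.comp (continuous_pi fun i => ?_))
      (OnePoint.continuous_coe.comp (continuous_pi fun i => ?_))
    · exact (continuous_apply _).comp (finHomeo _).symm.continuous
    · exact (continuous_apply _).comp (finHomeo _).symm.continuous⟩

theorem smash_splitMap {a b : ℕ} (x : SphNe (∞ : Sph (a + b))) :
    smash (rfl : a + b = a + b) (splitMap a b x) = x := by
  conv_rhs => rw [← coe_finHomeo_symm x]
  change ((Fin.append _ _ : Fin (a + b) → ℝ) : Sph (a + b)) = _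
  congr 1
  funext i
  refine Fin.addCases (fun j => ?_) (fun j => ?_) i <;> simp

theorem splitMap_smash {a b : ℕ} {p : Sph a × Sph b} (h : p ∈ (prodCover a b).V) :
    splitMap a b ⟨smash (rfl : a + b = a + b) p, smash_mapsTo_V a b h⟩ = p := by
  obtain ⟨x, y⟩ := p
  obtain ⟨v, hv⟩ := OnePoint.ne_infty_iff_exists.1 h.1
  obtain ⟨w, hw⟩ := OnePoint.ne_infty_iff_exists.1 h.2
  have hv' : x = (v : Sph a) := hv.symm
  have hw' : y = (w : Sph b) := hw.symm
  subst hv' hw'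
  have e : (finHomeo (a + b)).symm ⟨smash (rfl : a + b = a + b) ((v : Sph a), (w : Sph b)),
      smash_mapsTo_V a b h⟩ = Fin.append v w := by
    rw [Homeomorph.symm_apply_eq]
    exact Subtype.ext rfl
  simp only [splitMap, ContinuousMap.coe_mk, e]
  refine Prod.ext ?_ ?_
  · change ((_ : Fin a → ℝ) : Sph a) = _
    congr 1; funext i; simp
  · change ((_ : Fin b → ℝ) : Sph b) = _
    congr 1; funext i; simp

theorem hIso_smash_inter (a b : ℕ) : HIso R (restr (smash (rfl : a + b = a + b))
    ((smash_mapsTo_U a b).inter_inter (smash_mapsTo_V a b))) := by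
  have hm : ∀ x : ((sphCover (a + b)).U ∩ (sphCover (a + b)).V : Set (Sph (a + b))),
      splitMap a b ⟨x.1, x.2.2⟩ ∈ (prodCover a b).U ∩ (prodCover a b).V := by
    intro x
    refine ⟨?_, OnePoint.coe_ne_infty _, OnePoint.coe_ne_infty _⟩
    by_contra hne
    have hne' : ¬ ((splitMap a b ⟨x.1, x.2.2⟩).1 ≠ origin a ∨
      (splitMap a b ⟨x.1, x.2.2⟩).2 ≠ origin b) := hne
    push Not at hne'
    have h := smash_splitMap ⟨x.1, x.2.2⟩
    rw [show splitMap a b ⟨x.1, x.2.2⟩ = (origin a, origin b) from Prod.ext hne'.1 hne'.2] at h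
    refine x.2.1 (h.symm.trans ?_)
    change ((_ : Fin (a + b) → ℝ) : Sph (a + b)) = _
    rw [origin]
    congr 1
    funext i
    refine Fin.addCases (fun j => ?_) (fun j => ?_) i <;> simp
  refine HIso.of_inverse ⟨fun x => ⟨splitMap a b ⟨x.1, x.2.2⟩, hm x⟩, by fun_prop⟩ ?_ ?_
  · rintro ⟨p, hp⟩
    exact Subtype.ext (splitMap_smash hp.2)
  · rintro ⟨x, hx⟩
    exact Subtype.ext (smash_splitMap ⟨x, hx.2⟩)

/-- The quotient map to the smash product is surjective in the top homology. -/
theorem smash_surjective {a b c : ℕ} (h : a + b = c) (ha : 1 ≤ a) (hb : 1 ≤ b)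
    (z : Hom R c (Sph c)) : ∃ w : Hom R c (Sph a × Sph b), hmap R c (smash h) w = z := by
  subst h
  obtain ⟨k, hk⟩ : ∃ k, a + b = (k + 1) + 1 := ⟨a + b - 2, by omega⟩
  suffices H : ∀ z : Hom R (k + 1 + 1) (Sph (a + b)), ∃ w : Hom R (k + 1 + 1) (Sph a × Sph b),
      hmap R (k + 1 + 1) (smash rfl) w = z by
    rw [← hk] at H
    exact H z
  clear z
  intro z
  have S := (sphCover (a + b)).mvSquare (R := R)
  have S' := (prodCover a b).mvSquare (R := R)
  -- On finite points away from the origin the smash map is a homeomorphism, so the connecting class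
  -- of z lifts to the product.
  obtain ⟨w, hw⟩ := (hIso_smash_inter (R := R) a b (k + 1)).2 (mvδ R (sphCover (a + b)) (k + 1) z)
  have hV' : HIso R (toPt (prodCover a b).V) := by
    refine HIso.of_comp (hIso_toPt_prod (R := R) (sphNe_infty_contractible a)
      (sphNe_infty_contractible b)) (f := ⟨fun p => (⟨p.1.1, p.2.1⟩, ⟨p.1.2, p.2.2⟩),
        by fun_prop⟩) ?_ (fun _ => rfl)
    exact HIso.of_inverse ⟨fun q => ⟨(q.1.1, q.2.1), q.1.2, q.2.2⟩, by fun_prop⟩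
      (fun _ => rfl) (fun _ => rfl)
  -- The lift dies in `ProdNe`, because on the intersection both projections factor through the
  -- contractible set of finite points. Thus it is itself a connecting class; the degree is positive
  -- because a and b are.
  have e1 : hmap R (k + 1) (incl (Set.inter_subset_left :
      (prodCover a b).U ∩ (prodCover a b).V ⊆ (prodCover a b).U)) w = 0 := by
    refine prodNe_eq_zero _ ?_ ?_
    · refine (hmap_comm R (k + 1) (f' := incl (Set.inter_subset_right))
        (g' := (fstMap _ _).comp (inc (prodCover a b).V)) (by intro _; rfl) w).trans ?_
      exact hmap_eq_zero_of_acyclic hV' (Nat.succ_ne_zero k) w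
    · refine (hmap_comm R (k + 1) (f' := incl (Set.inter_subset_right))
        (g' := (sndMap _ _).comp (inc (prodCover a b).V)) (by intro _; rfl) w).trans ?_
      exact hmap_eq_zero_of_acyclic hV' (Nat.succ_ne_zero k) w
  obtain ⟨z', hz'⟩ := S'.exact_inter (k + 1) w e1
    (hom_eq_zero_of_hIso_toPt hV' (Nat.succ_ne_zero k) _)
  refine ⟨z', ?_⟩
  rw [← sub_eq_zero]
  -- For the sphere both pieces of the cover are contractible, so the connecting homomorphism is
  -- injective in this degree.
  have hδ : mvδ R (sphCover (a + b)) (k + 1) (hmap R (k + 1 + 1) (smash rfl) z' - z) = 0 := by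
    rw [map_sub, mvδ_natural (prodCover a b) (sphCover (a + b)) _ (smash_mapsTo_U a b)
      (smash_mapsTo_V a b), hz', hw, sub_self]
  obtain ⟨u, v, e⟩ := S.exact_total (k + 1) _ hδ
  obtain ⟨p, hp⟩ := sphNe_origin_contractible (a + b)
  obtain ⟨p', hp'⟩ := sphNe_infty_contractible (a + b)
  have hu : u = 0 := hom_eq_zero_of_hIso_toPt (hIso_toPt hp) (Nat.succ_ne_zero _) u
  have hv : v = 0 := hom_eq_zero_of_hIso_toPt (hIso_toPt hp') (Nat.succ_ne_zero _) v
  rw [e, hu, hv, map_zero, map_zero, add_zero]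

end Spheres

/-! ### The degree of the self-maps of spheres -/

theorem wind_add_one (t : ℝ) : wind (t + 1) = wind t := by
  have hs : Real.sin (Real.pi * (t + 1)) = -Real.sin (Real.pi * t) := by
    rw [mul_add, mul_one, Real.sin_add_pi]
  have hc : Real.cos (Real.pi * (t + 1)) = -Real.cos (Real.pi * t) := by
    rw [mul_add, mul_one, Real.cos_add_pi]
  simp only [wind, hs, hc, neg_eq_zero, neg_div_neg_eq]

/-- The map of the unit interval onto the circle. -/
def windI : C(I, Sph 1) := ⟨fun t => wind t, continuous_wind.comp continuous_subtype_val⟩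

theorem windI_surjective : Function.Surjective windI := by
  intro x
  induction x using OnePoint.rec with
  | infty => exact ⟨0, wind_zero⟩
  | coe v =>
    refine ⟨unwind (v 0), (wind_unwind _).trans ?_⟩
    congr 1
    funext i
    rw [Subsingleton.elim i 0]

/-- The only ambiguity of a parameter in [0,1] is 0 against 1, and `wind` has period 1; this makes
the addition of the circle well defined. -/
theorem wind_add_eq {s s' : I} (h : wind s = wind s') (t : ℝ) : wind (s + t) = wind (s' + t) := by
  have key : ∀ s : I, s = 0 ∨ s = 1 → wind (s + t) = wind t := by
    rintro s (rfl | rfl)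
    · simp
    · rw [add_comm]; exact wind_add_one t
  by_cases h0 : wind s = ∞
  · rw [key s ((wind_eq_infty_iff s).1 h0), key s' ((wind_eq_infty_iff s').1 (h ▸ h0))]
  · obtain ⟨v, hv⟩ := OnePoint.ne_infty_iff_exists.1 h0
    rw [← unwind_of_wind_eq hv.symm, ← unwind_of_wind_eq (h.symm.trans hv.symm)]

/-- A parameter of a point of the circle. -/
def windLift (x : Sph 1) : I := Function.surjInv windI_surjective x

theorem wind_windLift (x : Sph 1) : wind (windLift x) = x := Function.surjInv_eq windI_surjective x

/-- The addition of the circle. -/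
def circleAdd : C(Sph 1 × Sph 1, Sph 1) where
  toFun p := wind (windLift p.1 + windLift p.2)
  continuous_toFun := by
    have hc : Continuous (Prod.map windI windI) := by fun_prop
    have hq : IsQuotientMap (Prod.map windI windI) :=
      hc.isClosedMap.isQuotientMap hc (windI_surjective.prodMap windI_surjective)
    rw [hq.continuous_iff]
    have : (fun p : Sph 1 × Sph 1 => wind (windLift p.1 + windLift p.2)) ∘ Prod.map windI windI =
        fun p : I × I => wind (p.1 + p.2) := by
      funext ⟨s, t⟩
      change wind (windLift (wind s) + windLift (wind t)) = wind (s + t)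
      rw [wind_add_eq (wind_windLift (wind s)), add_comm, wind_add_eq (wind_windLift (wind t)),
        add_comm]
    rw [this]
    exact continuous_wind.comp (by fun_prop)

theorem wind_add_nat (t : ℝ) (n : ℕ) : wind (t + n) = wind t := by
  induction n with
  | zero => simp
  | succ n ih => rw [Nat.cast_succ, ← add_assoc, wind_add_one, ih]

theorem wind_fract (t : ℝ) : wind (Int.fract t) = wind t := by
  have key : ∀ (z : ℤ) (t : ℝ), wind (t + z) = wind t := by
    intro z t
    rcases Int.eq_nat_or_neg z with ⟨n, rfl | rfl⟩
    · exact_mod_cast wind_add_nat t n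
    · have := wind_add_nat (t + ((-(n : ℤ) : ℤ) : ℝ)) n
      rw [← this]
      congr 1
      push_cast
      ring
  conv_rhs => rw [← Int.fract_add_floor t]
  exact (key _ _).symm

theorem circleAdd_wind (s t : ℝ) : circleAdd (wind s, wind t) = wind (s + t) := by
  have hI : ∀ s : ℝ, ∃ u : I, wind s = wind u ∧ ∃ z : ℤ, s = u + z := fun s =>
    ⟨⟨Int.fract s, Int.fract_nonneg s, (Int.fract_lt_one s).le⟩, (wind_fract s).symm, ⌊s⌋,
      (Int.fract_add_floor s).symm⟩
  obtain ⟨u, hu, z, hz⟩ := hI s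
  obtain ⟨u', hu', z', hz'⟩ := hI t
  rw [hu, hu']
  change wind (windLift (wind u) + windLift (wind u')) = _
  rw [wind_add_eq (wind_windLift (wind u)), add_comm, wind_add_eq (wind_windLift (wind u')),
    ← wind_fract, ← wind_fract (s + t)]
  congr 1
  rw [Int.fract_eq_fract]
  exact ⟨-z - z', by rw [hz, hz']; push_cast; ring⟩

/-- The degree `d` self-map of the circle. -/
def circleDeg : ℕ → C(Sph 1, Sph 1)
  | 0 => ContinuousMap.const _ ∞
  | d + 1 => circleAdd.comp ((circleDeg d).prodMk (ContinuousMap.id _))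

theorem circleDeg_wind (d : ℕ) (t : ℝ) : circleDeg d (wind t) = wind (d * t) := by
  induction d with
  | zero => simp [circleDeg]
  | succ d ih =>
    change circleAdd (circleDeg d (wind t), wind t) = _
    rw [ih, circleAdd_wind]
    congr 1
    push_cast
    ring

section Degree

variable {R : Type} [CommRing R]

/-- The first homology of a torus. -/
theorem torus_decomp {X : Type} [TopologicalSpace X] (f : C(Sph 1 × Sph 1, X))
    (z : Hom R 1 (Sph 1 × Sph 1)) : hmap R 1 f z =
    hmap R 1 (f.comp ⟨fun x => (x, ∞), by fun_prop⟩) (hmap R 1 (fstMap _ _) z) +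
    hmap R 1 (f.comp ⟨fun x => (∞, x), by fun_prop⟩) (hmap R 1 (sndMap _ _) z) := by
  obtain ⟨z', hz', e⟩ := exists_red_add 1 z
  obtain ⟨u, hu⟩ := exists_cross (R := R) (Y := Sph 1) (k := 0) (a := 1) (z := z') hz'
  rw [sph_hom_zero le_rfl u, ← cross_natural] at hu
  -- The reduced part is the cross product with a class of degree 0, which comes from the base
  -- point; so z' is carried by the first axis of the torus.
  have hz1 : z' = hmap R 1 ⟨fun x => (x, ∞), by fun_prop⟩ (hmap R 1 (fstMap _ _) z') := by
    conv_rhs => rw [← hu]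
    rw [← hu]
    rw [hmap_hmap_eq (R := R) (f := idProd (Sph 1) (ContinuousMap.const PUnit (∞ : Sph 1)))
      (g := fstMap _ _) (h := fstMap _ _) (by intro _; rfl) (0 + 1)]
    exact (hmap_hmap_eq (by intro _; rfl) (0 + 1) _).symm
  have hz2 : hmap R 1 (fstMap _ _) z = hmap R 1 (fstMap _ _) z' := by
    conv_lhs => rw [e]
    rw [map_add, hmap_hmap_eq (h := ContinuousMap.const _ ∞) (by intro _; rfl),
      hmap_eq_zero_of_const (f := ContinuousMap.const _ ∞) (fun _ => rfl) one_ne_zero, add_zero]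
  rw [hmap_comp_apply, hmap_comp_apply, hz2, ← hz1, ← map_add]
  exact congrArg _ e

/-- Circle addition is the identity on both axes, so by `torus_decomp` the map induced by a sum of
two self-maps is the sum of the induced maps. -/
theorem hmap_circleDeg (d : ℕ) (z : Hom R 1 (Sph 1)) : hmap R 1 (circleDeg d) z = (d : R) • z := by
  induction d with
  | zero => rw [hmap_eq_zero_of_const (y := ∞) (fun _ => rfl) one_ne_zero]; simp
  | succ d ih =>
    have e1 : circleAdd.comp ⟨fun x => (x, ∞), by fun_prop⟩ = ContinuousMap.id (Sph 1) := by
      ext x : 1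
      obtain ⟨t, rfl⟩ := windI_surjective x
      have := circleAdd_wind t 0
      rwa [wind_zero, add_zero] at this
    have e2 : circleAdd.comp ⟨fun x => (∞, x), by fun_prop⟩ = ContinuousMap.id (Sph 1) := by
      ext x : 1
      obtain ⟨t, rfl⟩ := windI_surjective x
      have := circleAdd_wind 0 t
      rwa [wind_zero, zero_add] at this
    rw [circleDeg, hmap_comp_apply, torus_decomp, e1, e2, hmap_id_apply, hmap_id_apply,
      hmap_hmap_eq (h := circleDeg d) (by intro _; rfl), ih, hmap_hmap_eq_self (by intro _; rfl),
      Nat.cast_succ, add_smul, one_smul]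

theorem degMap_smash (d m : ℕ) (s : Sph 1) (x : Sph m) :
    degMap d (m + 1) (smash (Nat.add_comm 1 m) (s, x)) =
      smash (Nat.add_comm 1 m) (circleDeg d s, x) := by
  obtain ⟨t, rfl⟩ := windI_surjective s
  refine (degFun_susp d m t x).trans ?_
  rw [show windI t = wind t from rfl, circleDeg_wind]

/-- The degree `d` map induces multiplication by `d`. -/
theorem hmap_degMap {d m : ℕ} (hm : 2 ≤ m) (z : Hom R m (Sph m)) :
    hmap R m (degMap d m) z = (d : R) • z := by
  obtain ⟨m, rfl⟩ : ∃ k, m = k + 1 := ⟨m - 1, by omega⟩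
  -- The factors are swapped so that the cross product is taken with S^m and naturality moves the
  -- computation to the circle, where the degree is known.
  let sm : C(Sph m × Sph 1, Sph (m + 1)) :=
    ⟨fun p => smash (Nat.add_comm 1 m) (p.2, p.1), by fun_prop⟩
  obtain ⟨w, rfl⟩ := smash_surjective (R := R) (Nat.add_comm 1 m) le_rfl (by omega) z
  have hw : hmap R (m + 1) (smash (Nat.add_comm 1 m)) w =
      hmap R (m + 1) sm (hmap R (m + 1) ⟨Prod.swap, continuous_swap⟩ w) :=
    (hmap_hmap_eq (by intro _; rfl) (m + 1) w).symm
  rw [hw]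
  generalize hmap R (m + 1) (⟨Prod.swap, continuous_swap⟩ : C(Sph 1 × Sph m, Sph m × Sph 1)) w = w
  obtain ⟨w', hw', e⟩ := exists_red_add (m + 1) w
  have h0 : hmap R (m + 1) sm w = hmap R (m + 1) sm w' := by
    rw [e, map_add, hmap_hmap_eq (h := ContinuousMap.const _ ∞)
      (by intro x; exact smash_infty_right (Nat.add_comm 1 m) _),
      hmap_eq_zero_of_const (f := ContinuousMap.const _ ∞) (fun _ => rfl) (Nat.succ_ne_zero m),
      add_zero]
  rw [h0]
  have key : ∀ K, K = 1 + m → ∀ w' : Hom R K (Sph m × Sph 1), hmap R K (sndMap _ _) w' = 0 →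
      hmap R K (idProd (Sph m) (circleDeg d)) w' = (d : R) • w' := by
    rintro K rfl w' hw'
    obtain ⟨u, rfl⟩ := exists_cross hw'
    rw [cross_natural, hmap_circleDeg, map_smul]
    rfl
  rw [hmap_comm R (m + 1) (f' := idProd (Sph m) (circleDeg d)) (g' := sm)
    (by intro p; exact degMap_smash d m p.2 p.1), key (m + 1) (Nat.add_comm m 1) w' hw', map_smul]

end Degree

/-! ### The path fibration of a sphere -/

theorem HIso.of_comp_right {R : Type} [CommRing R] {X Y Z : Type} [TopologicalSpace X]
    [TopologicalSpace Y] [TopologicalSpace Z] {f : C(X, Y)} {g : C(Y, Z)}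
    (hgf : HIso R (g.comp f)) (hf : HIso R f) : HIso R g := by
  intro k
  have h := hgf k
  rw [hmap_comp] at h
  exact (Function.Bijective.of_comp_iff _ (hf k)).1 h

theorem HIso.of_homotopic_id {R : Type} [CommRing R] {X : Type} [TopologicalSpace X] {f : C(X, X)}
    (h : f.Homotopic (ContinuousMap.id X)) : HIso R f := by
  intro k
  rw [hmap_homotopic R k h, hmap_id]
  exact Function.bijective_id

/-- The projection of the real line to the unit interval. -/
def clamp : C(ℝ, I) := ⟨Set.projIcc 0 1 zero_le_one, continuous_projIcc⟩

theorem clamp_coe (t : I) : clamp t = t := Set.projIcc_val zero_le_one t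

theorem clamp_of_nonpos {t : ℝ} (h : t ≤ 0) : clamp t = 0 := Set.projIcc_of_le_left zero_le_one h

theorem clamp_of_one_le {t : ℝ} (h : 1 ≤ t) : clamp t = 1 := Set.projIcc_of_right_le zero_le_one h

theorem clamp_of_mem {t : ℝ} (h : t ∈ I) : clamp t = ⟨t, h⟩ := Set.projIcc_of_mem zero_le_one h

/-- The space of paths in the sphere that end at the base point. -/
abbrev PathSp (m : ℕ) : Type := {g : C(I, Sph m) // g 1 = ∞}

/-- The starting point of a path. -/
def startMap (m : ℕ) : C(PathSp m, Sph m) :=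
  ⟨fun g => g.1 0, (continuous_eval_const (0 : I)).comp continuous_subtype_val⟩

/-- The lift at time u runs along the given homotopy backwards from time u to 0 and then along the
original path. The combined length 1 + u is rescaled to 1, so at u = 0 the original path is
recovered exactly. -/
theorem chp_startMap (m : ℕ) : CHP (startMap m) := by
  intro Z _ f h h0
  let G : C((Z × I) × I, Sph m) :=
    ⟨fun p => if (p.2 : ℝ) * (1 + p.1.2) ≤ p.1.2 then h (p.1.1, clamp (p.1.2 - p.2 * (1 + p.1.2)))
      else (f p.1.1).1 (clamp (p.2 * (1 + p.1.2) - p.1.2)), by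
    refine Continuous.if_le ?_ ?_ (by fun_prop) (by fun_prop) ?_
    · fun_prop
    · have : Continuous fun p : (Z × I) × I => ((f p.1.1).1 : C(I, Sph m)) :=
        continuous_subtype_val.comp (f.continuous.comp (by fun_prop))
      exact this.eval (by fun_prop)
    · intro p hp
      rw [clamp_of_nonpos (by linarith), clamp_of_nonpos (by linarith)]
      exact h0 p.1.1⟩
  have hG1 : ∀ p : Z × I, G (p, 1) = ∞ := by
    intro p
    change (if ((1 : I) : ℝ) * (1 + p.2) ≤ p.2 then _ else _) = _
    rw [if_neg (by simp), clamp_of_one_le (by simp)]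
    exact (f p.1).2
  refine ⟨⟨fun p => ⟨G.curry p, hG1 p⟩, by fun_prop⟩, fun z => ?_, fun p => ?_⟩
  · apply Subtype.ext
    ext t : 1
    change (if (t : ℝ) * (1 + ((0 : I) : ℝ)) ≤ ((0 : I) : ℝ) then _ else _) = (f z).1 t
    simp only [Set.Icc.coe_zero, add_zero, mul_one, sub_zero, zero_sub]
    split_ifs with ht
    · have : t = 0 := le_antisymm ht t.2.1
      subst this
      rw [clamp_of_nonpos (by simp)]
      exact h0 z
    · rw [clamp_coe]
  · change (if ((0 : I) : ℝ) * (1 + (p.2 : ℝ)) ≤ p.2 then _ else _) = h p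
    rw [if_pos (by simpa using p.2.2.1)]
    simp [clamp_coe]

/-- The path s ↦ g(max(u, s)) forgets the part of g before u and is constant at the end point when u
= 1. -/
theorem pathSp_contractible (m : ℕ) : ∃ p : PathSp m,
    (ContinuousMap.const _ p).Homotopic (ContinuousMap.id _) := by
  let G : C((I × PathSp m) × I, Sph m) := ⟨fun p => p.1.2.1 (p.1.1 ⊔ p.2), by
    have : Continuous fun p : (I × PathSp m) × I => (p.1.2.1 : C(I, Sph m)) := by fun_prop
    exact this.eval (by fun_prop)⟩
  have hG : ∀ p, G.curry p 1 = ∞ := by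
    intro p
    change p.2.1 (p.1 ⊔ 1) = ∞
    rw [sup_eq_right.2 (unitInterval.le_one' (t := p.1))]
    exact p.2.2
  refine ⟨⟨ContinuousMap.const _ ∞, rfl⟩, ContinuousMap.Homotopic.symm
    ⟨⟨⟨fun p => ⟨G.curry p, hG p⟩, G.curry.continuous.subtype_mk hG⟩, fun g => ?_, fun g => ?_⟩⟩⟩
  · apply Subtype.ext
    ext t : 1
    change g.1 (0 ⊔ t) = g.1 t
    rw [sup_eq_right.2 (unitInterval.nonneg' (t := t))]
  · apply Subtype.ext
    ext t : 1
    change g.1 (1 ⊔ t) = ∞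
    rw [sup_eq_left.2 (unitInterval.le_one' (t := t))]
    exact g.2

/-! ### Reparametrization of loops -/

/-- A loop as a path that ends at the base point. -/
def loopPath (m : ℕ) : C(LoopSph m, PathSp m) :=
  ⟨fun w => ⟨w.toContinuousMap, w.target⟩, continuous_induced_dom.subtype_mk _⟩

/-- A family of continuous maps as a family of loops. -/
def toLoop {Z : Type} [TopologicalSpace Z] {m : ℕ} (g : C(Z, C(I, Sph m))) (h0 : ∀ z, g z 0 = ∞)
    (h1 : ∀ z, g z 1 = ∞) : C(Z, LoopSph m) :=
  ⟨fun z => ⟨g z, h0 z, h1 z⟩, continuous_induced_rng.2 g.continuous⟩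

theorem reparam_homotopic {m : ℕ} (φ : C(I, I)) (h0 : φ 0 = 0) (h1 : φ 1 = 1)
    (A : C(LoopSph m, LoopSph m)) (hA : ∀ w s, A w s = w (φ s)) :
    A.Homotopic (ContinuousMap.id _) := by
  let G : C((I × LoopSph m) × I, Sph m) :=
    ⟨fun p => p.1.2 (clamp ((1 - p.1.1) * φ p.2 + p.1.1 * p.2)), by
      have : Continuous fun p : (I × LoopSph m) × I => p.1.2.toContinuousMap :=
        continuous_induced_dom.comp (by fun_prop)
      exact this.eval (by fun_prop)⟩
  refine ⟨⟨toLoop G.curry (fun p => ?_) (fun p => ?_), fun w => ?_, fun w => ?_⟩⟩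
  · change p.2 (clamp ((1 - p.1) * φ 0 + p.1 * (0 : I))) = ∞
    rw [h0, clamp_of_nonpos (by simp)]
    exact p.2.source
  · change p.2 (clamp ((1 - p.1) * φ 1 + p.1 * (1 : I))) = ∞
    rw [h1, clamp_of_one_le (by simp)]
    exact p.2.target
  · apply Path.ext
    funext s
    change w (clamp ((1 - (0 : I)) * φ s + (0 : I) * s)) = A w s
    rw [hA]
    simp [clamp_coe]
  · apply Path.ext
    funext s
    change w (clamp ((1 - (1 : I)) * φ s + (1 : I) * s)) = w s
    simp [clamp_coe]

theorem refl_trans_homotopic {m : ℕ} (A : C(LoopSph m, LoopSph m))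
    (hA : ∀ w, A w = (Path.refl ∞).trans w) : A.Homotopic (ContinuousMap.id _) := by
  refine reparam_homotopic (clamp.comp ⟨fun s : I => 2 * (s : ℝ) - 1, by fun_prop⟩) ?_ ?_ A ?_
  · exact clamp_of_nonpos (by simp)
  · exact clamp_of_one_le (by simp; norm_num)
  · intro w s
    change _ = w (clamp (2 * (s : ℝ) - 1))
    rw [hA, Path.trans_apply]
    split_ifs with h
    · rw [clamp_of_nonpos (by linarith)]
      exact w.source.symm
    · rw [clamp_of_mem]

theorem trans_refl_homotopic {m : ℕ} (A : C(LoopSph m, LoopSph m))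
    (hA : ∀ w, A w = w.trans (Path.refl ∞)) : A.Homotopic (ContinuousMap.id _) := by
  refine reparam_homotopic (clamp.comp ⟨fun s : I => 2 * (s : ℝ), by fun_prop⟩) ?_ ?_ A ?_
  · exact clamp_of_nonpos (by simp)
  · exact clamp_of_one_le (by simp)
  · intro w s
    change _ = w (clamp (2 * (s : ℝ)))
    rw [hA, Path.trans_apply]
    split_ifs with h
    · rw [clamp_of_mem]
    · rw [clamp_of_one_le (by linarith)]
      exact w.target.symm

/-- The action of the sphere on its loop space. -/
def muMap (m : ℕ) : C(Sph m × LoopSph (m + 1), LoopSph (m + 1)) :=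
  loopMul ((suspLoop m).comp (fstMap _ _)) (sndMap _ _)

theorem suspLoop_infty (m : ℕ) : suspLoop m ∞ = Path.refl ∞ := by
  apply Path.ext
  funext t
  exact (susp_eq_infty_iff t ∞).2 (Or.inr (Or.inr rfl))

theorem muMap_slice_homotopic (m : ℕ) :
    ((muMap m).comp (sliceMap ∞ _)).Homotopic (ContinuousMap.id _) :=
  refl_trans_homotopic _ fun w => by
    change (suspLoop m ∞).trans w = _
    rw [suspLoop_infty]

/-! ### The arcs from the base point to the points of a sphere -/

/-- These arcs join the base point continuously to the images of all points of the ball, including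
its boundary; prefixing them trivializes the fibration over the ball. -/
theorem exists_arc (m : ℕ) : ∃ A : C(Db (Eu m), C(I, Sph (m + 1))),
    ∀ t x s, A (ballMap m (t, x)) s = susp m (s * t, x) := by
  let G : C((I × Sph m) × I, Sph (m + 1)) := ⟨fun p => susp m (p.2 * p.1.1, p.1.2), by fun_prop⟩
  have compat : ∀ p p', ballMap m p = ballMap m p' → G.curry p = G.curry p' := by
    intro p p' h
    have key : ∀ q : I × Sph m, q.1 = 0 ∨ q.2 = ∞ → G.curry q = ContinuousMap.const _ ∞ := by
      rintro ⟨t, x⟩ hq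
      ext s : 1
      change susp m (s * t, x) = ∞
      rw [susp_eq_infty_iff]
      rcases hq with hq | hq
      · left
        rw [show t = 0 from hq, mul_zero]
      · exact Or.inr (Or.inr hq)
    rcases (ballMap_eq_iff p p').1 h with rfl | ⟨h1, h2⟩
    · rfl
    · rw [key p h1, key p' h2]
  have hA : ∀ p, G.curry (Function.surjInv (ballMap_surjective m) (ballMap m p)) = G.curry p :=
    fun p => compat _ _ (Function.surjInv_eq (ballMap_surjective m) _)
  refine ⟨⟨fun y => G.curry (Function.surjInv (ballMap_surjective m) y), ?_⟩, fun t x s => ?_⟩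
  · rw [(isQuotientMap_ballMap m).continuous_iff]
    convert G.curry.continuous using 1
    funext p
    exact hA p
  · exact congrArg (fun g : C(I, Sph (m + 1)) => g s) (hA (t, x))

/-- The arc from the base point to the image of a point of the ball. -/
def arc (m : ℕ) : C(Db (Eu m), C(I, Sph (m + 1))) := (exists_arc m).choose

theorem arc_ballMap {m : ℕ} (t : I) (x : Sph m) (s : I) :
    arc m (ballMap m (t, x)) s = susp m (s * t, x) := (exists_arc m).choose_spec t x s

theorem arc_zero {m : ℕ} (y : Db (Eu m)) : arc m y 0 = ∞ := by
  obtain ⟨⟨t, x⟩, rfl⟩ := ballMap_surjective m y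
  rw [arc_ballMap, zero_mul, susp_eq_infty_iff]
  exact Or.inl rfl

theorem arc_base {m : ℕ} (s : I) : arc m (ballBase m) s = ∞ := by
  rw [← ballMap_base 1, arc_ballMap, susp_eq_infty_iff]
  exact Or.inr (Or.inr rfl)

/-! ### Fibrations over mapping cones induced from the path fibration -/

namespace ConeAt

variable {X B : Type} [TopologicalSpace X] [TopologicalSpace B] {m : ℕ} (K : ConeAt X B m)
  (c : C(X, Sph (m + 1))) (hκ : ∀ p, c (K.κ p) = susp m p)

theorem c_χ (hκ : ∀ p, c (K.κ p) = susp m p) (y : Db (Eu m)) : c (K.χ y) = arc m y 1 := by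
  obtain ⟨⟨t, x⟩, rfl⟩ := ballMap_surjective m y
  rw [χ_ballMap, hκ, arc_ballMap, one_mul]

theorem c_χ_sph (hκ : ∀ p, c (K.κ p) = susp m p) (x : Sph m) : c (K.χ (ballMap m (1, x))) = ∞ := by
  rw [χ_ballMap, hκ, susp_eq_infty_iff]
  exact Or.inr (Or.inl rfl)

theorem c_f (hκ : ∀ p, c (K.κ p) = susp m p) (x : Sph m) : c (K.i (K.f x)) = ∞ := by
  rw [← K.glue, hκ, susp_eq_infty_iff]
  exact Or.inr (Or.inl rfl)

theorem c_b0 (hκ : ∀ p, c (K.κ p) = susp m p) : c (K.i K.b0) = ∞ := by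
  rw [← K.apex ∞, hκ, susp_eq_infty_iff]
  exact Or.inl rfl

/-- The total space of the induced fibration. -/
abbrev Tot : Type := Pull c (startMap (m + 1))

/-- The projection of the induced fibration. -/
abbrev totBase : C(Tot c, X) := Pull.base c (startMap (m + 1))

theorem chp_totBase : CHP (totBase c) := (chp_startMap (m + 1)).pull c

/-- The part of the total space over the ball. -/
abbrev TotD : Type := Pull K.cell.χ (totBase c)

/-- The part of the total space over the boundary of the ball. -/
def totBdry : C(Sph m × LoopSph (m + 1), Pull K.cell.χb (totBase c)) :=
  ⟨fun p => ⟨(sphHomeo m p.1, ⟨(K.i (K.f p.1), loopPath _ p.2),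
    (K.c_f c hκ p.1).trans p.2.source.symm⟩), by
      change K.χ (bdry _ (sphHomeo m p.1)) = K.i (K.f p.1)
      rw [bdry_sphHomeo, χ_ballMap, K.glue]⟩, by fun_prop⟩

/-- The loop of a point over the boundary. -/
def bdryLoop {A : Type} [TopologicalSpace A] (α : C(A, X)) (h : ∀ a, c (α a) = ∞) :
    C(Pull α (totBase c), LoopSph (m + 1)) :=
  toLoop ⟨fun p => p.1.2.1.2.1, by fun_prop⟩
    (fun p => by
      have h1 : α p.1.1 = p.1.2.1.1 := p.2
      have h2 : c p.1.2.1.1 = p.1.2.1.2.1 0 := p.1.2.2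
      change p.1.2.1.2.1 0 = ∞
      rw [← h2, ← h1, h]) (fun p => p.1.2.1.2.2)

theorem hIso_totBdry {R : Type} [CommRing R] : HIso R (K.totBdry c hκ) := by
  have h : ∀ a, c (K.cell.χb a) = ∞ := by
    intro a
    obtain ⟨x, rfl⟩ := (sphHomeo m).surjective a
    exact K.c_χ_sph c hκ x
  refine HIso.of_inverse ((⟨fun p => (sphHomeo m).symm p.1.1, by fun_prop⟩ :
    C(Pull K.cell.χb (totBase c), Sph m)).prodMk (bdryLoop c K.cell.χb h)) ?_ ?_
  · rintro ⟨x, w⟩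
    exact Prod.ext ((sphHomeo m).symm_apply_apply x) rfl
  · rintro ⟨⟨a, ⟨⟨x, g⟩, h2⟩⟩, h1⟩
    apply Subtype.ext
    refine Prod.ext ((sphHomeo m).apply_symm_apply a) (Subtype.ext (Prod.ext ?_ rfl))
    obtain ⟨y, rfl⟩ := (sphHomeo m).surjective a
    change K.i (K.f ((sphHomeo m).symm (sphHomeo m y))) = x
    rw [Homeomorph.symm_apply_apply, ← K.glue, ← K.χ_ballMap, ← bdry_sphHomeo]
    exact h1

variable (hi : ∀ b, c (K.i b) = ∞)

/-- The part of the total space over `B`. -/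
def totB : C(B × LoopSph (m + 1), Pull K.cell.i (totBase c)) :=
  ⟨fun p => ⟨(p.1, ⟨(K.i p.1, loopPath _ p.2), (hi p.1).trans p.2.source.symm⟩), rfl⟩, by fun_prop⟩

theorem hIso_totB {R : Type} [CommRing R] : HIso R (K.totB c hi) := by
  refine HIso.of_inverse ((Pull.base _ _).prodMk (bdryLoop c K.cell.i hi)) (fun _ => rfl) ?_
  rintro ⟨⟨a, ⟨⟨x, g⟩, h2⟩⟩, h1⟩
  exact Subtype.ext (Prod.ext rfl (Subtype.ext (Prod.ext h1 rfl)))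

/-- The inclusion of the part over the boundary in the part over the ball. -/
def toDisk : C(Sph m × LoopSph (m + 1), K.TotD c) := (K.cell.toD (totBase c)).comp (K.totBdry c hκ)

/-- The inclusion of the part over `B` in the total space. -/
def fromB : C(B × LoopSph (m + 1), Tot c) := (Pull.top K.cell.i (totBase c)).comp (K.totB c hi)

/-- Over `B` and over the boundary sphere c is constant at the base point, so the fibres there are
loops and the parts are products with the loop space. -/
theorem totSquare {R : Type} [CommRing R] : ∃ δ, MVSquare R
    (K.f.prodMap (ContinuousMap.id (LoopSph (m + 1)))) (K.toDisk c hκ) (K.fromB c hi)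
    (Pull.top K.cell.χ (totBase c)) δ := by
  have S := K.cell.mvSquare (R := R) (chp_totBase c)
  refine ⟨_, S.pull (b := ContinuousMap.id _) (K.hIso_totBdry c hκ) (K.hIso_totB c hi)
    (HIso.of_inverse (ContinuousMap.id _) (fun _ => rfl) (fun _ => rfl)) ?_ rfl rfl rfl⟩
  ext p : 1
  apply Subtype.ext
  refine Prod.ext ?_ rfl
  exact (congrArg K.f ((sphHomeo m).symm_apply_apply p.1)).symm

/-- The identification of the part over the ball with the loop space. -/
def diskLoop : C(K.TotD c, LoopSph (m + 1)) where
  toFun p := Path.trans (y := arc m p.1.1 1) ⟨arc m p.1.1, arc_zero _, rfl⟩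
    ⟨p.1.2.1.2.1, by
      have h1 : K.χ p.1.1 = p.1.2.1.1 := p.2
      have h2 : c p.1.2.1.1 = p.1.2.1.2.1 0 := p.1.2.2
      rw [← K.c_χ c hκ, h1, h2]; rfl, p.1.2.1.2.2⟩
  continuous_toFun := by
    apply Path.continuous_uncurry_iff.1
    refine Path.trans_continuous_family _ ?_ _ ?_
    · have : Continuous fun p : K.TotD c × I => arc m p.1.1.1 := by fun_prop
      exact this.eval continuous_snd
    · have : Continuous fun p : K.TotD c × I => p.1.1.2.1.2.1 := by fun_prop
      exact this.eval continuous_snd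

/-- At a boundary point the arc is already the closed loop `suspLoop m x`, so the attaching map of
the fibration is multiplication by a letter. -/
theorem diskLoop_toDisk (p : Sph m × LoopSph (m + 1)) :
    K.diskLoop c hκ (K.toDisk c hκ p) = muMap m p := by
  apply Path.ext
  funext s
  refine (Path.trans_apply _ _ s).trans (Eq.trans ?_ (Path.trans_apply _ _ s).symm)
  split_ifs with h
  · change arc m (bdry _ (sphHomeo m p.1)) _ = susp m (_, p.1)
    rw [bdry_sphHomeo, arc_ballMap, mul_one]
  · rfl

/-- The fibre over the base point of the ball has the homology of the whole part, since the
contraction of the ball fixes that point. On this fibre the prefixed arc is constant, so the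
composite is homotopic to the identity. -/
theorem hIso_diskLoop {R : Type} [CommRing R] : HIso R (K.diskLoop c hκ) := by
  let j : C(LoopSph (m + 1), K.TotD c) := ⟨fun w => ⟨(ballBase m, ⟨(K.i K.b0, loopPath _ w),
    (K.c_b0 c hκ).trans w.source.symm⟩), K.χ_base⟩, by fun_prop⟩
  have hj : HIso R j := by
    have hp := (chp_totBase c).pull K.cell.χ
    have hAU : {ballBase m} ⊆ (Set.univ : Set (Db (Eu m))) := Set.subset_univ _
    have h1 := hp.hIso_incl (R := R) hAU
      ((ballContract m).comp ((inc _).prodMap (ContinuousMap.id I)))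
      (fun u => ballContract_zero _) (fun _ => trivial) (fun u => ballContract_one _) (by
        rintro ⟨⟨y, hy⟩, t⟩ h
        have : y = ballBase m := h
        subst this
        exact ballContract_base t)
    have h2 : HIso R (inc (Pull.base K.cell.χ (totBase c) ⁻¹' Set.univ)) :=
      HIso.of_inverse ⟨fun p => ⟨p, trivial⟩, by fun_prop⟩ (fun _ => rfl) (fun _ => rfl)
    have h3 : HIso R (⟨fun w => ⟨j w, rfl⟩, by fun_prop⟩ : C(LoopSph (m + 1),
        Pull.base K.cell.χ (totBase c) ⁻¹' {ballBase m})) := by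
      have e0 : ∀ p : Pull.base K.cell.χ (totBase c) ⁻¹' {ballBase m},
          c (K.cell.χ p.1.1.1) = ∞ := by
        intro p
        have h : p.1.1.1 = ballBase m := p.2
        rw [h]
        exact (congrArg c K.χ_base).trans (K.c_b0 c hκ)
      refine HIso.of_inverse (toLoop ⟨fun p => p.1.1.2.1.2.1, by fun_prop⟩ (fun p => ?_)
        (fun p => p.1.1.2.1.2.2)) (fun _ => rfl) ?_
      · have h1 : K.cell.χ p.1.1.1 = p.1.1.2.1.1 := p.1.2
        have h2 : c p.1.1.2.1.1 = p.1.1.2.1.2.1 0 := p.1.1.2.2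
        change p.1.1.2.1.2.1 0 = ∞
        rw [← h2, ← h1, e0]
      · rintro ⟨⟨⟨y, ⟨⟨x, g⟩, h2⟩⟩, h1⟩, h⟩
        have : y = ballBase m := h
        subst this
        exact Subtype.ext (Subtype.ext (Prod.ext rfl (Subtype.ext (Prod.ext
          (K.χ_base.symm.trans h1) rfl))))
    exact HIso.of_comp h2 (HIso.of_comp (h := ⟨fun w => ⟨j w, trivial⟩, by fun_prop⟩) h1 h3
      (fun _ => rfl)) (fun _ => rfl)
  refine HIso.of_comp_right (f := j) (HIso.of_homotopic_id (refl_trans_homotopic _ fun w => ?_)) hj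
  apply Path.ext
  funext s
  refine (Path.trans_apply _ _ s).trans (Eq.trans ?_ (Path.trans_apply _ _ s).symm)
  split_ifs with h
  · exact arc_base _
  · rfl

end ConeAt

/-! ### The homology of the loop space of a sphere -/

section Loops

variable {R : Type} [CommRing R] {m : ℕ}

theorem hIso_toPt_tot (m : ℕ) :
    HIso R (toPt (ConeAt.Tot (ContinuousMap.id (Sph (m + 1))))) := by
  obtain ⟨p, hp⟩ := pathSp_contractible (m + 1)
  refine HIso.of_comp (f := ⟨fun z => z.1.2, by fun_prop⟩) (hIso_toPt (R := R) hp) ?_ (fun _ => rfl)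
  refine HIso.of_inverse ⟨fun g => ⟨(startMap _ g, g), rfl⟩, by fun_prop⟩ ?_ (fun _ => rfl)
  rintro ⟨⟨x, g⟩, h⟩
  exact Subtype.ext (Prod.ext h.symm rfl)

theorem hmap_snd_prodMap {A B Y : Type} [TopologicalSpace A] [TopologicalSpace B]
    [TopologicalSpace Y] (f : C(A, B)) (k : ℕ) (z : Hom R k (A × Y)) :
    hmap R k (sndMap B Y) (hmap R k (f.prodMap (ContinuousMap.id Y)) z) =
      hmap R k (sndMap A Y) z := hmap_hmap_eq (by intro _; rfl) k z

theorem hIso_snd_pt (Y : Type) [TopologicalSpace Y] : HIso R (sndMap PUnit Y) :=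
  HIso.of_inverse ⟨fun y => (PUnit.unit, y), by fun_prop⟩ (fun _ => rfl) (fun _ => rfl)

theorem hmap_diskLoop_toDisk {X B : Type} [TopologicalSpace X] [TopologicalSpace B]
    (K : ConeAt X B m) (c : C(X, Sph (m + 1))) (hκ : ∀ p, c (K.κ p) = susp m p) (k : ℕ)
    (z : Hom R k (Sph m × LoopSph (m + 1))) :
    hmap R k (K.diskLoop c hκ) (hmap R k (K.toDisk c hκ) z) = hmap R k (muMap m) z :=
  hmap_hmap_eq (K.diskLoop_toDisk c hκ) k z

theorem id_κ (p : I × Sph m) : ContinuousMap.id _ ((coneSph m).κ p) = susp m p := rfl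

theorem id_i (b : PUnit) : ContinuousMap.id _ ((coneSph m).i b) = ∞ := rfl

/-- A class killed by both maps is a connecting class from the total space over S^(m+1), which is
contractible. -/
theorem muMap_injective {k : ℕ} {z : Hom R k (Sph m × LoopSph (m + 1))}
    (h1 : hmap R k (sndMap _ _) z = 0) (h2 : hmap R k (muMap m) z = 0) : z = 0 := by
  obtain ⟨δ, S⟩ := (coneSph m).totSquare (R := R) (ContinuousMap.id _) id_κ id_i
  obtain ⟨y, rfl⟩ := S.exact_inter k z
    ((hIso_snd_pt _ k).1 (by rw [hmap_snd_prodMap, h1, map_zero]))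
    (((coneSph m).hIso_diskLoop _ id_κ k).1 (by rw [hmap_diskLoop_toDisk, h2, map_zero]))
  rw [hom_eq_zero_of_hIso_toPt (hIso_toPt_tot m) (Nat.succ_ne_zero k) y, map_zero]

/-- In positive degrees a class over the ball dies in the contractible total space; exactness lifts
it to a class of S^m × Ω with zero component over the point. -/
theorem muMap_surjective {k : ℕ} (hk : k ≠ 0) (y : Hom R k (LoopSph (m + 1))) :
    ∃ z, hmap R k (sndMap (Sph m) _) z = 0 ∧ hmap R k (muMap m) z = y := by
  obtain ⟨δ, S⟩ := (coneSph m).totSquare (R := R) (ContinuousMap.id _) id_κ id_i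
  obtain ⟨v, rfl⟩ := ((coneSph m).hIso_diskLoop (R := R) (ContinuousMap.id _) id_κ k).2 y
  obtain ⟨w, h1, h2⟩ := S.exact_sum k 0 v (by
    rw [map_zero, hom_eq_zero_of_hIso_toPt (hIso_toPt_tot m) hk (hmap R k _ v)])
  refine ⟨w, ?_, ?_⟩
  · rw [← hmap_snd_prodMap (coneSph m).f, h1, map_zero]
  · rw [← hmap_diskLoop_toDisk (coneSph m) (ContinuousMap.id _) id_κ, h2]

theorem hmap_muMap_slice (k : ℕ) (y : Hom R k (LoopSph (m + 1))) :
    hmap R k (muMap m) (hmap R k (sliceMap ∞ _) y) = y := by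
  rw [← hmap_comp_apply, hmap_congr_homotopic (muMap_slice_homotopic m), hmap_id_apply]

/-- This is connectedness of the loop space in homological form. The augmentation-zero part z0 lifts
to a class of S^m × Ω projecting to z0 and killed by `muMap`; as 0 < m, that class lies on the slice
at ∞, where `muMap` is the identity in homology, so z0 = 0. -/
theorem loop_hom_zero (hm : 1 ≤ m) (z : Hom R 0 (LoopSph (m + 1))) :
    z = hmap R 0 (ContinuousMap.const _ (Path.refl ∞)) (hmap R 0 (toPt _) z) := by
  obtain ⟨δ, S⟩ := (coneSph m).totSquare (R := R) (ContinuousMap.id _) id_κ id_i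
  rw [← sub_eq_zero]
  set z0 := z - hmap R 0 (ContinuousMap.const _ (Path.refl ∞)) (hmap R 0 (toPt _) z) with hz0
  have h0 : hmap R 0 (toPt _) z0 = 0 := by
    rw [hz0, map_sub, hmap_hmap_eq_self (by intro _; rfl), sub_self]
  obtain ⟨w, h1, h2⟩ := S.exact_sum 0 (hmap R 0 (sliceMap PUnit.unit _) z0) 0 (by
    rw [map_zero]
    apply (hIso_toPt_tot m 0).1
    rw [map_zero, hmap_hmap_eq (h := toPt _) (by intro _; rfl),
      hmap_hmap_eq (h := toPt _) (by intro _; rfl), h0])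
  have h3 : hmap R 0 (sndMap _ _) w = z0 := by
    rw [← hmap_snd_prodMap (coneSph m).f, h1, hmap_hmap_eq_self (by intro _; rfl)]
  obtain ⟨w', hw', e⟩ := exists_red_add 0 w
  rw [eq_zero_of_lt m 0 hm w' hw', zero_add, h3] at e
  have h4 : hmap R 0 (muMap m) w = 0 := by
    rw [← hmap_diskLoop_toDisk (coneSph m) (ContinuousMap.id _) id_κ, h2, map_zero]
  rw [e, hmap_muMap_slice] at h4
  exact h4

end Loops

/-! ### The homology of the fibre of the pinch map -/

section Fiber

variable {R : Type} [CommRing R] {d m : ℕ}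

/-- The fibre of the pinch map as a total space over the Moore space. -/
def toFiber (d m : ℕ) : C(ConeAt.Tot (Moore.pinch d m), PinchFiber d m) :=
  ⟨fun z => ⟨(z.1.1, z.1.2.1), z.2.symm, z.1.2.2⟩, by fun_prop⟩

theorem hIso_toFiber : HIso R (toFiber d m) := by
  refine HIso.of_inverse ⟨fun z => ⟨(z.1.1, ⟨z.1.2, z.2.2⟩), z.2.1.symm⟩, ?_⟩ (fun _ => rfl)
    (fun _ => rfl)
  have : Continuous (fun z : PinchFiber d m => z.1) := continuous_subtype_val
  exact Continuous.subtype_mk ((continuous_fst.comp this).prodMk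
    ((continuous_snd.comp this).subtype_mk _)) _

theorem pinch_κ (p : I × Sph m) : Moore.pinch d m ((coneMoore d m).κ p) = susp m p := rfl

theorem pinch_i (x : Sph m) : Moore.pinch d m ((coneMoore d m).i x) = ∞ := rfl

theorem toFiber_fromB (p : Sph m × LoopSph (m + 1)) :
    toFiber d m ((coneMoore d m).fromB _ pinch_i p) = PinchFiber.ofProd d m p := rfl

/-- The homology of the fibre comes from the reduced homology of the product of a sphere and a
loop space. -/
theorem fiber_surjective {k : ℕ} (hk : k ≠ 0) (z : Hom R k (PinchFiber d m)) :
    ∃ u, hmap R k (sndMap (Sph m) _) u = 0 ∧ hmap R k (PinchFiber.ofProd d m) u = z := by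
  obtain ⟨k, rfl⟩ := Nat.exists_eq_succ_of_ne_zero hk
  obtain ⟨δ, S⟩ := (coneMoore d m).totSquare (R := R) (Moore.pinch d m) pinch_κ pinch_i
  have hD := (coneMoore d m).hIso_diskLoop (R := R) (Moore.pinch d m) pinch_κ
  obtain ⟨z, rfl⟩ := (hIso_toFiber (R := R) (d := d) (m := m) (k + 1)).2 z
  -- A connecting class is killed by the projection and by the multiplication, hence vanishes; the
  -- sequence of the fibre therefore splits into short pieces.
  have hw : δ k z = 0 := by
    refine muMap_injective ?_ ?_
    · rw [← hmap_snd_prodMap (coneMoore d m).f, S.left_δ, map_zero]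
    · rw [← hmap_diskLoop_toDisk (coneMoore d m) (Moore.pinch d m) pinch_κ, S.right_δ, map_zero]
  obtain ⟨u, v, rfl⟩ := S.exact_total k z hw
  -- Classes over the ball contribute nothing new: each equals a multiplication image of a reduced
  -- class of the boundary part, which can be moved across the square to S^m × Ω.
  have key : ∀ v : Hom R (k + 1) ((coneMoore d m).TotD (Moore.pinch d m)), ∃ u,
      hmap R (k + 1) (sndMap (Sph m) _) u = 0 ∧ hmap R (k + 1) (Pull.top _ _) v =
        hmap R (k + 1) ((coneMoore d m).fromB _ pinch_i) u := by
    intro v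
    obtain ⟨w, h1, h2⟩ := muMap_surjective (Nat.succ_ne_zero k)
      (hmap R (k + 1) ((coneMoore d m).diskLoop (Moore.pinch d m) pinch_κ) v)
    refine ⟨hmap R (k + 1) ((coneMoore d m).f.prodMap (ContinuousMap.id _)) w, ?_, ?_⟩
    · rw [hmap_snd_prodMap, h1]
    · rw [← hmap_diskLoop_toDisk (coneMoore d m) (Moore.pinch d m) pinch_κ] at h2
      rw [S.comm, (hD (k + 1)).1 h2]
  obtain ⟨u1, hu1, e1⟩ := key v
  obtain ⟨u2, hu2, e2⟩ := exists_red_add (k + 1) u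
  -- The slice part of u also passes through the ball, because the degree map fixes ∞; by `key` it
  -- can be replaced by a reduced class.
  obtain ⟨u3, hu3, e3⟩ := key (hmap R (k + 1) ((coneMoore d m).toDisk (Moore.pinch d m) pinch_κ)
    (hmap R (k + 1) (sliceMap ∞ _) (hmap R (k + 1) (sndMap _ _) u)))
  rw [← S.comm, hmap_hmap_eq (f := sliceMap (∞ : Sph m) (LoopSph (m + 1)))
    (g := (coneMoore d m).f.prodMap (ContinuousMap.id _)) (h := sliceMap ∞ _)
    (by intro w; exact Prod.ext (degMap_infty (d := d) (m := m)) rfl)] at e3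
  refine ⟨u2 + u3 + u1, by rw [map_add, map_add, hu1, hu2, hu3, add_zero, add_zero], ?_⟩
  rw [← hmap_hmap_eq toFiber_fromB]
  congr 1
  rw [map_add, map_add, ← e1, ← e3, ← map_add, ← e2]

/-- By exactness u is the image under the degree map of a class that dies over the ball; that class
is killed by the projection and by `muMap`, so it is zero. -/
theorem fiber_injective {k : ℕ} {u : Hom R k (Sph m × LoopSph (m + 1))}
    (h1 : hmap R k (sndMap _ _) u = 0) (h2 : hmap R k (PinchFiber.ofProd d m) u = 0) : u = 0 := by
  obtain ⟨δ, S⟩ := (coneMoore d m).totSquare (R := R) (Moore.pinch d m) pinch_κ pinch_i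
  rw [← hmap_hmap_eq toFiber_fromB] at h2
  have h3 := (hIso_toFiber (R := R) (d := d) (m := m) k).1 (h2.trans (map_zero _).symm)
  obtain ⟨w, hw1, hw2⟩ := S.exact_sum k u 0 (by rw [h3, map_zero])
  have hw : w = 0 := by
    refine muMap_injective ?_ ?_
    · rw [← hmap_snd_prodMap (coneMoore d m).f, hw1, h1]
    · rw [← hmap_diskLoop_toDisk (coneMoore d m) (Moore.pinch d m) pinch_κ, hw2, map_zero]
  rw [← hw1, hw, map_zero]

/-- The kernel of the inclusion of the bottom cell of a Moore space in homology. -/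
theorem exists_deg_of_incl_eq_zero {k : ℕ} {s : Hom R k (Sph m)}
    (h : hmap R k (Moore.incl d m) s = 0) : ∃ w, hmap R k (degMap d m) w = s := by
  have S := (coneMoore d m).cell.mvSquare (R := R) (CHP.id (X := Moore d m))
  let e : C(Sph m, Pull (coneMoore d m).cell.i (ContinuousMap.id (Moore d m))) :=
    ⟨fun x => ⟨(x, Moore.incl d m x), rfl⟩, by fun_prop⟩
  obtain ⟨w, hw, -⟩ := S.exact_sum k (hmap R k e s) 0 (by
    rw [map_zero, hmap_hmap_eq (h := Moore.incl d m) (by intro _; rfl), h])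
  refine ⟨hmap R k ⟨fun p => (sphHomeo m).symm p.1.1, by fun_prop⟩ w, ?_⟩
  have h1 := congrArg (hmap R k (Pull.base _ _)) hw
  rw [hmap_hmap_eq_self (by intro _; rfl)] at h1
  rw [← h1]
  exact hmap_comm R k (by intro _; rfl) w

/-- The homology of the fibre in the dimension of the sphere. -/
theorem fiber_fundamental (hm : 1 ≤ m) {s : Hom R m (Sph m)} (hs : ∀ z, ∃ r : R, z = r • s)
    (hs0 : ∀ r : R, r • s = 0 → r = 0) : ∃ u : Hom R m (PinchFiber d m),
    hmap R m (PinchFiber.proj d m) u = hmap R m (Moore.incl d m) s ∧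
    (∀ z, ∃ r : R, z = r • u) ∧ ∀ r : R, r • u = 0 → r = 0 := by
  let j : C(Sph m, Sph m × LoopSph (m + 1)) := ⟨fun x => (x, Path.refl ∞), by fun_prop⟩
  refine ⟨hmap R m (PinchFiber.ofProd d m) (hmap R m j s), ?_, fun z => ?_, fun r hr => ?_⟩
  · rw [hmap_hmap_eq (f := PinchFiber.ofProd d m) (h := (Moore.incl d m).comp (fstMap _ _))
      (by intro _; rfl), hmap_hmap_eq (h := Moore.incl d m) (by intro _; rfl)]
  · obtain ⟨u, hu, rfl⟩ := fiber_surjective (by omega) z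
    have key : ∀ K, K = 0 + m → ∀ u : Hom R K (Sph m × LoopSph (m + 1)),
        hmap R K (sndMap _ _) u = 0 → ∃ w, u = hmap R K j w := by
      rintro K rfl u hu
      obtain ⟨v, rfl⟩ := exists_cross hu
      refine ⟨hmap R _ (fstMap _ _) (cross R 0 m PUnit (hmap R 0 (toPt _) v)).1, ?_⟩
      conv_lhs => rw [loop_hom_zero hm v, ← cross_natural]
      exact (hmap_hmap_eq (by intro _; rfl) _ _).symm
    obtain ⟨w, rfl⟩ := key m (Nat.zero_add m).symm u hu
    obtain ⟨r, rfl⟩ := hs w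
    exact ⟨r, by simp only [map_smul]⟩
  · rw [← map_smul, ← map_smul] at hr
    have h1 := fiber_injective (by
      rw [hmap_hmap_eq (h := ContinuousMap.const _ (Path.refl ∞)) (by intro _; rfl)]
      exact hmap_eq_zero_of_const (fun _ => rfl) (by omega) _) hr
    refine hs0 r ?_
    rw [← hmap_hmap_eq_self (f := j) (g := fstMap _ _) (by intro _; rfl) m (r • s), h1, map_zero]

end Fiber

/-! ### The classes detected by the James-Hopf invariant -/

theorem append_eq_dite {a b : ℕ} (v : Fin a → ℝ) (w : Fin b → ℝ) (i : Fin (a + b)) :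
    Fin.append v w i = if h : (i : ℕ) < a then v ⟨i, h⟩ else w ⟨i - a, by omega⟩ := by
  refine Fin.addCases (fun j => ?_) (fun j => ?_) i
  · rw [Fin.append_left, dif_pos (by simp)]
    rfl
  · rw [Fin.append_right, dif_neg (by simp)]
    congr 1
    ext
    simp

/-- On a loop s ↦ s ∧ y the collapse is u ∧ t ↦ u ∧ (t ∧ y), so only associativity of the smash
product, read in coordinates, is involved. -/
theorem collapse_suspLoop {a m c : ℕ} (ha : 0 < a) (h : a + m = c) (x : Sph a) (y : Sph m) :
    collapse ha h (x, suspLoop m y) = smash h (x, y) := by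
  induction x using OnePoint.rec with
  | infty => rfl
  | coe v =>
    change smash (a := a - 1) (b := m + 1) (by omega)
      (((fun i => v ⟨i, by omega⟩ : Fin (a - 1) → ℝ) : Sph (a - 1)),
        smash (Nat.add_comm 1 m) (wind (unwind (v ⟨a - 1, by omega⟩)), y)) = _
    induction y using OnePoint.rec with
    | infty => rw [smash_infty_right, smash_infty_right, smash_infty_right]
    | coe w =>
      rw [wind_unwind]
      change ((_ : Fin c → ℝ) : Sph c) = ((_ : Fin c → ℝ) : Sph c)
      congr 1
      funext i
      simp only [Function.comp, append_eq_dite, Fin.val_cast]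
      split_ifs with h1 h2 h2 h3 h3
      · rfl
      · omega
      · congr 1; ext; simp; omega
      · omega
      · omega
      · congr 1; ext; simp; omega

/-! ### Words of letters and their homology classes. -/

/-- The product of the letters of a word. -/
def wordMap (m j : ℕ) : C(Fin j → Sph m, LoopSph (m + 1)) :=
  loopProd (List.ofFn fun i : Fin j =>
    ((suspLoop m).comp ⟨fun x : Fin j → Sph m => x i, continuous_apply i⟩))

theorem loopProd_comp {Y Z : Type} [TopologicalSpace Y] [TopologicalSpace Z] {m : ℕ}
    (l : List C(Y, LoopSph m)) (f : C(Z, Y)) :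
    (loopProd l).comp f = loopProd (l.map fun g => g.comp f) := by
  induction l with
  | nil => rfl
  | cons g l ih =>
    change (loopMul g (loopProd l)).comp f = loopMul (g.comp f) (loopProd (l.map fun g => g.comp f))
    rw [← ih]
    rfl

/-- Adding a letter to a word. -/
def consMap (m j : ℕ) : C(Sph m × (Fin j → Sph m), Fin (j + 1) → Sph m) :=
  ⟨fun p => Fin.cons p.1 p.2, by
    refine continuous_pi fun i => ?_
    refine Fin.cases ?_ (fun k => ?_) i
    · exact continuous_fst
    · exact (continuous_apply k).comp continuous_snd⟩

theorem wordMap_cons (m j : ℕ) :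
    (wordMap m (j + 1)).comp (consMap m j) = (muMap m).comp (idProd _ (wordMap m j)) := by
  rw [wordMap, List.ofFn_succ, loopProd_comp]
  have e : (muMap m).comp (idProd _ (wordMap m j)) = loopMul ((suspLoop m).comp (fstMap _ _))
      ((wordMap m j).comp (sndMap _ _)) := rfl
  rw [e, wordMap, loopProd_comp, List.map_cons, List.map_ofFn, List.map_ofFn]
  rfl

theorem smashPow_cons {m j K M : ℕ} (h : j * m = K) (h' : (j + 1) * m = M) (h'' : m + K = M)
    (x : Sph m) (y : Fin j → Sph m) :
    smashPow h' (consMap m j (x, y)) = smash h'' (x, smashPow h y) := by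
  change smashPowFun h' (Fin.cons x y : Fin (j + 1) → Sph m) = smash h'' (x, smashPowFun h y)
  induction x using OnePoint.rec with
  | infty => exact smashPowFun_of_eq_infty h' (i := 0) rfl
  | coe v =>
    by_cases hy : ∃ i, y i = ∞
    · obtain ⟨i, hi⟩ := hy
      rw [smashPowFun_of_eq_infty h' (i := i.succ) (by simpa using hi),
        smashPowFun_of_eq_infty h hi, smash_infty_right]
    · push Not at hy
      choose w hw using fun i => OnePoint.ne_infty_iff_exists.1 (hy i)
      obtain rfl : y = fun i => ((w i : Fin m → ℝ) : Sph m) := funext fun i => (hw i).symm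
      have e : (Fin.cons (v : Sph m) (fun i => ((w i : Fin m → ℝ) : Sph m)) : Fin (j + 1) → Sph m) =
          fun i => (((Fin.cons v w : Fin (j + 1) → Fin m → ℝ) i : Fin m → ℝ) : Sph m) := by
        funext i
        refine Fin.cases rfl (fun k => rfl) i
      rw [e, smashPowFun_coe, smashPowFun_coe]
      change _ = ((_ : Fin M → ℝ) : Sph M)
      congr 1
      funext i
      -- `finProdFinEquiv` lists coordinates block by block, so the first letter occupies the
      -- positions below m and the rest are shifted by m.
      simp only [Function.comp, append_eq_dite, Fin.val_cast, finProdFinEquiv_symm_apply]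
      have hi := i.2
      have hm : 0 < m := by
        rcases Nat.eq_zero_or_pos m with rfl | hm
        · simp at h'; omega
        · exact hm
      split_ifs with h1
      · have e1 : (Fin.cast h'.symm i).divNat = 0 := by
          ext; simp [Fin.divNat, Nat.div_eq_of_lt h1]
        rw [e1, Fin.cons_zero]
        congr 1
        ext; simp [Fin.modNat, Nat.mod_eq_of_lt h1]
      · obtain ⟨t, ht⟩ : ∃ t, (i : ℕ) = m + t := ⟨i - m, by omega⟩
        have e1 : (Fin.cast h'.symm i).divNat =
            (Fin.cast h.symm (⟨i - m, by omega⟩ : Fin K)).divNat.succ := by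
          ext; simp [Fin.divNat, ht, Nat.add_div_left t hm]
        rw [e1, Fin.cons_succ]
        congr 1
        ext; simp [Fin.modNat, ht]

section Classes

variable {R : Type} [CommRing R]

/-- The map that detects the classes of words. -/
def detect {m j K M : ℕ} (h : j * m = K) (h'' : m + K = M) : C(Sph m × (Fin j → Sph m), Sph M) :=
  (smash h'').comp (idProd _ (smashPow h))

theorem hmap_smash_slice {a b c k : ℕ} (h : a + b = c) (hk : k ≠ 0) (y : Hom R k (Sph b)) :
    hmap R k (smash h) (hmap R k (sliceMap ∞ _) y) = 0 := by
  rw [hmap_hmap_eq (f := sliceMap ∞ _) (g := smash h) (h := ContinuousMap.const _ ∞)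
    (by intro _; rfl)]
  exact hmap_eq_zero_of_const (fun _ => rfl) hk _

theorem hmap_detect_slice {m j K M k : ℕ} (h : j * m = K) (h'' : m + K = M) (hk : k ≠ 0)
    (y : Hom R k (Fin j → Sph m)) :
    hmap R k (detect h h'') (hmap R k (sliceMap ∞ _) y) = 0 := by
  rw [hmap_hmap_eq (f := sliceMap ∞ _) (g := detect h h'') (h := ContinuousMap.const _ ∞)
    (by intro _; rfl)]
  exact hmap_eq_zero_of_const (fun _ => rfl) hk _

theorem exists_section_detect_zero {m M : ℕ} (h : 0 * m = 0) (h'' : m + 0 = M) :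
    ∃ s : C(Sph M, Sph m × (Fin 0 → Sph m)), ∀ x, detect h h'' (s x) = x := by
  subst h''
  refine ⟨⟨fun x => (x, Fin.elim0), by fun_prop⟩, fun x => ?_⟩
  change smash rfl (x, smashPowFun h Fin.elim0) = x
  have e : (Fin.elim0 : Fin 0 → Sph m) =
      fun i => (((Fin.elim0 : Fin 0 → Fin m → ℝ) i : Fin m → ℝ) : Sph m) := funext (Fin.elim0 ·)
  rw [e, smashPowFun_coe]
  induction x using OnePoint.rec with
  | infty => rfl
  | coe v =>
    change ((_ : Fin m → ℝ) : Sph m) = v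
    congr 1
    funext i
    simp only [Function.comp, append_eq_dite]
    rw [dif_pos (by simp)]
    rfl

/-- One class ζ serves two purposes: its word product generates the homology of the loop space in
degree jm, and its smash with [S^m] generates the top homology of the sphere. The inductive step
crosses ζ with [S^m] and adds a letter, using surjectivity of `muMap` for the first claim and of the
smash map for the second. Generation suffices; freeness of the loop classes is not needed. -/
theorem exists_wordClass {m : ℕ} (hm : 1 ≤ m) (j : ℕ) : ∀ (K : ℕ) (h : j * m = K)
    (h'' : m + K = K + m), ∃ ζ : Hom R K (Fin j → Sph m),
    (∀ z, ∃ r : R, z = r • hmap R K (wordMap m j) ζ) ∧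
    ∀ z, ∃ r : R, z = r • hmap R (K + m) (detect h h'') (cross R K m _ ζ).1 := by
  induction j with
  | zero =>
    intro K h h''
    obtain rfl : K = 0 := by rw [← h, Nat.zero_mul]
    let pt : C(PUnit, Fin 0 → Sph m) := ContinuousMap.const _ Fin.elim0
    refine ⟨hmap R 0 pt (ptClass R), fun z => ?_, fun z => ?_⟩
    · obtain ⟨r, hr⟩ := exists_smul_ptClass (hmap R 0 (toPt _) z)
      refine ⟨r, ?_⟩
      conv_lhs => rw [loop_hom_zero hm z, hr, map_smul]
      rw [hmap_hmap_eq (f := pt) (g := wordMap m 0) (h := ContinuousMap.const _ (Path.refl ∞))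
        (by intro _; rfl)]
    · obtain ⟨s, hs⟩ := exists_section_detect_zero h h''
      obtain ⟨w', hw', e⟩ := exists_red_add (0 + m) (hmap R (0 + m) s z)
      obtain ⟨u, rfl⟩ := exists_cross hw'
      obtain ⟨r, hr⟩ := exists_smul_ptClass (hmap R 0 (toPt _) u)
      have hu : u = r • hmap R 0 pt (ptClass R) := by
        rw [← map_smul, ← hr, hmap_hmap_eq_self]
        exact fun x => Subsingleton.elim _ _
      refine ⟨r, ?_⟩
      have hz : z = hmap R (0 + m) (detect h h'') (hmap R (0 + m) s z) :=
        (hmap_hmap_eq_self hs _ _).symm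
      rw [hz, e, map_add, hmap_detect_slice h h'' (by omega), add_zero, hu, map_smul]
      exact map_smul (hmap R (0 + m) (detect h h'')) r _
  | succ j ih =>
    intro K' h' hM
    obtain ⟨K, rfl⟩ : ∃ K, K' = K + m := ⟨j * m, by rw [← h', Nat.succ_mul]⟩
    have h : j * m = K := by rw [Nat.succ_mul] at h'; omega
    obtain ⟨ζ, h1, h2⟩ := ih K h (Nat.add_comm _ _)
    -- The second claim for j says that the smash power of the new class generates the homology of
    -- S^(K+m), because adding a letter before smashing is smashing with that letter.
    have e2 : ∀ z, ∃ r : R, z = r • hmap R (K + m) (smashPow h')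
        (hmap R (K + m) (consMap m j) (cross R K m _ ζ).1) := by
      intro z
      obtain ⟨r, hr⟩ := h2 z
      refine ⟨r, hr.trans ?_⟩
      rw [hmap_hmap_eq (h := detect h (Nat.add_comm m K))]
      rintro ⟨x, y⟩
      exact smashPow_cons h h' (Nat.add_comm m K) x y
    refine ⟨hmap R (K + m) (consMap m j) (cross R K m _ ζ).1, fun z => ?_, fun z => ?_⟩
    · obtain ⟨w, hw, rfl⟩ := muMap_surjective (by omega) z
      obtain ⟨u, rfl⟩ := exists_cross hw
      obtain ⟨r, rfl⟩ := h1 u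
      refine ⟨r, ?_⟩
      rw [← hmap_comp_apply R (K + m) (wordMap m (j + 1)), wordMap_cons, hmap_comp_apply,
        cross_natural, map_smul]
      exact map_smul (hmap R (K + m) (muMap m)) r _
    · obtain ⟨w, rfl⟩ := smash_surjective (R := R) hM hm (by omega) z
      obtain ⟨w', hw', e⟩ := exists_red_add (K + m + m) w
      obtain ⟨u, rfl⟩ := exists_cross hw'
      obtain ⟨r, rfl⟩ := e2 u
      refine ⟨r, ?_⟩
      rw [e, map_add, hmap_smash_slice hM (by omega), add_zero, detect,
        hmap_comp_apply, cross_natural, map_smul]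
      exact map_smul (hmap R (K + m + m) (smash hM)) r _

end Classes

/-! ### The homology of the fibre maps -/

theorem eq_singleton_of_pairwise {α : Type*} [Subsingleton α] {L : List α} {r : α → α → Prop}
    (hr : ∀ a, ¬ r a a) (a : α) (ha : a ∈ L) (hL : L.Pairwise r) : L = [a] := by
  match L, ha, hL with
  | [b], _, _ => rw [Subsingleton.elim a b]
  | b :: c :: l, _, hL =>
    have h := (List.pairwise_cons.1 hL).1 c (by simp)
    rw [Subsingleton.elim c b] at h
    exact absurd h (hr b)

/-- A word of length j has exactly one subsequence of j letters, so James' product has a single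
factor, whatever the order; the trailing constant loop is removed by a homotopy. -/
theorem IsJamesHopf.comp_wordMap {j m K : ℕ} {hK : j * m = K}
    {H : C(LoopSph (m + 1), LoopSph (K + 1))}
    (hH : IsJamesHopf hK H) :
    (H.comp (wordMap m j)).Homotopic ((suspLoop K).comp (smashPow hK)) := by
  obtain ⟨ord, hord⟩ := hH
  obtain ⟨L, hL, hp, hh⟩ := hord j
  have hs : Subsingleton (Fin j ↪o Fin j) := by
    refine ⟨fun f g => ?_⟩
    have key : ∀ f : Fin j ↪o Fin j, ∀ i, f i = i := fun f i => by
      have := Subsingleton.elim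
        (f.strictMono.orderIsoOfSurjective f (Finite.surjective_of_injective f.injective))
        (OrderIso.refl _)
      exact congrArg (fun e : Fin j ≃o Fin j => e i) this
    exact DFunLike.ext _ _ fun i => (key f i).trans (key g i).symm
  have hirr := ord.isStrictTotalOrder
  have e : L = [RelEmbedding.refl _] :=
    eq_singleton_of_pairwise (r := fun s t : Fin j ↪o Fin j =>
      ord.lt (s.trans (Fin.valOrderEmb j)) (t.trans (Fin.valOrderEmb j)))
      (fun a => irrefl_of ord.lt _) _ (hL _) hp
  subst e
  refine hh.trans ?_
  let A : C(LoopSph (K + 1), LoopSph (K + 1)) := ⟨fun w => w.trans (Path.refl ∞), by fun_prop⟩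
  have hA := trans_refl_homotopic A (fun _ => rfl)
  exact hA.comp (.refl ((suspLoop K).comp (smashPow hK)))

section Final

variable {R : Type} [CommRing R]

/-- Freeness of the source generator g is not assumed: if r g is in the kernel, then r c annihilates
u, and so r = 0. -/
theorem bijective_of_generators {A B : Type*} [AddCommGroup A] [AddCommGroup B] [Module R A]
    [Module R B] (f : A →ₗ[R] B) {g : A} {u : B} {c : R} (hg : ∀ z, ∃ r : R, z = r • g)
    (hu : ∀ z, ∃ r : R, z = r • u) (hu0 : ∀ r : R, r • u = 0 → r = 0) (hf : f g = c • u)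
    (hc : IsUnit c) : Function.Bijective f := by
  obtain ⟨c', hc'⟩ := hc.exists_left_inv
  constructor
  · refine (injective_iff_map_eq_zero f).2 fun z hz => ?_
    obtain ⟨r, rfl⟩ := hg z
    rw [map_smul, hf, smul_smul] at hz
    have h0 := hu0 _ hz
    have : r = 0 := by
      calc r = r * c * c' := by rw [mul_assoc, mul_comm c, hc', mul_one]
        _ = 0 := by rw [h0, zero_mul]
    rw [this, zero_smul]
  · intro z
    obtain ⟨r, rfl⟩ := hu z
    refine ⟨(r * c') • g, ?_⟩
    rw [map_smul, hf, smul_smul, mul_assoc, hc', mul_one]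

/-- Both groups have single generators, that of the target being free. After projection to the Moore
space, the image of the source generator is the image of a generator of H_M(S^M), so its coefficient
c is a unit modulo d. Locality and d not being a unit make c a unit. -/
theorem hmap_bijective_of_homotopic [IsLocalRing R] {d j m K M : ℕ}
    (hd : ¬ IsUnit (d : R)) (hm : 2 ≤ m) (hK : j * m = K) (hM : m + K = M)
    (H : C(LoopSph (m + 1), LoopSph (K + 1))) (hH : IsJamesHopf hK H)
    (h : C(PinchFiber d m, PinchFiber d M))
    (hh : ((PinchFiber.proj d M).comp (h.comp (PinchFiber.ofProd d m))).Homotopic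
      ((Moore.incl d M).comp ((collapse (by omega) hM).comp (idProd _ H)))) :
    Function.Bijective (hmap R M h) := by
  obtain rfl : M = K + m := by omega
  obtain ⟨ζ, hζ, hs⟩ := exists_wordClass (R := R) (by omega : 1 ≤ m) j K hK hM
  set s := hmap R (K + m) (detect hK hM) (cross R K m _ ζ).1 with hsdef
  -- The generator of H_M(F_n) is the cross product of [S^m] with the class of words of j letters.
  set g := hmap R (K + m) (PinchFiber.ofProd d m)
    (hmap R (K + m) (idProd _ (wordMap m j)) (cross R K m _ ζ).1) with hgdef
  have hg : ∀ z, ∃ r : R, z = r • g := by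
    intro z
    obtain ⟨u, hu, rfl⟩ := fiber_surjective (by omega) z
    obtain ⟨v, rfl⟩ := exists_cross hu
    obtain ⟨r, rfl⟩ := hζ v
    refine ⟨r, ?_⟩
    rw [hgdef, cross_natural, map_smul]
    exact map_smul (hmap R (K + m) (PinchFiber.ofProd d m)) r _
  have hpg : hmap R (K + m) (PinchFiber.proj d (K + m)) (hmap R (K + m) h g) =
      hmap R (K + m) (Moore.incl d (K + m)) s := by
    have h1 := hmap_congr_homotopic (R := R)
      (hh.comp (.refl (idProd (Sph m) (wordMap m j)))) (K + m) (cross R K m _ ζ).1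
    have h2 : ((collapse (by omega) hM).comp (idProd (Sph m) (H.comp (wordMap m j)))).Homotopic
        (detect hK hM) := by
      have e : detect hK hM = (collapse (by omega) hM).comp
          (idProd (Sph m) ((suspLoop K).comp (smashPow hK))) := by
        ext p
        exact (collapse_suspLoop (by omega) hM p.1 (smashPow hK p.2)).symm
      rw [e]
      refine (ContinuousMap.Homotopic.refl _).comp ?_
      exact ContinuousMap.Homotopic.prodMap (.refl _) hH.comp_wordMap
    have h3 := hmap_congr_homotopic (R := R) h2 (K + m) (cross R K m _ ζ).1
    rw [hsdef, ← h3, hgdef]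
    simp only [← hmap_comp_apply]
    exact h1
  obtain ⟨o, ho, ho0⟩ := exists_fundamental (R := R) (by omega : 1 ≤ K + m)
  obtain ⟨u, hu, hu1, hu0⟩ := fiber_fundamental (d := d) (by omega) ho ho0
  obtain ⟨a, ha⟩ := ho s
  obtain ⟨b, hb⟩ := hs o
  obtain ⟨c, hc⟩ := hu1 (hmap R (K + m) h g)
  have hab : b * a = 1 := by
    have : (b * a - 1) • o = 0 := by
      rw [sub_smul, mul_smul, ← ha, one_smul, sub_eq_zero]
      exact hb.symm
    exact sub_eq_zero.1 (ho0 _ this)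
  -- The projection of the target generator u is the image of o, so the two expressions for the
  -- projected class of h(g) differ by (c - a)o, which must die in the Moore space.
  have hcz : hmap R (K + m) (Moore.incl d (K + m)) ((c - a) • o) = 0 := by
    rw [map_smul, sub_smul, ← hu, ← map_smul, ← hc, hpg, hu, ha, map_smul, sub_self]
  obtain ⟨w, hw⟩ := exists_deg_of_incl_eq_zero hcz
  obtain ⟨t, rfl⟩ := ho w
  rw [hmap_degMap (by omega)] at hw
  have hca : c - a = d * t := by
    have : (c - a - d * t) • o = 0 := by
      rw [sub_smul, ← hw, mul_smul, sub_self]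
    exact sub_eq_zero.1 (ho0 _ this)
  -- Otherwise a = c - dt would be a sum of nonunits, but a is invertible because s and o generate
  -- the same free module of rank one.
  have hcu : IsUnit c := by
    by_contra hc'
    have h1 : (d : R) * t ∈ nonunits R := fun h => hd (isUnit_of_mul_isUnit_left h)
    have h2 : a ∈ nonunits R := by
      have e : a = c + -(d * t) := by rw [← hca]; ring
      rw [e]
      exact IsLocalRing.nonunits_add hc' (by simpa [mem_nonunits_iff] using h1)
    exact h2 (IsUnit.of_mul_eq_one b (by rw [mul_comm]; exact hab))
  exact bijective_of_generators _ hg hu1 hu0 hc hcu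

end Final

theorem isIso_homologyMap {p : ℕ} [hp : Fact p.Prime] {e n r : ℕ} (he : 1 ≤ e) (hn : 1 ≤ n)
    (hr : 1 ≤ r) (H : C(LoopSph (2 * n + 1), LoopSph (2 * (r - 1) * n + 1)))
    (hH : IsJamesHopf (k := r - 1) (m := 2 * n) (c := 2 * (r - 1) * n) (by ring) H)
    (h : C(F p e n, F p e (r * n)))
    (hh : (throughFiber h).Homotopic (throughHopf p e hn hr H)) :
    IsIso (homologyMap p (2 * (r * n)) h) := by
  have : (Ideal.span {(p : ℤ)}).IsPrime :=
    Ideal.isPrime_span_singleton_of_prime (Nat.prime_iff_prime_int.1 hp.out)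
  have hd : ¬ IsUnit ((p ^ e : ℕ) : ZLoc p) := by
    have hmem : algebraMap ℤ (ZLoc p) p ∈ IsLocalRing.maximalIdeal (ZLoc p) :=
      (IsLocalization.AtPrime.to_map_mem_maximal_iff (ZLoc p) (Ideal.span {(p : ℤ)}) _).2
        (Ideal.mem_span_singleton_self _)
    rw [IsLocalRing.mem_maximalIdeal, mem_nonunits_iff] at hmem
    rw [Nat.cast_pow, isUnit_pow_iff (by omega)]
    simpa using hmem
  have hb := hmap_bijective_of_homotopic (R := ZLoc p) hd (by omega : 2 ≤ 2 * n) _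
    (dim_eq n hr) H hH h hh
  rw [ConcreteCategory.isIso_iff_bijective]
  exact hb

/-! ### The construction of the fibre map -/

/-- The degree map reparametrizes the first coordinate, while the collapse uses the last coordinate
of x as loop parameter; for a ≥ 2 these are different coordinates, so the operations commute
strictly. -/
theorem degMap_collapse {d a K c : ℕ} (ha : 2 ≤ a) (h : a + K = c) (x : Sph a)
    (w : LoopSph (K + 1)) :
    collapse (by omega) h (degMap d a x, w) = degMap d c (collapse (by omega) h (x, w)) := by
  obtain ⟨b, rfl⟩ : ∃ b, a = b + 2 := ⟨a - 2, by omega⟩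
  obtain ⟨c, rfl⟩ : ∃ c', c = c' + 1 := ⟨c - 1, by omega⟩
  change collapse _ h (degFun d (b + 1) x, w) = degFun d c (collapse _ h (x, w))
  induction x using OnePoint.rec with
  | infty => rfl
  | coe v =>
    have e0 : ∀ v : Fin (b + 2) → ℝ, collapse (by omega) h ((v : Sph (b + 2)), w) =
      smash (a := b + 1) (b := K + 1) (by omega)
        (((fun i => v i.castSucc : Fin (b + 1) → ℝ) : Sph (b + 1)), w (unwind (v (Fin.last _)))) :=
      fun v => rfl
    have e1 : degFun d (b + 1) (v : Sph (b + 2)) = smash (Nat.add_comm 1 (b + 1))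
      (wind (d * unwind (v 0)), ((fun i => v i.succ : Fin (b + 1) → ℝ) : Sph (b + 1))) := rfl
    rw [e0 v, e1]
    by_cases hs : wind (d * unwind (v 0)) = ∞
    · rw [hs]
      change ∞ = _
      rcases hy : w (unwind (v (Fin.last _))) with _ | y
      · exact (congrArg (degFun d c) (smash_infty_right _ _)).symm
      · change ∞ = smash (Nat.add_comm 1 c) (wind (d * unwind (Fin.append _ y _)), _)
        have : Fin.append (fun i => v i.castSucc : Fin (b + 1) → ℝ) y
            (Fin.cast (by omega) (0 : Fin (c + 1))) = v 0 := by
          rw [append_eq_dite, dif_pos (by simp)]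
          rfl
        rw [this, hs]
        rfl
    · obtain ⟨s, hs'⟩ := OnePoint.ne_infty_iff_exists.1 hs
      rw [← hs', smash_cons, e0]
      have e2 : (Fin.cons (s 0) (fun i => v i.succ) : Fin (b + 2) → ℝ) (Fin.last _) =
          v (Fin.last _) :=
        Fin.cons_succ (n := b + 1) (α := fun _ => ℝ) (s 0) (fun i => v i.succ) (Fin.last b)
      rw [e2]
      rcases hy : w (unwind (v (Fin.last _))) with _ | y
      · exact (smash_infty_right _ _).trans (congrArg (degFun d c) (smash_infty_right _ _)).symm
      · change _ = smash (Nat.add_comm 1 c) (wind (d * unwind (Fin.append _ y _)), _)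
        have : Fin.append (fun i => v i.castSucc : Fin (b + 1) → ℝ) y
            (Fin.cast (by omega) (0 : Fin (c + 1))) = v 0 := by
          rw [append_eq_dite, dif_pos (by simp)]
          rfl
        rw [this, ← hs']
        refine Eq.trans ?_ (smash_cons _ _).symm
        change ((_ : Fin (c + 1) → ℝ) : Sph (c + 1)) = _
        congr 1
        funext i
        refine Fin.cases ?_ (fun i => ?_) i
        · simp only [Function.comp, append_eq_dite]
          rw [dif_pos (by simp)]
          rfl
        · simp only [Function.comp, append_eq_dite, Fin.cons_succ, Fin.val_cast]
          split_ifs with h1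
          · rfl
          · rfl

/-- The pullback of a proper map to a space of pairs is closed. -/
theorem isClosedMap_pairs {X Y W : Type*} [TopologicalSpace X] [TopologicalSpace Y]
    [TopologicalSpace W] {f : X → Y} (hf : IsProperMap f) (Q : Y × W → Prop) :
    IsClosedMap (fun z : {z : X × W // Q (f z.1, z.2)} =>
      (⟨(f z.1.1, z.1.2), z.2⟩ : {z : Y × W // Q z})) :=
  ((hf.prodMap (isProperMap_id (X := W))).isClosedMap).restrictPreimage {z | Q z}

/-- The path space of a sphere, as a space of pairs of a starting point and a path. -/
abbrev EndPath (m : ℕ) : Type := {z : Sph m × C(I, Sph m) // z.2 0 = z.1 ∧ z.2 1 = ∞}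

/-- Paths to the base point with a suspension coordinate of the starting point. -/
abbrev SuspPath (m : ℕ) : Type :=
  {z : (I × Sph m) × C(I, Sph (m + 1)) // z.2 0 = susp m z.1 ∧ z.2 1 = ∞}

/-! ### Closing up paths along suspension lines. -/

section Extend

variable {m : ℕ}

/-- The path from the base point down the suspension line, followed by the given path. -/
def extendFun (z : SuspPath m) (t : I) : Sph (m + 1) :=
  -- For suspension parameter u, the line from 1 to u takes length 1 - u and the path length 1,
  -- total 2 - u.
  if (t : ℝ) * (2 - z.1.1.1) ≤ 1 - z.1.1.1 then susp m (clamp (1 - t * (2 - z.1.1.1)), z.1.1.2)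
  else z.1.2 (clamp (t * (2 - z.1.1.1) - (1 - z.1.1.1)))

theorem continuous_extendFun : Continuous fun p : SuspPath m × I => extendFun p.1 p.2 := by
  refine Continuous.if_le ?_ ?_ (by fun_prop) (by fun_prop) ?_
  · fun_prop
  · fun_prop
  · intro p hp
    rw [hp, sub_self, clamp_of_nonpos le_rfl, p.1.2.1]
    congr 2
    rw [show 1 - (1 - (p.1.1.1.1 : ℝ)) = p.1.1.1.1 by ring, clamp_coe]

/-- The loop from the base point down the suspension line, followed by the given path. -/
def extend (m : ℕ) : C(SuspPath m, LoopSph (m + 1)) :=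
  toLoop (ContinuousMap.curry ⟨fun p : SuspPath m × I => extendFun p.1 p.2, continuous_extendFun⟩)
    (fun z => by
      change extendFun z 0 = ∞
      have := z.1.1.1.2.2
      rw [extendFun, if_pos (by simpa using this), susp_eq_infty_iff]
      right; left
      exact clamp_of_one_le (by simp))
    (fun z => by
      change extendFun z 1 = ∞
      have := z.1.1.1.2.2
      have h1 : ((1 : I) : ℝ) = 1 := rfl
      rw [extendFun, if_neg (by rw [h1]; linarith), clamp_of_one_le (by rw [h1]; linarith), z.2.2])

theorem extend_apply (z : SuspPath m) (t : I) : extend m z t = extendFun z t := rfl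

/-- With suspension parameter 1 the initial segment has length zero, so the loop equals the given
path on the nose; this is what makes the fibre map match on the sphere and the cone without a
homotopy. -/
theorem extend_one {x : Sph m} {g : C(I, Sph (m + 1))} (h : g 0 = susp m (1, x) ∧ g 1 = ∞) (t : I) :
    extend m ⟨((1, x), g), h⟩ t = g t := by
  rw [extend_apply, extendFun]
  split_ifs with ht
  · have : t = 0 := by
      have h1 : (t : ℝ) * (2 - 1) ≤ 1 - 1 := ht
      have h2 : (t : ℝ) ≤ 0 := by linarith
      exact Subtype.ext (le_antisymm h2 t.2.1)
    subst this
    rw [h.1]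
    congr 2
    exact clamp_of_one_le (by simp)
  · refine congrArg g (Eq.trans ?_ (clamp_coe t))
    refine congrArg clamp ?_
    change (t : ℝ) * (2 - 1) - (1 - 1) = t
    ring

end Extend

/-! ### Assembly of the fibre map. -/

section Build

variable {m K M : ℕ} (hm : 2 ≤ m) (hM : m + K = M) (H : C(LoopSph (m + 1), LoopSph (K + 1)))

/-- The sphere coordinate of the fibre map over the cone. -/
def coneVal : C(SuspPath m, Sph M) :=
  ⟨fun z => collapse (by omega) hM (z.1.1.2, H (extend m z)), by fun_prop⟩

theorem coneVal_infty {z : SuspPath m} (h : z.1.1.2 = ∞) : coneVal hm hM H z = ∞ := by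
  change collapse (Nat.lt_of_lt_of_le two_pos hm) hM (z.1.1.2, _) = ∞
  rw [h]
  rfl

/-- Forgetting the suspension coordinate. -/
def suspEnd (m : ℕ) : C(SuspPath m, EndPath (m + 1)) :=
  ⟨fun z => ⟨(susp m z.1.1, z.1.2), z.2⟩, by fun_prop⟩

theorem isQuotientMap_suspEnd (m : ℕ) : IsQuotientMap (suspEnd m) := by
  refine IsClosedMap.isQuotientMap ?_ (suspEnd m).continuous ?_
  · exact isClosedMap_pairs (susp m).continuous.isProperMap
      (fun z : Sph (m + 1) × C(I, Sph (m + 1)) => z.2 0 = z.1 ∧ z.2 1 = ∞)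
  · rintro ⟨⟨y, g⟩, hy⟩
    obtain ⟨p, rfl⟩ := susp_surjective m y
    exact ⟨⟨(p, g), hy⟩, rfl⟩

/-- The value of the map of path spaces at the starting point, on pairs. -/
def suspStart : C(SuspPath m, Sph (M + 1)) :=
  ⟨fun z => susp M (z.1.1.1, coneVal hm hM H z), by fun_prop⟩

theorem suspStart_eq_infty {z : SuspPath m} (h : susp m z.1.1 = ∞) : suspStart hm hM H z = ∞ := by
  have h' : z.1.1.1 = 0 ∨ z.1.1.1 = 1 ∨ z.1.1.2 = ∞ := (susp_eq_infty_iff _ _).1 h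
  refine (susp_eq_infty_iff _ _).2 ?_
  rcases h' with h | h | h
  · exact Or.inl h
  · exact Or.inr (Or.inl h)
  · exact Or.inr (Or.inr (coneVal_infty hm hM H h))

/-- Forgetting the suspension coordinate identifies points only over ∞, and there the value is ∞: t
is 0 or 1, or x = ∞ and the collapse is ∞. -/
theorem suspStart_factors : Function.FactorsThrough (suspStart hm hM H) (suspEnd m) := by
  intro z z' e
  have e1 : susp m z.1.1 = susp m z'.1.1 := congrArg (fun z : EndPath (m + 1) => z.1.1) e
  have e2 : z.1.2 = z'.1.2 := congrArg (fun z : EndPath (m + 1) => z.1.2) e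
  by_cases h0 : susp m z.1.1 = ∞
  · exact (suspStart_eq_infty hm hM H h0).trans
      (suspStart_eq_infty hm hM H (e1.symm.trans h0)).symm
  · obtain ⟨h1, h2⟩ := susp_inj h0 e1
    rw [show z = z' from Subtype.ext (Prod.ext (Prod.ext h1 h2) e2)]

/-- The value of the map of path spaces at the starting point. -/
def startVal : C(EndPath (m + 1), Sph (M + 1)) :=
  (isQuotientMap_suspEnd m).lift (suspStart hm hM H) (suspStart_factors hm hM H)

theorem startVal_suspEnd (z : SuspPath m) :
    startVal hm hM H (suspEnd m z) = susp M (z.1.1.1, coneVal hm hM H z) :=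
  (isQuotientMap_suspEnd m).lift_comp (suspStart hm hM H) (suspStart_factors hm hM H) |>
    fun e => DFunLike.congr_fun e z

theorem startVal_eq_infty {z : EndPath (m + 1)} (h : z.1.1 = ∞) : startVal hm hM H z = ∞ := by
  obtain ⟨y, rfl⟩ := (isQuotientMap_suspEnd m).surjective z
  rw [startVal_suspEnd]
  exact suspStart_eq_infty hm hM H h

/-- The tail of a path. -/
def tail (m : ℕ) : C(C(I, Sph m) × I, C(I, Sph m)) :=
  ContinuousMap.curry ⟨fun p : (C(I, Sph m) × I) × I => p.1.1 (max p.1.2 p.2), by fun_prop⟩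

/-- The points of the fibre over the sphere. -/
abbrev BasePart (d m : ℕ) : Type :=
  {z : Sph m × C(I, Sph (m + 1)) // z.2 0 = Moore.pinch d m (Moore.incl d m z.1) ∧ z.2 1 = ∞}

/-- The parametrization of the fibre by its parts over the sphere and over the cone. -/
def parts (d m : ℕ) : C(BasePart d m ⊕ SuspPath m, PinchFiber d m) :=
  ⟨Sum.elim (fun z => ⟨(Moore.incl d m z.1.1, z.1.2), z.2⟩)
    (fun z => ⟨(Moore.mk d m (Sum.inr z.1.1), z.1.2), z.2⟩),
    Continuous.sumElim (Continuous.subtype_mk (by fun_prop) _)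
      (Continuous.subtype_mk (by fun_prop) _)⟩

theorem isQuotientMap_parts (d m : ℕ) : IsQuotientMap (parts d m) := by
  refine IsClosedMap.isQuotientMap (IsClosedMap.sumElim ?_ ?_) (parts d m).continuous ?_
  · exact isClosedMap_pairs (f := Moore.incl d m)
      ((Moore.isProperMap_mk d m).comp IsClosedEmbedding.inl.isProperMap)
      (fun z : Moore d m × C(I, Sph (m + 1)) => z.2 0 = Moore.pinch d m z.1 ∧ z.2 1 = ∞)
  · exact isClosedMap_pairs (f := fun p => Moore.mk d m (Sum.inr p))
      ((Moore.isProperMap_mk d m).comp IsClosedEmbedding.inr.isProperMap)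
      (fun z : Moore d m × C(I, Sph (m + 1)) => z.2 0 = Moore.pinch d m z.1 ∧ z.2 1 = ∞)
  · rintro ⟨⟨y, g⟩, hy⟩
    obtain ⟨z, rfl⟩ := Quot.exists_rep y
    rcases z with x | p
    · exact ⟨Sum.inl ⟨(x, g), hy⟩, rfl⟩
    · exact ⟨Sum.inr ⟨(p, g), hy⟩, rfl⟩

/-- The loop of a point of the fibre over the sphere. -/
def baseLoop (d m : ℕ) : C(BasePart d m, LoopSph (m + 1)) :=
  toLoop ⟨fun z => z.1.2, by fun_prop⟩ (fun z => z.2.1) (fun z => z.2.2)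

/-- The Moore space coordinate of the fibre map on the parts of the fibre. -/
def partsVal (d : ℕ) : C(BasePart d m ⊕ SuspPath m, Moore d M) :=
  ⟨Sum.elim (fun z => Moore.incl d M (collapse (by omega) hM (z.1.1, H (baseLoop d m z))))
    (fun z => Moore.mk d M (Sum.inr (z.1.1.1, coneVal hm hM H z))),
    Continuous.sumElim (by fun_prop) (by fun_prop)⟩

/-- The part of the fibre with a given representative of the point of the Moore space. -/
def toParts {d m : ℕ} : (z : Sph m ⊕ (I × Sph m)) → (g : C(I, Sph (m + 1))) →
    (g 0 = Moore.pinch d m (Moore.mk d m z) ∧ g 1 = ∞) → BasePart d m ⊕ SuspPath m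
  | Sum.inl x, g, h => Sum.inl ⟨(x, g), h⟩
  | Sum.inr p, g, h => Sum.inr ⟨(p, g), h⟩

/-- Points of the Moore space are classes of the generated relation, so it suffices to check the
generating identifications, with the path g held fixed. Only the gluing at t = 1 has content. -/
theorem partsVal_toParts {d : ℕ} {z z' : Sph m ⊕ (I × Sph m)}
    (e : Relation.EqvGen (MooreRel d m) z z') (g : C(I, Sph (m + 1)))
    (h : g 0 = Moore.pinch d m (Moore.mk d m z) ∧ g 1 = ∞)
    (h' : g 0 = Moore.pinch d m (Moore.mk d m z') ∧ g 1 = ∞) :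
    partsVal hm hM H d (toParts z g h) = partsVal hm hM H d (toParts z' g h') := by
  induction e with
  | rel z z' e =>
    cases e with
    | glue x =>
      change Moore.mk d M (Sum.inr (1, coneVal hm hM H ⟨((1, x), g), h⟩)) =
        Moore.mk d M (Sum.inl (collapse (Nat.lt_of_lt_of_le two_pos hm) hM (degMap d m x,
          H (baseLoop d m ⟨(degMap d m x, g), h'⟩))))
      -- The degree map is moved past the collapse, so that the gluing relation of the target Moore
      -- space applies.
      rw [degMap_collapse hm hM]
      refine (Quot.sound (MooreRel.glue _)).trans ?_
      change Moore.mk d M (Sum.inl (degMap d M (collapse (Nat.lt_of_lt_of_le two_pos hm) hM (x,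
        H (extend m ⟨((1, x), g), h⟩))))) = _
      have : extend m ⟨((1, x), g), h⟩ = baseLoop d m ⟨(degMap d m x, g), h'⟩ := by
        ext t
        exact extend_one h t
      rw [this]
    | apex x => exact Quot.sound (MooreRel.apex _)
    | base t =>
      change Moore.mk d M (Sum.inr (t, coneVal hm hM H ⟨((t, ∞), g), h⟩)) = _
      rw [coneVal_infty hm hM H rfl]
      exact Quot.sound (MooreRel.base _)
  | refl => rfl
  | symm _ _ _ ih => exact (ih h' h).symm
  | trans x y z e₁ _ ih₁ ih₂ =>
    have e : Moore.mk d m x = Moore.mk d m y := Quot.eqvGen_sound e₁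
    have h'' := h
    rw [e] at h''
    exact (ih₁ h h'').trans (ih₂ h'' h')

theorem partsVal_factors (d : ℕ) : Function.FactorsThrough (partsVal hm hM H d) (parts d m) := by
  have key : ∀ z : BasePart d m ⊕ SuspPath m, ∃ (y : Sph m ⊕ (I × Sph m)) (g : C(I, Sph (m + 1)))
      (h : g 0 = Moore.pinch d m (Moore.mk d m y) ∧ g 1 = ∞), z = toParts y g h := by
    rintro (⟨⟨x, g⟩, h⟩ | ⟨⟨p, g⟩, h⟩)
    · exact ⟨Sum.inl x, g, h, rfl⟩
    · exact ⟨Sum.inr p, g, h, rfl⟩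
  have val : ∀ (y : Sph m ⊕ (I × Sph m)) (g : C(I, Sph (m + 1)))
      (h : g 0 = Moore.pinch d m (Moore.mk d m y) ∧ g 1 = ∞),
      (parts d m (toParts y g h)).1 = (Moore.mk d m y, g) := by
    rintro (x | p) g h <;> rfl
  intro z z' e
  obtain ⟨y, g, h, rfl⟩ := key z
  obtain ⟨y', g', h', rfl⟩ := key z'
  have e' := congrArg Subtype.val e
  rw [val, val, Prod.mk.injEq] at e'
  obtain ⟨e1, rfl⟩ := e'
  exact partsVal_toParts hm hM H (Quot.eqvGen_exact e1) g _ _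

/-- The Moore space coordinate of the fibre map. -/
def mooreVal (d : ℕ) : C(PinchFiber d m, Moore d M) :=
  (isQuotientMap_parts d m).lift (partsVal hm hM H d) (partsVal_factors hm hM H d)

theorem mooreVal_parts (d : ℕ) (z : BasePart d m ⊕ SuspPath m) :
    mooreVal hm hM H d (parts d m z) = partsVal hm hM H d z :=
  DFunLike.congr_fun ((isQuotientMap_parts d m).lift_comp (partsVal hm hM H d)
    (partsVal_factors hm hM H d)) z

/-- The tails of the path of a point of the fibre. -/
def tails (d m : ℕ) : C(PinchFiber d m × I, EndPath (m + 1)) :=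
  ⟨fun p => ⟨(p.1.1.2 p.2, tail (m + 1) (p.1.1.2, p.2)), by
    constructor
    · exact congrArg p.1.1.2 (max_eq_left (b := (0 : I)) p.2.2.1)
    · exact (congrArg p.1.1.2 (max_eq_right (b := (1 : I)) p.2.2.2)).trans p.1.2.2⟩, by
    have h : Continuous fun p : PinchFiber d m × I => p.1.1.2 :=
      continuous_snd.comp (continuous_subtype_val.comp continuous_fst)
    refine Continuous.subtype_mk (Continuous.prodMk ?_ ?_) _
    · exact h.eval continuous_snd
    · exact (tail (m + 1)).continuous.comp (h.prodMk continuous_snd)⟩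

/-- Over the sphere both sides are ∞. Over the cone both are the suspension, with unchanged t, of
the same value, since the tail of a path at time 0 is the path. -/
theorem pinch_mooreVal (d : ℕ) (z : PinchFiber d m) :
    Moore.pinch d M (mooreVal hm hM H d z) = startVal hm hM H (tails d m (z, 0)) := by
  obtain ⟨y, rfl⟩ := (isQuotientMap_parts d m).surjective z
  rw [mooreVal_parts]
  rcases y with y | y
  · refine Eq.trans (b := ∞) rfl (startVal_eq_infty hm hM H ?_).symm
    exact y.2.1
  · change susp M (y.1.1.1, coneVal hm hM H y) = _
    rw [← startVal_suspEnd]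
    congr 1
    refine Subtype.ext (Prod.ext ?_ ?_)
    · exact y.2.1.symm
    · ext t : 1
      exact congrArg y.1.2 (max_eq_right (a := (0 : I)) t.2.1).symm

/-- The path coordinate of the fibre map. -/
def pathVal (d : ℕ) : C(PinchFiber d m, C(I, Sph (M + 1))) :=
  ContinuousMap.curry ((startVal hm hM H).comp (tails d m))

theorem pathVal_zero (d : ℕ) (z : PinchFiber d m) :
    pathVal hm hM H d z 0 = Moore.pinch d M (mooreVal hm hM H d z) :=
  (pinch_mooreVal hm hM H d z).symm

theorem pathVal_eq_infty {d : ℕ} {z : PinchFiber d m} {t : I} (h : z.1.2 t = ∞) :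
    pathVal hm hM H d z t = ∞ :=
  startVal_eq_infty hm hM H h

/-- The fibre map. -/
def fiberMap (d : ℕ) : C(PinchFiber d m, PinchFiber d M) where
  toFun z := ⟨(mooreVal hm hM H d z, pathVal hm hM H d z), pathVal_zero hm hM H d z,
    pathVal_eq_infty hm hM H z.2.2⟩
  continuous_toFun := Continuous.subtype_mk
    ((mooreVal hm hM H d).continuous.prodMk (pathVal hm hM H d).continuous) _

theorem proj_fiberMap_ofProd (d : ℕ) (p : Sph m × LoopSph (m + 1)) :
    PinchFiber.proj d M (fiberMap hm hM H d (PinchFiber.ofProd d m p)) =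
      Moore.incl d M (collapse (by omega) hM (p.1, H p.2)) :=
  mooreVal_parts hm hM H d (Sum.inl ⟨(p.1, p.2.toContinuousMap), p.2.source, p.2.target⟩)

theorem fiberMap_base (d : ℕ) : fiberMap hm hM H d (PinchFiber.base d m) = PinchFiber.base d M := by
  refine Subtype.ext (Prod.ext ?_ ?_)
  · exact proj_fiberMap_ofProd hm hM H d (prodBase m)
  · ext t : 1
    exact pathVal_eq_infty hm hM H rfl

end Build

end HopfFiber

end

open HopfFiber in
theorem corollary5p2 (p : ℕ) [Fact p.Prime] (e n r : ℕ) (_he : 1 ≤ e) (hn : 1 ≤ n) (hr : 1 ≤ r)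
    (H : C(LoopSph (2 * n + 1), LoopSph (2 * (r - 1) * n + 1)))
    (_hH : IsJamesHopf (k := r - 1) (m := 2 * n) (c := 2 * (r - 1) * n) (by ring) H) :
    (∃ h : C(F p e n, F p e (r * n)),
      h (PinchFiber.base (p ^ e) (2 * n)) = PinchFiber.base (p ^ e) (2 * (r * n)) ∧
      ContinuousMap.HomotopicRel (throughFiber h) (throughHopf p e hn hr H) {prodBase (2 * n)}) ∧
    (∀ h : C(F p e n, F p e (r * n)),
      ContinuousMap.Homotopic (throughFiber h) (throughHopf p e hn hr H) →
        CategoryTheory.IsIso (homologyMap p (2 * (r * n)) h)) := by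
  refine ⟨⟨fiberMap (by omega) (dim_eq n hr) H (p ^ e), fiberMap_base _ _ H _, ?_⟩,
    fun h hh => isIso_homologyMap _he hn hr H _hH h hh⟩
  -- The two compositions coincide as maps, so the constant homotopy, which fixes the base point, is
  -- enough.
  have : throughFiber (fiberMap (by omega) (dim_eq n hr) H (p ^ e)) = throughHopf p e hn hr H :=
    ContinuousMap.ext (proj_fiberMap_ofProd (by omega) (dim_eq n hr) H (p ^ e))
  rw [this]
  exact ContinuousMap.HomotopicRel.refl _
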